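/- Let $\theta\in[0,1)$ be irrational, $\varepsilon\in\{-1,1\}$, $\omega=(\theta,\varepsilon)$. **The system.** Put $f_{-1}(x)=x$, $f_1(x)=1-x$, $\mathcal C=[0,1]^2$, $\mathcal R_\theta=[1,1+\theta]\times[0,1]$. The map $T_\omega$ is defined on $\mathring{\mathcal C}\cup\mathring{\mathcal R}_\theta$ by $T_\omega(x,y)=(1+\theta-y,\,f_\varepsilon(x))$ on $\mathring{\mathcal C}$ and $T_\omega(x,y)=(x-1,\,1-y)$ on $\mathring{\mathcal R}_\theta$. Let $\mathcal X_\omega$ be the set of points of $\mathcal C\cup\mathcal R_\theta$ whose orbit under $T_\omega$ never meets $\partial\mathcal C\cup\partial\mathcal R_\theta$. The coding of $z\in\mathcal X_\omega$ is the infinite word over $\{a,b\}$ whose $n$-th letter is $a$ if $T_\omega^n z\in\mathcal C$ and $b$ if $T_\omega^nz\in\mathcal R_\theta$. Let $\mathcal I_\omega(n)$ be the set of points of $\mathcal X_\omega$ whose coding is a periodic word of period at most $n$. The aperiodic set is $\mathcal K_\omega=\bigcap_{n}\overline{\mathcal X_\omega\setminus\mathcal I_\omega(n)}$. **The word.** For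 $\omega=(\theta,\varepsilon)$ let $n_\omega=\lfloor 1/f_\varepsilon(\theta)\rfloor$ and $S(\omega)=\left(1/f_\varepsilon(\theta)-n_\omega,\,(-1)^{n_\omega+1}\right)$. Let $\sigma_\omega$ be the substitution with $\sigma_\omega(b)=aab$ and with $\sigma_\omega(a)=ab(aab)^{n_\omega-1}$ if $\varepsilon=-1$, $\sigma_\omega(a)=a(aab)^{n_\omega-1}$ if $\varepsilon=1$. **Statement.** The finite words $\sigma_\omega\circ\sigma_{S\omega}\circ\cdots\circ\sigma_{S^\ell\omega}(a)$ converge, as $\ell\to\infty$, to an infinite word $u_\omega$, and $u_\omega$ is Sturmian (it has exactly $n+1$ factors of length $n$ for every $n\ge0$). Let $t$ be the shift and $\Sigma_\omega=\overline{\{t^nu_\omega : n\in\mathbb N\}}$. Then $(\Sigma_\omega,t)$ has a unique invariant Borel probability measure $\tilde\mu_\omega$, and there is a continuous map $h:\Sigma_\omega\to\mathbb R^2$ with image $h(\Sigma_\omega)=\mathcal K_\omega$ such that - $T_\omega(h(v))=h(t v)$ for every $v\in\Sigma_\omega$ such that $h(v)$ is in the domain $\mathring{\mathcal C}\cup\mathring{\mathcal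 R}_\theta$ of $T_\omega$, and $h(v)\in\mathcal X_\omega$ for $\tilde\mu_\omega$-almost every $v$; - $h$ is almost everywhere injective: for $\tilde\mu_\omega$-almost every $v\in\Sigma_\omega$, $v$ is the only point of $\Sigma_\omega$ whose image is $h(v)$; - with the image measure $\mu=h_*\tilde\mu_\omega$, the dynamical system $(\mathcal K_\omega,T_\omega,\mu)$ is measurably conjugate to a rotation of the circle $\mathbb R/\mathbb Z$ by some irrational number $\alpha$, equipped with Lebesgue measure. That is, there are measurable sets $A\subseteq\mathcal K_\omega\cap\mathcal X_\omega$ and $B\subseteq\mathbb R/\mathbb Z$ of full measure, invariant under $T_\omega$ and under the rotation respectively, and a bimeasurable bijection $A\to B$ that intertwines the two maps and sends $\mu$ to Lebesgue measure. -/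

import Mathlib

open Set Filter Topology MeasureTheory

noncomputable section

namespace PiecewiseSquare

/-! ### The piecewise isometry

A parameter is a pair `ω = (θ, ε)` with `0 ≤ θ < 1` and `ε = ±1`. -/

/-- The parameter space `Ω = [0,1[ × {-1,1}` is `{ω : Param | 0 ≤ ω.1 ∧ ω.1 < 1}`. -/
abbrev Param : Type := ℝ × ℤˣ

/-- `f_ε(x) = x` if `ε = -1`, and `1 - x` if `ε = 1`. -/
def flip (ε : ℤˣ) (x : ℝ) : ℝ := if ε = -1 then x else 1 - x

/-- The closed unit square `[0,1]²`. -/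
def square : Set (ℝ × ℝ) := Icc 0 1 ×ˢ Icc 0 1

/-- The closed rectangle `[1,1+θ] × [0,1]`. -/
def rect (θ : ℝ) : Set (ℝ × ℝ) := Icc 1 (1 + θ) ×ˢ Icc 0 1

/-- The union of the boundaries of the square and of the rectangle. -/
def boundarySet (θ : ℝ) : Set (ℝ × ℝ) := frontier square ∪ frontier (rect θ)

/-- The domain of `T_ω`: the union of the interiors of the square and of the rectangle. -/
def domT (ω : Param) : Set (ℝ × ℝ) := interior square ∪ interior (rect ω.1)

open Classical in
/-- The map `T_ω`. It is meaningful on `domT ω` only; outside it is given the junk value `z`. -/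
def T (ω : Param) (z : ℝ × ℝ) : ℝ × ℝ :=
  if z ∈ interior square then (1 + ω.1 - z.2, flip ω.2 z.1)
  else if z ∈ interior (rect ω.1) then (z.1 - 1, 1 - z.2)
  else z

/-- `X_ω`: the points of the square and the rectangle whose orbit never meets the boundary set,
that is, the points with a well defined infinite `T_ω`-orbit. -/
def regularSet (ω : Param) : Set (ℝ × ℝ) :=
  {z | z ∈ square ∪ rect ω.1 ∧ ∀ k : ℕ, (T ω)^[k] z ∉ boundarySet ω.1}

/-! ### Coding and the aperiodic set -/

/-- The two letters: `a = false`, `b = true`. -/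
abbrev Letter : Type := Bool

/-- The letter `a`. -/
abbrev la : Letter := false

/-- The letter `b`. -/
abbrev lb : Letter := true

open Classical in
/-- The coding of a point: the `n`-th letter is `a` if the first coordinate of `T_ω^n z` is
smaller than `1`, and `b` otherwise. -/
def coding (ω : Param) (z : ℝ × ℝ) : ℕ → Letter :=
  fun n => if ((T ω)^[n] z).1 < 1 then la else lb

/-- The union of the periodic cells of period at most `n`: the points of `X_ω` whose coding is a
periodic word of some period `p` with `1 ≤ p ≤ n`. -/
def periodicCells (ω : Param) (n : ℕ) : Set (ℝ × ℝ) :=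
  {z | z ∈ regularSet ω ∧
    ∃ p : ℕ, 1 ≤ p ∧ p ≤ n ∧ ∀ k : ℕ, coding ω z (k + p) = coding ω z k}

/-- The aperiodic set `K_ω = ⋂ₙ closure (X_ω \ I_ω(n))`. -/
def aperiodicSet (ω : Param) : Set (ℝ × ℝ) :=
  ⋂ n : ℕ, closure (regularSet ω \ periodicCells ω n)

/-! ### The renormalization map and the substitutions -/

/-- `n_ω = ⌊1 / f_ε(θ)⌋`. -/
def digit (ω : Param) : ℕ := ⌊1 / flip ω.2 ω.1⌋₊

/-- The renormalization map `S(θ, ε) = (1 / f_ε(θ) - n_ω, (-1)^(n_ω + 1))`. -/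
def S (ω : Param) : Param :=
  (1 / flip ω.2 ω.1 - digit ω, (-1) ^ (digit ω + 1))

/-- The substitution `σ_ω`: for `ε = -1` it is `a ↦ ab(aab)^(n_ω-1)`, `b ↦ aab`; for `ε = 1` it is
`a ↦ a(aab)^(n_ω-1)`, `b ↦ aab`. -/
def subst (ω : Param) : Letter → List Letter
  | false => (if ω.2 = -1 then [la, lb] else [la]) ++
      (List.replicate (digit ω - 1) [la, la, lb]).flatten
  | true => [la, la, lb]

/-- The extension of `σ_ω` to finite words by concatenation. -/
def substWord (ω : Param) (w : List Letter) : List Letter := w.flatMap (subst ω)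

/-- The finite word `σ_ω ∘ σ_{Sω} ∘ ⋯ ∘ σ_{S^ℓ ω} (a)`. -/
def sadicPrefix : ℕ → Param → List Letter
  | 0, ω => substWord ω [la]
  | ℓ + 1, ω => substWord ω (sadicPrefix ℓ (S ω))

/-- `u` is the limit of the sequence of finite words `w`: for every `n`, the `n`-th letter of
`w ℓ` exists and equals `u n` as soon as `ℓ` is large enough. -/
def IsLimitWord (w : ℕ → List Letter) (u : ℕ → Letter) : Prop :=
  ∀ n : ℕ, ∀ᶠ ℓ in atTop, (w ℓ)[n]? = some (u n)

/-- The set `L_n(u)` of the words of length `n` which appear in `u`. -/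
def factors (u : ℕ → Letter) (n : ℕ) : Set (List Letter) :=
  {w | ∃ i : ℕ, w = List.ofFn (fun j : Fin n => u (i + j))}

/-- `u` is Sturmian: it has exactly `n + 1` factors of length `n`, for every `n`. -/
def IsSturmian (u : ℕ → Letter) : Prop := ∀ n : ℕ, (factors u n).ncard = n + 1

/-! ### The subshift generated by a word -/

/-- The one-sided shift. -/
def shift (v : ℕ → Letter) : ℕ → Letter := fun n => v (n + 1)

/-- The closure (in the product topology) of the orbit of `u` under the shift. -/
def subshift (u : ℕ → Letter) : Set (ℕ → Letter) :=
  closure (range fun n : ℕ => shift^[n] u)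

theorem continuous_shift : Continuous shift :=
  continuous_pi fun n => continuous_apply (n + 1)

theorem mapsTo_shift (u : ℕ → Letter) : MapsTo shift (subshift u) (subshift u) := by
  refine MapsTo.closure ?_ continuous_shift
  rintro _ ⟨n, rfl⟩
  exact ⟨n + 1, Function.iterate_succ_apply' shift n u⟩

/-- The shift restricted to the subshift generated by `u`. -/
def subshiftMap (u : ℕ → Letter) : subshift u → subshift u :=
  (mapsTo_shift u).restrict shift (subshift u) (subshift u)

/-! ### Measurable conjugacy -/

/-- Measurable conjugacy of `(D, F, μ)` with `(Y, G, ν)`, where the map `F` needs to be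
meaningful on `D` only: there are invariant measurable sets `A ⊆ D` and `B` of full measure and a
bimeasurable bijection between `A` and `B` which intertwines `F` and `G` and transports `μ`
to `ν`. -/
def IsMeasurablyConjugate {X Y : Type*} [MeasurableSpace X] [MeasurableSpace Y]
    (D : Set X) (F : X → X) (μ : Measure X) (G : Y → Y) (ν : Measure Y) : Prop :=
  ∃ (A : Set X) (B : Set Y) (φ : X → Y) (ψ : Y → X),
    A ⊆ D ∧ MeasurableSet A ∧ MeasurableSet B ∧ μ Aᶜ = 0 ∧ ν Bᶜ = 0 ∧
    MapsTo F A A ∧ MapsTo G B B ∧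
    Measurable φ ∧ Measurable ψ ∧ MapsTo φ A B ∧ MapsTo ψ B A ∧
    LeftInvOn ψ φ A ∧ RightInvOn ψ φ B ∧
    (∀ x ∈ A, φ (F x) = G (φ x)) ∧ μ.map φ = ν

end PiecewiseSquare

end

/-!
The system belongs to a family of piecewise isometries `geo (ℓ, ε)` of rectangles `[0, ℓ] × [0, 1]`,
`ℓ > 1`, which is closed under renormalization: the map induced on a subrectangle is similar to
another member of the family. Three elementary steps suffice. If `ℓ > 2`, a unit square is cut off
(`Kind.cut`, with ratio `1`); if `ℓ < 2`, the new domain is the image of a longer rectangle by a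
contraction (`Kind.rot` or `Kind.refl`, according to `ε`). Each step replaces a letter by a block of
letters (`Good.renorm`), and `σ_ω` is a `rot` or `refl` step followed by `n_ω - 1` steps `cut`
(`substWord_eq_iterBlock`). Since `cut` steps and other steps both occur infinitely often, the
heights of the towers above the renormalized domains tend to infinity, and the substituted words
converge (`Mixing.exists_isLimit`, `IsLimit.isLimitWord`).

A generic point is periodic of period at most `2`, or its orbit passes through the renormalized
domain (`Gen.exists_lift`); iterating this, a point without a short period belongs to a tower of
high level (`Gen.exists_iterLift`). The pairs formed by a generic point and its coding, the periods
tending to infinity, accumulate on a compact set `limitSet` of pairs (word, point). The words which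
appear are those of the subshift of the limit word. As the scales of the renormalized domains tend
to `0`, a word determines its point (`eq_of_mem_limitSet`), so `limitSet` is the graph of a
continuous map `h` (`exists_parametrization`), whose image is the aperiodic set (`aperiodicSet_eq`).
The map `h` intertwines the shift and the piecewise isometry away from the sides of the rectangles,
and a regular point has only one preimage, namely its coding.

It remains to see that the sides are negligible for every invariant measure. The floors of a tower
of level `k` which meet the sides are disjoint, have area comparable to `λ²`, where `λ` is the
scale, and lie within a distance comparable to `λ` of the sides; so there are at most `const / λ` of
them (`Good.card_touching_le`). On the other hand there are levels for which the height of the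
towers is arbitrarily large compared with `1 / λ` (`Good.exists_high_towers`), so orbits visit the
sides with frequency zero (`Good.card_visits_le`, `ae_codes`).

The dynamics of the subshift comes from a second model of the same substitutions: exchanges of two
intervals, that is rotations of a circle, are renormalized by the same blocks (`iet_renorm`). A
compactness argument yields a compatible sequence of lengths, hence a rotation coded by the limit
word, with an irrational angle since this word is not eventually periodic
(`IsLimit.exists_codesRotation`). Therefore the word is Sturmian (`CodesRotation.isSturmian`), and
the subshift is semiconjugate to the rotation by a map which is invertible outside a countable set
(`CodesRotation.exists_semiconj`). Unique ergodicity of irrational rotations then gives that of the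
subshift (`eq_map_volume`), and together with the injectivity of `h` almost everywhere it gives the
conjugacy (`isMeasurablyConjugate`).
-/

open Set Filter Topology MeasureTheory

noncomputable section

namespace PiecewiseSquare

/-! ### Block substitutions on infinite words -/

/-- The three elementary renormalization steps. -/
inductive Kind
  | cut
  | rot
  | refl

/-- The block substituted for a letter by an elementary step. The macroscopic substitution `σ_ω`
is a `rot` or `refl` step followed by `n_ω - 1` steps `cut`. -/
def block : Kind → Letter → List Letter
  | .cut, false => [false, true]
  | .cut, true => [true]
  | .rot, false => [false, true]
  | .rot, true => [false, false, true]
  | .refl, false => [false]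
  | .refl, true => [false, false, true]

/-- The length of a block. -/
def blockLen (κ : Kind) (c : Letter) : ℕ := (block κ c).length

theorem blockLen_pos (κ : Kind) (c : Letter) : 0 < blockLen κ c := by
  cases κ <;> cases c <;> simp [blockLen, block]

theorem blockLen_le (κ : Kind) (c : Letter) : blockLen κ c ≤ 3 := by
  cases κ <;> cases c <;> simp [blockLen, block]

/-- The extension of a block substitution to infinite words. -/
def substSeq (κ : Kind) (v : ℕ → Letter) (n : ℕ) : Letter :=
  if n < blockLen κ (v 0) then (block κ (v 0)).getD n la
  else substSeq κ (shift v) (n - blockLen κ (v 0))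
termination_by n
decreasing_by
  have := blockLen_pos κ (v 0)
  omega

theorem substSeq_of_lt {κ : Kind} {v : ℕ → Letter} {n : ℕ} (h : n < blockLen κ (v 0)) :
    substSeq κ v n = (block κ (v 0)).getD n la := by
  rw [substSeq, if_pos h]

theorem substSeq_add (κ : Kind) (v : ℕ → Letter) (n : ℕ) :
    substSeq κ v (n + blockLen κ (v 0)) = substSeq κ (shift v) n := by
  rw [substSeq, if_neg (by omega), Nat.add_sub_cancel]

theorem iterate_shift_apply (v : ℕ → Letter) (n i : ℕ) : shift^[n] v i = v (i + n) := by
  induction n generalizing v with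
  | zero => rfl
  | succ n ih => rw [Function.iterate_succ_apply, ih]; simp only [shift]; congr 1

theorem shift_substSeq (κ : Kind) (v : ℕ → Letter) :
    shift^[blockLen κ (v 0)] (substSeq κ v) = substSeq κ (shift v) := by
  funext n
  rw [iterate_shift_apply, substSeq_add]

/-- The total weight of the first `m` letters of a word. -/
def wsum (w : Letter → ℕ) (v : ℕ → Letter) (m : ℕ) : ℕ := ∑ i ∈ Finset.range m, w (v i)

@[simp] theorem wsum_zero (w : Letter → ℕ) (v : ℕ → Letter) : wsum w v 0 = 0 := rfl

theorem wsum_succ (w : Letter → ℕ) (v : ℕ → Letter) (m : ℕ) :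
    wsum w v (m + 1) = wsum w v m + w (v m) := Finset.sum_range_succ _ _

theorem wsum_one (w : Letter → ℕ) (v : ℕ → Letter) : wsum w v 1 = w (v 0) := by
  rw [wsum_succ, wsum_zero, zero_add]

theorem wsum_succ' (w : Letter → ℕ) (v : ℕ → Letter) (m : ℕ) :
    wsum w v (m + 1) = w (v 0) + wsum w (shift v) m := by
  rw [wsum, Finset.sum_range_succ', add_comm]; rfl

theorem wsum_add (w : Letter → ℕ) (v : ℕ → Letter) (m n : ℕ) :
    wsum w v (m + n) = wsum w v m + wsum w (shift^[m] v) n := by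
  rw [wsum, Finset.sum_range_add]
  congr 1
  exact Finset.sum_congr rfl fun i _ => by rw [iterate_shift_apply, add_comm]

theorem wsum_const_one (v : ℕ → Letter) (m : ℕ) : wsum (fun _ => 1) v m = m := by
  simp [wsum]

theorem wsum_congr (w : Letter → ℕ) {v v' : ℕ → Letter} {m : ℕ} (h : ∀ i < m, v i = v' i) :
    wsum w v m = wsum w v' m :=
  Finset.sum_congr rfl fun i hi => by rw [h i (Finset.mem_range.1 hi)]

theorem wsum_mono (w : Letter → ℕ) (v : ℕ → Letter) {m n : ℕ} (h : m ≤ n) :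
    wsum w v m ≤ wsum w v n :=
  Finset.sum_le_sum_of_subset (Finset.range_subset_range.2 h)

theorem le_wsum {w : Letter → ℕ} (hw : ∀ c, 0 < w c) (v : ℕ → Letter) (m : ℕ) :
    m ≤ wsum w v m := by
  induction m with
  | zero => simp
  | succ m ih => rw [wsum_succ]; have := hw (v m); omega

theorem wsum_strictMono {w : Letter → ℕ} (hw : ∀ c, 0 < w c) (v : ℕ → Letter) :
    StrictMono (wsum w v) :=
  strictMono_nat_of_lt_succ fun m => by rw [wsum_succ]; have := hw (v m); omega

/-- Every index lies in exactly one block. -/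
theorem exists_wsum_add_lt {w : Letter → ℕ} (hw : ∀ c, 0 < w c) (v : ℕ → Letter) (n : ℕ) :
    ∃ m r, n = wsum w v m + r ∧ r < w (v m) := by
  induction n with
  | zero => exact ⟨0, 0, rfl, hw _⟩
  | succ n ih =>
    obtain ⟨m, r, rfl, hr⟩ := ih
    by_cases h : r + 1 < w (v m)
    · exact ⟨m, r + 1, by omega, h⟩
    · exact ⟨m + 1, 0, by rw [wsum_succ]; omega, hw _⟩

theorem iterate_shift_substSeq (κ : Kind) (v : ℕ → Letter) (m : ℕ) :
    shift^[wsum (blockLen κ) v m] (substSeq κ v) = substSeq κ (shift^[m] v) := by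
  induction m with
  | zero => rfl
  | succ m ih =>
    rw [wsum_succ, add_comm, Function.iterate_add_apply, ih, Function.iterate_succ_apply']
    have := shift_substSeq κ (shift^[m] v)
    rwa [iterate_shift_apply, zero_add] at this

/-- The weight of blocks: `push κ w c` is the `w`-weight of the block of `c`. -/
def push (κ : Kind) (w : Letter → ℕ) (c : Letter) : ℕ := ((block κ c).map w).sum

theorem push_one (κ : Kind) : push κ (fun _ => 1) = blockLen κ := by
  funext c; simp [push, blockLen]

theorem wsum_substSeq_block (κ : Kind) (w : Letter → ℕ) (v : ℕ → Letter) :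
    wsum w (substSeq κ v) (blockLen κ (v 0)) = push κ w (v 0) := by
  rw [wsum, Finset.sum_congr rfl fun i hi => by rw [substSeq_of_lt (Finset.mem_range.1 hi)]]
  generalize v 0 = c
  cases κ <;> cases c <;> simp [push, block, blockLen, Finset.sum_range_succ, add_assoc]

theorem wsum_substSeq (κ : Kind) (w : Letter → ℕ) (v : ℕ → Letter) (m : ℕ) :
    wsum w (substSeq κ v) (wsum (blockLen κ) v m) = wsum (push κ w) v m := by
  induction m with
  | zero => rfl
  | succ m ih =>
    rw [wsum_succ, wsum_add, ih, wsum_succ, iterate_shift_substSeq]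
    have := wsum_substSeq_block κ w (shift^[m] v)
    rw [iterate_shift_apply, zero_add] at this
    rw [this]

theorem substSeq_wsum_add {κ : Kind} {v : ℕ → Letter} {m r : ℕ} (h : r < blockLen κ (v m)) :
    substSeq κ v (wsum (blockLen κ) v m + r) = (block κ (v m)).getD r la := by
  have h1 := congrFun (iterate_shift_substSeq κ v m) r
  rw [iterate_shift_apply, add_comm] at h1
  have h2 : r < blockLen κ (shift^[m] v 0) := by rwa [iterate_shift_apply, zero_add]
  rw [h1, substSeq_of_lt h2, iterate_shift_apply, zero_add]

theorem substSeq_congr (κ : Kind) {v v' : ℕ → Letter} {m : ℕ} (h : ∀ i < m, v i = v' i) :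
    ∀ i < wsum (blockLen κ) v m, substSeq κ v i = substSeq κ v' i := by
  intro i hi
  obtain ⟨j, r, rfl, hr⟩ := exists_wsum_add_lt (blockLen_pos κ) v i
  have hj : j < m := by
    by_contra hj
    have := wsum_mono (blockLen κ) v (not_lt.1 hj)
    omega
  rw [substSeq_wsum_add hr, wsum_congr _ fun i hi => h i (hi.trans hj),
    substSeq_wsum_add (by rwa [← h j hj]), h j hj]

/-- The letter `b` occurs at the end of blocks only, so that each occurrence of `b` reveals a
boundary between two blocks. -/
theorem exists_wsum_of_substSeq_eq_true {κ : Kind} {v : ℕ → Letter} {q : ℕ}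
    (h : substSeq κ v q = true) : ∃ m, q + 1 = wsum (blockLen κ) v m := by
  obtain ⟨m, r, rfl, hr⟩ := exists_wsum_add_lt (blockLen_pos κ) v q
  refine ⟨m + 1, ?_⟩
  rw [substSeq_wsum_add hr] at h
  rw [wsum_succ]
  generalize v m = c at *
  suffices r + 1 = blockLen κ c by omega
  cases κ <;> cases c <;> simp only [blockLen, block, List.length_cons, List.length_nil] at hr h ⊢
    <;> interval_cases r <;> simp_all

/-- Substitution of blocks is injective on infinite words. -/
theorem substSeq_injective (κ : Kind) : Function.Injective (substSeq κ) := by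
  have key : ∀ v v', substSeq κ v = substSeq κ v' → v 0 = v' 0 := by
    intro v v' h
    have aux : ∀ v v', substSeq κ v = substSeq κ v' → v 0 = false → v' 0 = true → False := by
      intro v v' h h0 h1
      have e0 : substSeq κ v' 0 = (block κ true).getD 0 la := by
        rw [substSeq_of_lt (blockLen_pos κ _), h1]
      have e0' : substSeq κ v 0 = (block κ false).getD 0 la := by
        rw [substSeq_of_lt (blockLen_pos κ _), h0]
      cases κ with
      | cut => rw [h, e0] at e0'; simp [block] at e0'
      | rot =>
        have e1 := congrFun h 1
        rw [substSeq_of_lt (by rw [h0]; decide), substSeq_of_lt (by rw [h1]; decide)] at e1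
        simp [h0, h1, block] at e1
      | refl =>
        have e1 := congrFun h 2
        rw [substSeq_of_lt (v := v') (by rw [h1]; decide)] at e1
        have l1 : blockLen .refl (v 0) = 1 := by rw [h0]; rfl
        have e2 := substSeq_add .refl v 1
        rw [l1, one_add_one_eq_two] at e2
        rw [e2, h1] at e1
        simp only [block] at e1
        cases h2 : v 1 with
        | true =>
          rw [substSeq_of_lt (by simp only [shift, zero_add, h2]; decide)] at e1
          simp [shift, h2, block] at e1
        | false =>
          have l2 : blockLen .refl (shift v 0) = 1 := by simp only [shift, zero_add, h2]; rfl
          have e3 := substSeq_add .refl (shift v) 0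
          rw [l2, zero_add] at e3
          rw [e3, substSeq_of_lt (blockLen_pos _ _)] at e1
          generalize shift (shift v) 0 = c at e1
          cases c <;> simp [block] at e1
    cases h0 : v 0 <;> cases h1 : v' 0
    · rfl
    · exact (aux v v' h h0 h1).elim
    · exact (aux v' v h.symm h1 h0).elim
    · rfl
  have step : ∀ n v v', substSeq κ v = substSeq κ v' → v n = v' n := by
    intro n
    induction n with
    | zero => exact key
    | succ n ih =>
      intro v v' h
      refine ih (shift v) (shift v') ?_
      rw [← shift_substSeq, ← shift_substSeq, h, key v v' h]
  exact fun v v' h => funext fun n => step n v v' h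

/-! ### Continuity of maps between spaces of words -/

theorem eventually_agree (v : ℕ → Letter) (m : ℕ) : ∀ᶠ w in 𝓝 v, ∀ i < m, w i = v i := by
  have : ∀ i ∈ Finset.range m, ∀ᶠ w in 𝓝 v, w i = v i := fun i _ =>
    (continuous_apply i).continuousAt.eventually
      (eventually_of_mem ((isOpen_discrete {v i}).mem_nhds rfl) fun _ h => h)
  filter_upwards [(Filter.eventually_all_finset _).2 this] with w hw i hi
  exact hw i (Finset.mem_range.2 hi)

theorem continuousAt_of_agree {X : Type*} [TopologicalSpace X] {f : (ℕ → Letter) → X}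
    {v : ℕ → Letter} {m : ℕ} (h : ∀ w, (∀ i < m, w i = v i) → f w = f v) : ContinuousAt f v :=
  (continuousAt_const (y := f v)).congr <| (eventually_agree v m).mono fun w hw => (h w hw).symm

theorem continuous_substSeq (κ : Kind) : Continuous (substSeq κ) := by
  refine continuous_pi fun n => continuous_iff_continuousAt.2 fun v => ?_
  refine continuousAt_of_agree (m := n + 1) fun w hw => ?_
  refine (substSeq_congr κ (fun i hi => (hw i hi).symm) n ?_).symm
  exact le_wsum (blockLen_pos κ) v (n + 1)

theorem continuous_iterate_shift (n : ℕ) : Continuous shift^[n] := continuous_shift.iterate n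

/-! ### Weights of periods under desubstitution -/

/-- The word `v` is eventually periodic, and the letters of one period (not necessarily the
smallest) have total `w`-weight `W`. -/
def EvPer (w : Letter → ℕ) (W : ℕ) (v : ℕ → Letter) : Prop :=
  ∃ M p, 1 ≤ p ∧ shift^[M + p] v = shift^[M] v ∧ wsum w (shift^[M] v) p = W

theorem wsum_shift_of_periodic (w : Letter → ℕ) {x : ℕ → Letter} {p : ℕ} (h : shift^[p] x = x) :
    wsum w (shift x) p = wsum w x p := by
  have h1 := wsum_succ' w x p
  rw [wsum_succ] at h1
  have : x p = x 0 := by rw [← congrFun h 0, iterate_shift_apply, zero_add]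
  rw [this] at h1
  omega

/-- The weight of a period can be read arbitrarily far in the word. -/
theorem EvPer.exists_ge {w : Letter → ℕ} {W : ℕ} {v : ℕ → Letter} (h : EvPer w W v) (N : ℕ) :
    ∃ M ≥ N, ∃ p, 1 ≤ p ∧ shift^[M + p] v = shift^[M] v ∧ wsum w (shift^[M] v) p = W := by
  obtain ⟨M, p, hp, h, hW⟩ := h
  have : ∀ i, shift^[M + i + p] v = shift^[M + i] v ∧ wsum w (shift^[M + i] v) p = W := by
    intro i
    induction i with
    | zero => exact ⟨h, hW⟩
    | succ i ih =>
      constructor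
      · rw [show M + (i + 1) + p = (M + i + p) + 1 by omega, Function.iterate_succ_apply', ih.1,
          ← Function.iterate_succ_apply' shift]
        rfl
      · rw [← ih.2, ← add_assoc, Function.iterate_succ_apply']
        refine wsum_shift_of_periodic w ?_
        rw [← Function.iterate_add_apply, add_comm, ih.1]
  exact ⟨M + N, by omega, p, hp, (this N).1, (this N).2⟩

theorem evPer_iterate_shift {w : Letter → ℕ} {W : ℕ} {v : ℕ → Letter} (n : ℕ) :
    EvPer w W (shift^[n] v) ↔ EvPer w W v := by
  constructor
  · rintro ⟨M, p, hp, h, hW⟩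
    refine ⟨M + n, p, hp, ?_, ?_⟩
    · rw [Function.iterate_add_apply _ M n, ← h, ← Function.iterate_add_apply]
      rw [add_right_comm]
    · rwa [Function.iterate_add_apply]
  · intro h
    obtain ⟨M, hM, p, hp, h, hW⟩ := h.exists_ge n
    obtain ⟨i, rfl⟩ := Nat.exists_eq_add_of_le' hM
    refine ⟨i, p, hp, ?_, ?_⟩
    · rw [← Function.iterate_add_apply, ← Function.iterate_add_apply, ← h, add_right_comm]
    · rwa [← Function.iterate_add_apply]

theorem EvPer.substSeq {κ : Kind} {w : Letter → ℕ} {W : ℕ} {v : ℕ → Letter}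
    (h : EvPer (push κ w) W v) : EvPer w W (substSeq κ v) := by
  obtain ⟨M, p, hp, h, hW⟩ := h
  refine ⟨wsum (blockLen κ) v M, wsum (blockLen κ) (shift^[M] v) p,
    hp.trans (le_wsum (blockLen_pos κ) _ _), ?_, ?_⟩
  · rw [← wsum_add, iterate_shift_substSeq, iterate_shift_substSeq, h]
  · rw [iterate_shift_substSeq, wsum_substSeq, hW]

/-- A period of a substituted word comes from a period of the original word: if `b` occurs
infinitely often, then it synchronizes the blocks of two successive periods. -/
theorem EvPer.of_substSeq {κ : Kind} {w : Letter → ℕ} {W : ℕ} {v : ℕ → Letter}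
    (h : EvPer w W (PiecewiseSquare.substSeq κ v)) : EvPer (push κ w) W v := by
  by_cases hb : ∀ N, ∃ q ≥ N, PiecewiseSquare.substSeq κ v q = true
  · obtain ⟨M, p, hp, h, hW⟩ := h
    obtain ⟨q, hq, hqb⟩ := hb M
    obtain ⟨i, rfl⟩ := Nat.exists_eq_add_of_le' hq
    have hqb' : PiecewiseSquare.substSeq κ v (i + M + p) = true := by
      have := congrFun h i
      rw [iterate_shift_apply, iterate_shift_apply] at this
      rw [add_assoc, this, hqb]
    have h' : shift^[i + 1 + M + p] (PiecewiseSquare.substSeq κ v) =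
        shift^[i + 1 + M] (PiecewiseSquare.substSeq κ v) := by
      rw [add_assoc, Function.iterate_add_apply, h, ← Function.iterate_add_apply]
    have hW' : wsum w (shift^[i + 1 + M] (PiecewiseSquare.substSeq κ v)) p = W := by
      rw [← hW]
      have : shift^[p] (shift^[M] (PiecewiseSquare.substSeq κ v)) =
          shift^[M] (PiecewiseSquare.substSeq κ v) := by
        rw [← Function.iterate_add_apply, add_comm, h]
      have aux : ∀ j, wsum w (shift^[j] (shift^[M] (PiecewiseSquare.substSeq κ v))) p =
          wsum w (shift^[M] (PiecewiseSquare.substSeq κ v)) p := by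
        intro j
        induction j with
        | zero => rfl
        | succ j ih =>
          rw [← ih, Function.iterate_succ_apply']
          refine wsum_shift_of_periodic w ?_
          rw [← Function.iterate_add_apply, add_comm, Function.iterate_add_apply, this]
      rw [← aux (i + 1), ← Function.iterate_add_apply]
    obtain ⟨m, hm⟩ := exists_wsum_of_substSeq_eq_true hqb
    obtain ⟨m', hm'⟩ := exists_wsum_of_substSeq_eq_true hqb'
    have hmm : m < m' := by
      rw [← (wsum_strictMono (blockLen_pos κ) v).lt_iff_lt]; omega
    obtain ⟨d, rfl⟩ := Nat.exists_eq_add_of_lt hmm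
    have e1 : i + 1 + M = wsum (blockLen κ) v m := by omega
    have e2 : i + 1 + M + p = wsum (blockLen κ) v (m + d + 1) := by omega
    rw [e2, e1, iterate_shift_substSeq, iterate_shift_substSeq] at h'
    refine ⟨m, d + 1, by omega, substSeq_injective κ h', ?_⟩
    rw [e1, iterate_shift_substSeq] at hW'
    rw [← hW', ← wsum_substSeq]
    congr 1
    have := wsum_add (blockLen κ) v m (d + 1)
    rw [← add_assoc] at this
    omega
  · push Not at hb
    obtain ⟨N, hN⟩ := hb
    have hκ : ∀ m ≥ N, κ = .refl ∧ v m = false := by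
      intro m hm
      have h1 := le_wsum (blockLen_pos κ) v m
      have h2 : ∀ r < blockLen κ (v m), (block κ (v m)).getD r la ≠ true := by
        intro r hr
        rw [← substSeq_wsum_add hr]
        exact hN _ (by omega)
      generalize v m = c at h2
      have h0 := h2 0
      have h3 := h2 1
      have h4 := h2 2
      cases κ <;> cases c <;> simp [block, blockLen] at h0 h3 h4 ⊢
    have hv : ∀ M ≥ N, shift^[M] v = fun _ => false := fun M hM => funext fun i => by
      rw [iterate_shift_apply]; exact (hκ _ (by omega)).2
    have hκ' := (hκ N le_rfl).1
    subst hκ'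
    obtain ⟨M, hM, p, hp, -, hW⟩ := h.exists_ge N
    refine ⟨M, p, hp, by rw [hv _ hM, hv _ (by omega)], ?_⟩
    rw [hv _ hM, ← hW]
    refine Finset.sum_congr rfl fun i _ => ?_
    have : PiecewiseSquare.substSeq .refl v (i + M) = false := by
      simpa using hN (i + M) (by omega)
    rw [iterate_shift_apply, this]
    simp [push, block]

/-! ### Compositions of substitutions -/

/-- The composition `κ 0 ∘ ⋯ ∘ κ (k - 1)` of block substitutions, on infinite words. -/
def iterSubst (κ : ℕ → Kind) : ℕ → (ℕ → Letter) → ℕ → Letter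
  | 0, v => v
  | k + 1, v => iterSubst κ k (substSeq (κ k) v)

/-- The length of the image of a letter by `κ 0 ∘ ⋯ ∘ κ (k - 1)`. -/
def height (κ : ℕ → Kind) : ℕ → Letter → ℕ
  | 0 => fun _ => 1
  | k + 1 => push (κ k) (height κ k)

theorem push_mono_aux (κ : Kind) (w : Letter → ℕ) (c : Letter) : w c ≤ push κ w c := by
  cases κ <;> cases c <;> simp [push, block] <;> omega

theorem height_pos (κ : ℕ → Kind) (k : ℕ) (c : Letter) : 0 < height κ k c := by
  induction k with
  | zero => exact Nat.one_pos
  | succ k ih => exact ih.trans_le (push_mono_aux _ _ _)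

theorem height_mono (κ : ℕ → Kind) (c : Letter) : Monotone fun k => height κ k c :=
  monotone_nat_of_le_succ fun _ => push_mono_aux _ _ _

theorem height_le (κ : ℕ → Kind) (k : ℕ) (c : Letter) : height κ k c ≤ 3 ^ k := by
  induction k generalizing c with
  | zero => exact le_rfl
  | succ k ih =>
    have ha := ih false
    have hb := ih true
    rw [pow_succ]
    cases h : κ k <;> cases c <;> simp [height, h, push, block] <;> omega

theorem iterate_shift_iterSubst (κ : ℕ → Kind) (k : ℕ) (v : ℕ → Letter) (m : ℕ) :
    shift^[wsum (height κ k) v m] (iterSubst κ k v) = iterSubst κ k (shift^[m] v) := by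
  induction k generalizing v m with
  | zero => simp [height, wsum_const_one, iterSubst]
  | succ k ih =>
    rw [height, ← wsum_substSeq, iterSubst, ih, iterate_shift_substSeq]; rfl

theorem iterSubst_congr (κ : ℕ → Kind) (k : ℕ) {v v' : ℕ → Letter} {m : ℕ}
    (h : ∀ i < m, v i = v' i) :
    ∀ i < wsum (height κ k) v m, iterSubst κ k v i = iterSubst κ k v' i := by
  induction k generalizing v v' m with
  | zero => simpa [height, wsum_const_one, iterSubst] using h
  | succ k ih =>
    rw [height, ← wsum_substSeq]
    exact ih (substSeq_congr _ h)

/-- A period of a composed substitution is a total height of towers. -/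
theorem EvPer.of_iterSubst {κ : ℕ → Kind} {k : ℕ} {W : ℕ} {v : ℕ → Letter}
    (h : EvPer (fun _ => 1) W (iterSubst κ k v)) : EvPer (height κ k) W v := by
  induction k generalizing v with
  | zero => exact h
  | succ k ih => exact (ih h).of_substSeq

theorem EvPer.le_of_forall {w : Letter → ℕ} {W N : ℕ} {v : ℕ → Letter} (h : EvPer w W v)
    (hN : ∀ c, N ≤ w c) : N ≤ W := by
  obtain ⟨M, p, hp, -, rfl⟩ := h
  obtain ⟨p, rfl⟩ := Nat.exists_eq_add_of_le' hp
  rw [wsum_succ']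
  exact (hN _).trans (Nat.le_add_right _ _)

theorem iterSubst_succ' (κ : ℕ → Kind) (k : ℕ) (v : ℕ → Letter) :
    iterSubst κ (k + 1) v = substSeq (κ 0) (iterSubst (fun n => κ (n + 1)) k v) := by
  induction k generalizing v with
  | zero => rfl
  | succ k ih => rw [iterSubst, ih]; rfl

theorem iterSubst_add (κ : ℕ → Kind) (j k : ℕ) (v : ℕ → Letter) :
    iterSubst κ (j + k) v = iterSubst κ j (iterSubst (fun n => κ (n + j)) k v) := by
  induction k generalizing v with
  | zero => rfl
  | succ k ih => rw [← add_assoc, iterSubst, ih, iterSubst, add_comm k j]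

/-- A pointed block of level `k + 1` refines a pointed block of level `k`. -/
theorem iterSubst_refine {κ : ℕ → Kind} {k : ℕ} {v : ℕ → Letter} {i j : ℕ}
    (hi : i < blockLen (κ k) (v 0)) (hj : j < height κ k (substSeq (κ k) v i)) :
    shift^[j] (iterSubst κ k (shift^[i] (substSeq (κ k) v))) =
        shift^[j + wsum (height κ k) (substSeq (κ k) v) i] (iterSubst κ (k + 1) v) ∧
      j + wsum (height κ k) (substSeq (κ k) v) i < height κ (k + 1) (v 0) := by
  constructor
  · rw [Function.iterate_add_apply, iterSubst, iterate_shift_iterSubst]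
  · have h1 := wsum_mono (height κ k) (substSeq (κ k) v) (Nat.succ_le_of_lt hi)
    rw [wsum_succ, wsum_substSeq_block] at h1
    simp only [height]
    omega

/-- A sequence of steps in which `cut` occurs infinitely often, and so does its complement. -/
structure Mixing (κ : ℕ → Kind) : Prop where
  cut : ∀ n, ∃ k ≥ n, κ k = .cut
  not_cut : ∀ n, ∃ k ≥ n, κ k ≠ .cut

theorem Mixing.tail {κ : ℕ → Kind} (h : Mixing κ) (j : ℕ) : Mixing fun n => κ (n + j) := by
  constructor
  · intro n
    obtain ⟨k, hk, h⟩ := h.cut (n + j)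
    exact ⟨k - j, by omega, by rwa [Nat.sub_add_cancel (by omega)]⟩
  · intro n
    obtain ⟨k, hk, h⟩ := h.not_cut (n + j)
    exact ⟨k - j, by omega, by rwa [Nat.sub_add_cancel (by omega)]⟩

/-- The `cut` steps increase the height of the letter `a`, and the other steps carry this growth
over to the letter `b`. -/
theorem Mixing.exists_le_height {κ : ℕ → Kind} (h : Mixing κ) (N : ℕ) :
    ∃ k₀, ∀ k ≥ k₀, ∀ c, N ≤ height κ k c := by
  have ha : ∀ N, ∃ k, N ≤ height κ k false := by
    intro N
    induction N with
    | zero => exact ⟨0, Nat.zero_le _⟩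
    | succ N ih =>
      obtain ⟨k, hk⟩ := ih
      obtain ⟨j, hj, hc⟩ := h.cut k
      refine ⟨j + 1, ?_⟩
      have h1 : height κ k false ≤ height κ j false := height_mono κ false hj
      have h2 := height_pos κ j true
      simp only [height, hc, push, block, List.map_cons, List.map_nil, List.sum_cons,
        List.sum_nil]
      omega
  obtain ⟨k, hk⟩ := ha N
  obtain ⟨j, hj, hc⟩ := h.not_cut k
  have h1 : height κ k false ≤ height κ j false := height_mono κ false hj
  refine ⟨j + 1, fun i hi c => ?_⟩
  cases c
  · exact hk.trans (height_mono κ false (show k ≤ i by omega))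
  · refine le_trans ?_ (height_mono κ true hi)
    simp only [height, push]
    cases h' : κ j <;> simp_all [block] <;> omega

/-! ### The limit word -/

theorem substSeq_zero_of_eq_false {κ : Kind} {v : ℕ → Letter} (h : v 0 = false) :
    substSeq κ v 0 = false := by
  rw [substSeq_of_lt (blockLen_pos _ _), h]
  cases κ <;> rfl

theorem iterSubst_zero_of_eq_false {κ : ℕ → Kind} {k : ℕ} {v : ℕ → Letter} (h : v 0 = false) :
    iterSubst κ k v 0 = false := by
  induction k generalizing v with
  | zero => exact h
  | succ k ih => exact ih (substSeq_zero_of_eq_false h)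

/-- The limit of the words `κ 0 ∘ ⋯ ∘ κ (k - 1) (a)`; its `n`-th letter is read in the word of
level `k` as soon as the latter has more than `n` letters. -/
def IsLimit (κ : ℕ → Kind) (u : ℕ → Letter) : Prop :=
  ∀ k v, v 0 = false → ∀ i < height κ k false, iterSubst κ k v i = u i

theorem iterSubst_agree {κ : ℕ → Kind} {j k : ℕ} (hjk : j ≤ k) {v v' : ℕ → Letter}
    (h : v 0 = false) (h' : v' 0 = false) :
    ∀ i < height κ j false, iterSubst κ j v i = iterSubst κ k v' i := by
  obtain ⟨d, rfl⟩ := Nat.exists_eq_add_of_le hjk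
  rw [iterSubst_add]
  have := iterSubst_congr κ j (m := 1) (v := v) (v' := iterSubst (fun n => κ (n + j)) d v')
    (fun i hi => by
      obtain rfl : i = 0 := by omega
      rw [h, iterSubst_zero_of_eq_false h'])
  rwa [wsum_one, h] at this

theorem Mixing.exists_isLimit {κ : ℕ → Kind} (h : Mixing κ) : ∃ u, IsLimit κ u := by
  choose K hK using fun n => h.exists_le_height (n + 1)
  refine ⟨fun n => iterSubst κ (K n) (fun _ => false) n, fun k v hv i hi => ?_⟩
  rcases le_total k (K i) with hk | hk
  · exact iterSubst_agree hk hv rfl i hi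
  · exact (iterSubst_agree hk rfl hv i (hK i _ le_rfl false)).symm

theorem IsLimit.eq_substSeq_tail {κ : ℕ → Kind} (h : Mixing κ) {u u' : ℕ → Letter}
    (hu : IsLimit κ u) (hu' : IsLimit (fun n => κ (n + 1)) u') : u = substSeq (κ 0) u' := by
  funext n
  obtain ⟨j, hj⟩ := h.exists_le_height (n + 1)
  obtain ⟨k, hk⟩ := (h.tail 1).exists_le_height (n + 1)
  have h1 : n < height κ (max j k + 1) false :=
    hj (max j k + 1) ((le_max_left j k).trans (Nat.le_succ _)) false
  have h2 : n + 1 ≤ height (fun n => κ (n + 1)) (max j k) false := hk _ (le_max_right _ _) false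
  rw [← hu _ (fun _ => false) rfl n h1, iterSubst_succ']
  refine substSeq_congr _ (m := n + 1) (fun i hi => hu' _ _ rfl i (by omega)) n ?_
  exact le_wsum (blockLen_pos _) _ (n + 1)

/-- The limit word is the image of the limit word of the remaining steps. -/
theorem IsLimit.eq_iterSubst {κ : ℕ → Kind} (h : Mixing κ) {u u' : ℕ → Letter} {k : ℕ}
    (hu : IsLimit κ u) (hu' : IsLimit (fun n => κ (n + k)) u') : u = iterSubst κ k u' := by
  induction k generalizing u' with
  | zero =>
    funext n
    obtain ⟨k, hk⟩ := h.exists_le_height (n + 1)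
    exact (hu k (fun _ => false) rfl n (hk k le_rfl _)).symm.trans
      (hu' k (fun _ => false) rfl n (hk k le_rfl _))
  | succ k ih =>
    obtain ⟨u'', hu''⟩ := (h.tail k).exists_isLimit
    rw [ih hu'', iterSubst, hu''.eq_substSeq_tail (h.tail k) (u' := u'), zero_add]
    convert hu' using 3
    omega

/-! ### Desubstitution in the subshift -/

theorem iterate_shift_mem_subshift {u v : ℕ → Letter} (hv : v ∈ subshift u) (n : ℕ) :
    shift^[n] v ∈ subshift u := (mapsTo_shift u).iterate n hv

theorem self_mem_subshift (u : ℕ → Letter) : u ∈ subshift u := subset_closure ⟨0, rfl⟩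

theorem isClosed_subshift (u : ℕ → Letter) : IsClosed (subshift u) := isClosed_closure

theorem subshift_subset {u : ℕ → Letter} {C : Set (ℕ → Letter)} (hC : IsClosed C)
    (hs : MapsTo shift C C) (hu : u ∈ C) : subshift u ⊆ C :=
  closure_minimal (by rintro _ ⟨n, rfl⟩; exact hs.iterate n hu) hC

/-- A word of the subshift agrees on any prefix with a shift of the generating word. -/
theorem exists_agree_of_mem_subshift {u v : ℕ → Letter} (hv : v ∈ subshift u) (m : ℕ) :
    ∃ n, ∀ i < m, u (i + n) = v i := by
  obtain ⟨_, h, n, rfl⟩ := mem_closure_iff_nhds.1 hv _ (eventually_agree v m)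
  exact ⟨n, fun i hi => by rw [← h i hi]; exact (iterate_shift_apply u n i).symm⟩

/-- A word all of whose prefixes are factors of `u` belongs to the subshift of `u`. -/
theorem mem_subshift_of_agree {u v : ℕ → Letter}
    (h : ∀ m, ∃ n, ∀ i < m, u (i + n) = v i) : v ∈ subshift u := by
  choose n hn using h
  refine mem_closure_of_tendsto (f := fun m => shift^[n m] u) (b := atTop)
    (tendsto_pi_nhds.2 fun i => ?_) (Eventually.of_forall fun m => ⟨n m, rfl⟩)
  refine tendsto_const_nhds.congr' ?_
  filter_upwards [eventually_gt_atTop i] with m hm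
  rw [iterate_shift_apply, hn m i hm]

theorem exists_substSeq_of_mem_subshift {κ : Kind} {u v : ℕ → Letter}
    (hv : v ∈ subshift (substSeq κ u)) :
    ∃ v' ∈ subshift u, ∃ j < blockLen κ (v' 0), v = shift^[j] (substSeq κ v') := by
  have hclosed : IsClosed (⋃ j ∈ Finset.range 3, (fun v' => shift^[j] (substSeq κ v')) ''
      {v' ∈ subshift u | j < blockLen κ (v' 0)}) := by
    refine isClosed_biUnion_finset fun j _ => IsCompact.isClosed (IsCompact.image ?_
      ((continuous_iterate_shift j).comp (continuous_substSeq κ)))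
    refine IsClosed.isCompact ((isClosed_subshift u).inter ?_)
    exact (isClosed_discrete {c : Letter | j < blockLen κ c}).preimage
      (continuous_apply (A := fun _ : ℕ => Letter) 0)
  have := closure_minimal (s := range fun n : ℕ => shift^[n] (substSeq κ u)) (fun x hx => ?_)
    hclosed hv
  · simp only [mem_iUnion, mem_image] at this
    obtain ⟨j, -, v', ⟨hv', hj⟩, rfl⟩ := this
    exact ⟨v', hv', j, hj, rfl⟩
  · obtain ⟨n, rfl⟩ := hx
    obtain ⟨m, j, rfl, hj⟩ := exists_wsum_add_lt (blockLen_pos κ) u n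
    simp only [mem_iUnion, mem_image]
    refine ⟨j, Finset.mem_range.2 (hj.trans_le (blockLen_le _ _)), shift^[m] u,
      ⟨iterate_shift_mem_subshift (self_mem_subshift u) m, ?_⟩, ?_⟩
    · rwa [iterate_shift_apply, zero_add]
    · rw [← iterate_shift_substSeq, ← Function.iterate_add_apply, add_comm]

/-- Desubstitution: every word of the subshift of a substituted word is a suffix of a substituted
word, which starts in its first block. -/
theorem exists_iterSubst_of_mem_subshift {κ : ℕ → Kind} {k : ℕ} {u v : ℕ → Letter}
    (hv : v ∈ subshift (iterSubst κ k u)) :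
    ∃ v' ∈ subshift u, ∃ j < height κ k (v' 0), v = shift^[j] (iterSubst κ k v') := by
  induction k generalizing u with
  | zero => exact ⟨v, hv, 0, Nat.one_pos, rfl⟩
  | succ k ih =>
    obtain ⟨v', hv', j, hj, rfl⟩ := ih hv
    obtain ⟨v'', hv'', i, hi, rfl⟩ := exists_substSeq_of_mem_subshift hv'
    rw [iterate_shift_apply, zero_add] at hj
    have := iterSubst_refine hi hj
    exact ⟨v'', hv'', _, this.2, this.1⟩

/-- The letter `b` occurs in every word of the subshift. -/
theorem IsLimit.exists_eq_true {κ : ℕ → Kind} (h : Mixing κ) {u v : ℕ → Letter}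
    (hu : IsLimit κ u) (hv : v ∈ subshift u) : ∃ q, v q = true := by
  obtain ⟨n, -, hn⟩ := h.cut 0
  induction n generalizing κ u v with
  | zero =>
    obtain ⟨u', hu'⟩ := (h.tail 1).exists_isLimit
    rw [hu.eq_substSeq_tail h hu'] at hv
    obtain ⟨v', -, j, hj, rfl⟩ := exists_substSeq_of_mem_subshift hv
    refine ⟨blockLen (κ 0) (v' 0) - 1 - j, ?_⟩
    rw [iterate_shift_apply, Nat.sub_add_cancel (by omega), substSeq_of_lt (by omega), hn]
    cases v' 0 <;> rfl
  | succ n ih =>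
    obtain ⟨u', hu'⟩ := (h.tail 1).exists_isLimit
    rw [hu.eq_substSeq_tail h hu'] at hv
    obtain ⟨v', hv', j, hj, rfl⟩ := exists_substSeq_of_mem_subshift hv
    obtain ⟨q, hq⟩ := ih (h.tail 1) hu' hv' hn
    have h1 := wsum_mono (blockLen (κ 0)) v' (Nat.zero_le q)
    have h2 := blockLen_pos (κ 0) true
    have h3 : j ≤ wsum (blockLen (κ 0)) v' q + (blockLen (κ 0) true - 1) := by
      rcases q with - | q
      · rw [hq] at hj; omega
      · have := wsum_mono (blockLen (κ 0)) v' (show 1 ≤ q + 1 by omega)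
        rw [wsum_one] at this
        omega
    refine ⟨wsum (blockLen (κ 0)) v' q + (blockLen (κ 0) true - 1) - j, ?_⟩
    rw [iterate_shift_apply, Nat.sub_add_cancel h3, substSeq_wsum_add (by rw [hq]; omega), hq]
    cases κ 0 <;> rfl

/-- The limit word is not eventually periodic: its periods are total weights of towers of every
level, so they are at least as long as these towers. -/
theorem IsLimit.not_evPer {κ : ℕ → Kind} (h : Mixing κ) {u : ℕ → Letter} (hu : IsLimit κ u)
    (W : ℕ) : ¬ EvPer (fun _ => 1) W u := by
  intro hW
  obtain ⟨k, hk⟩ := h.exists_le_height (W + 1)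
  obtain ⟨u', hu'⟩ := (h.tail k).exists_isLimit
  rw [hu.eq_iterSubst h hu'] at hW
  exact absurd (hW.of_iterSubst.le_of_forall (hk k le_rfl)) (by omega)

/-! ### Coded systems and their renormalization -/

/-- A partial dynamical system given by one branch for each letter; the branch `map c` is used on
`cell c`, although it makes sense everywhere. -/
structure CodedSystem (X : Type*) where
  /-- The branch of the map for each letter. -/
  map : Letter → X → X
  /-- The domain of each branch. -/
  cell : Letter → Set X

namespace CodedSystem

variable {X : Type*} (A A' : CodedSystem X)

/-- The skew product which applies to the point the branch prescribed by the first letter of the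
word, and shifts the word. -/
def next (p : (ℕ → Letter) × X) : (ℕ → Letter) × X := (shift p.1, A.map (p.1 0) p.2)

/-- The word `p.1` is the coding of the point `p.2`. -/
def Codes (p : (ℕ → Letter) × X) : Prop := ∀ n, (A.next^[n] p).2 ∈ A.cell (p.1 n)

/-- The branches prescribed by a finite word. -/
def act : List Letter → X → X
  | [], z => z
  | c :: w, z => act w (A.map c z)

/-- The point `z` follows the branches prescribed by a finite word. -/
def Follows : List Letter → X → Prop
  | [], _ => True
  | c :: w, z => z ∈ A.cell c ∧ Follows w (A.map c z)

variable {A A'}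

theorem next_iterate_fst (p : (ℕ → Letter) × X) (n : ℕ) : (A.next^[n] p).1 = shift^[n] p.1 := by
  induction n generalizing p with
  | zero => rfl
  | succ n ih => rw [Function.iterate_succ_apply, ih]; rfl

theorem Codes.mem {p : (ℕ → Letter) × X} (h : A.Codes p) : p.2 ∈ A.cell (p.1 0) := h 0

theorem Codes.next {p : (ℕ → Letter) × X} (h : A.Codes p) : A.Codes (A.next p) := fun n => h (n + 1)

theorem Codes.iterate {p : (ℕ → Letter) × X} (h : A.Codes p) (n : ℕ) : A.Codes (A.next^[n] p) := by
  induction n generalizing p with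
  | zero => exact h
  | succ n ih => exact ih h.next

theorem Codes.ext {v v' : ℕ → Letter} {z : X} (hA : ∀ c c' x, x ∈ A.cell c → x ∈ A.cell c' → c = c')
    (h : A.Codes (v, z)) (h' : A.Codes (v', z)) : v = v' := by
  funext n
  induction n generalizing v v' z with
  | zero => exact hA _ _ _ (h 0) (h' 0)
  | succ n ih =>
    have e : v 0 = v' 0 := hA _ _ _ (h 0) (h' 0)
    have h1 := h.next
    have h2 := h'.next
    simp only [CodedSystem.next, ← e] at h1 h2
    exact ih h1 h2

/-- The system `A'` is a renormalization of `A`, with substitution `block κ`, through the embedding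
`φ`. -/
structure Renorm (A A' : CodedSystem X) (κ : Kind) (φ : X → X) : Prop where
  act : ∀ c z, A.act (block κ c) (φ z) = φ (A'.map c z)
  follows : ∀ c, ∀ z ∈ A'.cell c, A.Follows (block κ c) (φ z)

variable {κ : Kind} {φ : X → X}

theorem iterate_next_of_agree {w : List Letter} {p : (ℕ → Letter) × X}
    (h : ∀ i < w.length, p.1 i = w.getD i la) :
    A.next^[w.length] p = (shift^[w.length] p.1, A.act w p.2) := by
  refine Prod.ext (next_iterate_fst _ _) ?_
  induction w generalizing p with
  | nil => rfl
  | cons c w ih =>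
    have h0 : p.1 0 = c := h 0 (by simp)
    rw [List.length_cons, Function.iterate_succ_apply, ih, act, CodedSystem.next, h0]
    intro i hi
    simpa [CodedSystem.next, shift] using h (i + 1) (by simpa using hi)

theorem Follows.mem_cell {w : List Letter} {p : (ℕ → Letter) × X} (hw : A.Follows w p.2)
    (h : ∀ i < w.length, p.1 i = w.getD i la) :
    ∀ i < w.length, (A.next^[i] p).2 ∈ A.cell (p.1 i) := by
  induction w generalizing p with
  | nil => intro i hi; simp at hi
  | cons c w ih =>
    have h0 : p.1 0 = c := h 0 (by simp)
    intro i hi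
    rcases i with - | i
    · rw [Function.iterate_zero_apply, h0]; exact hw.1
    · have := hw.2
      rw [← h0] at this
      refine ih (p := A.next p) this (fun i hi => ?_) i (by simpa using hi)
      simpa [CodedSystem.next, shift] using h (i + 1) (by simpa using hi)

/-- The lift of a coded point by a renormalization. -/
def lift (κ : Kind) (φ : X → X) (p : (ℕ → Letter) × X) : (ℕ → Letter) × X :=
  (substSeq κ p.1, φ p.2)

theorem Renorm.iterate_next_block (h : Renorm A A' κ φ) (p : (ℕ → Letter) × X) :
    A.next^[blockLen κ (p.1 0)] (lift κ φ p) = lift κ φ (A'.next p) := by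
  rw [blockLen, iterate_next_of_agree fun i hi => substSeq_of_lt hi, lift, h.act]
  refine Prod.ext ?_ rfl
  exact shift_substSeq κ p.1

theorem Renorm.iterate_next (h : Renorm A A' κ φ) (p : (ℕ → Letter) × X) (m : ℕ) :
    A.next^[wsum (blockLen κ) p.1 m] (lift κ φ p) = lift κ φ (A'.next^[m] p) := by
  induction m with
  | zero => rfl
  | succ m ih =>
    rw [wsum_succ, add_comm, Function.iterate_add_apply, ih, Function.iterate_succ_apply',
      ← h.iterate_next_block, next_iterate_fst, iterate_shift_apply, zero_add]

theorem Renorm.codes (h : Renorm A A' κ φ) {p : (ℕ → Letter) × X} (hp : A'.Codes p) :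
    A.Codes (lift κ φ p) := by
  intro n
  obtain ⟨m, r, rfl, hr⟩ := exists_wsum_add_lt (blockLen_pos κ) p.1 n
  have h1 := (hp.iterate m).mem
  have h2 := h.iterate_next p m
  have h3 : (A'.next^[m] p).1 0 = p.1 m := by
    rw [next_iterate_fst, iterate_shift_apply, zero_add]
  rw [add_comm, Function.iterate_add_apply, h2]
  rw [h3] at h1
  have h4 := Follows.mem_cell (p := lift κ φ (A'.next^[m] p)) (h.follows _ _ h1) (fun i hi => by
    rw [← h3]; exact substSeq_of_lt (by rwa [h3])) r hr
  convert h4 using 2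
  simp only [lift]
  rw [next_iterate_fst, ← iterate_shift_substSeq, iterate_shift_apply]

end CodedSystem

/-- A closed relation in a compact space which is injective over its first coordinate is the graph
of a continuous function. -/
theorem continuous_of_isClosed_graph {W X : Type*} [TopologicalSpace W] [TopologicalSpace X]
    {K : Set X} (hK : IsCompact K) {C : Set W} {f : C → X} {G : Set (W × X)} (hG : IsClosed G)
    (hmaps : ∀ v, f v ∈ K) (hf : ∀ v : C, ∀ x ∈ K, ((v : W), x) ∈ G ↔ x = f v) : Continuous f := by
  refine continuous_iff_continuousAt.2 fun v => ?_
  refine hK.tendsto_nhds_of_unique_mapClusterPt (Eventually.of_forall hmaps) fun y hy hc => ?_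
  refine (hf v y hy).1 (hG.closure_subset (mem_closure_iff_nhds.2 fun t ht => ?_))
  rw [nhds_prod_eq, mem_prod_iff] at ht
  obtain ⟨U, hU, V, hV, hUV⟩ := ht
  have h1 : ∃ᶠ x in 𝓝 v, f x ∈ V := mapClusterPt_iff_frequently.1 hc V hV
  obtain ⟨x, hx, hxU⟩ := (h1.and_eventually (continuous_subtype_val.continuousAt.eventually hU)).exists
  exact ⟨(x, f x), hUV ⟨hxU, hx⟩, (hf x _ (hmaps x)).2 rfl⟩

/-! ### The piecewise isometries of longer rectangles -/

/-- The piecewise isometry of the rectangle `[0, ℓ] × [0, 1]`, for a parameter `s = (ℓ, ε)` with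
`ℓ > 1`: the unit square is rotated or reflected to the right end of the rectangle, and the rest is
moved to the left by `1` and reflected. For `s = (1 + θ, ε)` this is `T_(θ,ε)`. -/
def geo (s : Param) : CodedSystem (ℝ × ℝ) where
  map c z := bif c then (z.1 - 1, 1 - z.2) else (s.1 - z.2, flip s.2 z.1)
  cell c := bif c then Ioo 1 s.1 ×ˢ Ioo 0 1 else Ioo 0 1 ×ˢ Ioo 0 1

theorem geo_map_false (s : Param) (z : ℝ × ℝ) :
    (geo s).map false z = (s.1 - z.2, flip s.2 z.1) := rfl

theorem geo_map_true (s : Param) (z : ℝ × ℝ) : (geo s).map true z = (z.1 - 1, 1 - z.2) := rfl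

theorem mem_geo_cell_false {s : Param} {z : ℝ × ℝ} :
    z ∈ (geo s).cell false ↔ (0 < z.1 ∧ z.1 < 1) ∧ 0 < z.2 ∧ z.2 < 1 := Iff.rfl

theorem mem_geo_cell_true {s : Param} {z : ℝ × ℝ} :
    z ∈ (geo s).cell true ↔ (1 < z.1 ∧ z.1 < s.1) ∧ 0 < z.2 ∧ z.2 < 1 := Iff.rfl

/-- The parameters of interest. -/
structure Good (s : Param) : Prop where
  one_lt : 1 < s.1
  irrational : Irrational s.1

/-- The elementary renormalization step available for a parameter. -/
def kindOf (s : Param) : Kind := if 2 < s.1 then .cut else if s.2 = -1 then .rot else .refl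

/-- The parameter of the renormalized system. -/
def nextParam (s : Param) : Param :=
  match kindOf s with
  | .cut => (s.1 - 1, -s.2)
  | .rot => (1 / (s.1 - 1), 1)
  | .refl => (1 / (2 - s.1), 1)

/-- The scaling ratio of the renormalization. -/
def ratio (s : Param) : ℝ :=
  match kindOf s with
  | .cut => 1
  | .rot => s.1 - 1
  | .refl => 2 - s.1

/-- The similarity which sends the rectangle of the renormalized system into that of the original
system. -/
def embed (s : Param) (z : ℝ × ℝ) : ℝ × ℝ :=
  match kindOf s with
  | .cut => z
  | .rot => ((s.1 - 1) * z.2, (s.1 - 1) * z.1)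
  | .refl => ((2 - s.1) * z.1, (s.1 - 1) + (2 - s.1) * z.2)

theorem flip_neg_one (x : ℝ) : flip (-1) x = x := by simp [flip]

theorem flip_one (x : ℝ) : flip 1 x = 1 - x := by simp [flip]

theorem flip_neg (ε : ℤˣ) (x : ℝ) : flip (-ε) x = 1 - flip ε x := by
  rcases Int.units_eq_one_or ε with rfl | rfl <;> simp [flip]

theorem flip_mem {ε : ℤˣ} {x : ℝ} (h0 : 0 < x) (h1 : x < 1) : 0 < flip ε x ∧ flip ε x < 1 := by
  rcases Int.units_eq_one_or ε with rfl | rfl <;> simp [flip, h0, h1]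

/-- The three cases of the renormalization, with the values of all data. -/
theorem Good.cases {s : Param} (hs : Good s) :
    (2 < s.1 ∧ kindOf s = .cut ∧ nextParam s = (s.1 - 1, -s.2) ∧ ratio s = 1 ∧ embed s = id) ∨
    (s.1 < 2 ∧ s.2 = -1 ∧ kindOf s = .rot ∧ nextParam s = (1 / (s.1 - 1), 1) ∧
      ratio s = s.1 - 1 ∧ embed s = fun z => ((s.1 - 1) * z.2, (s.1 - 1) * z.1)) ∨
    (s.1 < 2 ∧ s.2 = 1 ∧ kindOf s = .refl ∧ nextParam s = (1 / (2 - s.1), 1) ∧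
      ratio s = 2 - s.1 ∧
      embed s = fun z => ((2 - s.1) * z.1, (s.1 - 1) + (2 - s.1) * z.2)) := by
  have h2 : s.1 ≠ 2 := fun h => hs.irrational ⟨2, by rw [h]; norm_num⟩
  rcases lt_or_gt_of_ne h2 with h | h
  · right
    rcases Int.units_eq_one_or s.2 with hε | hε
    · right
      have hk : kindOf s = .refl := by simp [kindOf, hε, h.le]
      refine ⟨h, hε, hk, ?_, ?_, ?_⟩
      · simp only [nextParam, hk]
      · simp only [ratio, hk]
      · funext z; simp only [embed, hk]
    · left
      have hk : kindOf s = .rot := by simp [kindOf, hε, h.le]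
      refine ⟨h, hε, hk, ?_, ?_, ?_⟩
      · simp only [nextParam, hk]
      · simp only [ratio, hk]
      · funext z; simp only [embed, hk]
  · left
    have hk : kindOf s = .cut := by simp [kindOf, h]
    refine ⟨h, hk, ?_, ?_, ?_⟩
    · simp only [nextParam, hk]
    · simp only [ratio, hk]
    · funext z; simp only [embed, hk]; rfl

theorem Good.next {s : Param} (hs : Good s) : Good (nextParam s) := by
  have h1 := hs.one_lt
  have hi := hs.irrational
  rcases hs.cases with ⟨h, -, h', -⟩ | ⟨h, -, -, h', -⟩ | ⟨h, -, -, h', -⟩ <;> rw [h']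
  · exact ⟨by simp only; linarith, by simpa using hi.sub_natCast 1⟩
  · refine ⟨?_, ?_⟩
    · simp only; rw [lt_div_iff₀ (by linarith)]; linarith
    · simpa using (hi.sub_natCast 1).inv
  · refine ⟨?_, ?_⟩
    · simp only; rw [lt_div_iff₀ (by linarith)]; linarith
    · simpa using (hi.natCast_sub 2).inv

theorem Good.ratio_pos {s : Param} (hs : Good s) : 0 < ratio s := by
  have h1 := hs.one_lt
  rcases hs.cases with ⟨h, -, -, h', -⟩ | ⟨h, -, -, -, h', -⟩ | ⟨h, -, -, -, h', -⟩ <;> rw [h'] <;>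
    linarith

theorem geo_cell_disjoint {s : Param} (c c' : Letter) (z : ℝ × ℝ) (h : z ∈ (geo s).cell c)
    (h' : z ∈ (geo s).cell c') : c = c' := by
  cases c <;> cases c' <;> simp only [mem_geo_cell_false, mem_geo_cell_true] at h h' <;>
    first | rfl | (exfalso; linarith [h.1.1, h.1.2, h'.1.1, h'.1.2])

/-- The piecewise isometries are renormalized to each other. -/
theorem Good.renorm {s : Param} (hs : Good s) :
    CodedSystem.Renorm (geo s) (geo (nextParam s)) (kindOf s) (embed s) := by
  have h1 := hs.one_lt
  rcases hs.cases with ⟨h, hk, hn, -, he⟩ | ⟨h, hε, hk, hn, -, he⟩ | ⟨h, hε, hk, hn, -, he⟩ <;>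
    rw [hk, hn, he]
  · constructor
    · rintro (_ | _) ⟨x, y⟩
      · simp [block, CodedSystem.act, geo, flip_neg]
        ring
      · simp [block, CodedSystem.act, geo]
    · rintro (_ | _) ⟨x, y⟩ hz
      · simp only [mem_geo_cell_false] at hz
        have := flip_mem (ε := s.2) hz.1.1 hz.1.2
        simp [block, CodedSystem.Follows, geo]
        refine ⟨?_, ⟨?_, ?_⟩, ?_⟩ <;> first | tauto | linarith
      · simp only [mem_geo_cell_true] at hz
        simp [block, CodedSystem.Follows, geo]
        refine ⟨⟨?_, ?_⟩, ?_⟩ <;> first | tauto | linarith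
  · have hθ : 0 < s.1 - 1 := by linarith
    have key : (s.1 - 1) * (1 / (s.1 - 1)) = 1 := by field_simp
    constructor
    · rintro (_ | _) ⟨x, y⟩
      · simp [block, CodedSystem.act, geo, hε, flip, mul_sub, hθ.ne']
        ring
      · simp [block, CodedSystem.act, geo, hε, flip, mul_sub]
        constructor <;> ring
    · rintro (_ | _) ⟨x, y⟩ hz
      · simp only [mem_geo_cell_false] at hz
        obtain ⟨⟨hx0, hx1⟩, hy0, hy1⟩ := hz
        have a1 := mul_pos hθ hx0
        have a2 := mul_pos hθ hy0
        have a3 := mul_lt_mul_of_pos_left hx1 hθ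
        have a4 := mul_lt_mul_of_pos_left hy1 hθ
        simp [block, CodedSystem.Follows, geo, hε, flip]
        refine ⟨⟨⟨?_, ?_⟩, ?_, ?_⟩, ⟨?_, ?_⟩, ?_, ?_⟩ <;> first | assumption | linarith
      · simp only [mem_geo_cell_true] at hz
        obtain ⟨⟨hx0, hx1⟩, hy0, hy1⟩ := hz
        have a2 := mul_pos hθ hy0
        have a1 := mul_lt_mul_of_pos_left hx0 hθ
        have a3 := mul_lt_mul_of_pos_left hx1 hθ
        have a4 := mul_lt_mul_of_pos_left hy1 hθ
        rw [key] at a3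
        simp [block, CodedSystem.Follows, geo, hε, flip]
        refine ⟨⟨⟨?_, ?_⟩, ?_, ?_⟩, ⟨⟨?_, ?_⟩, ?_, ?_⟩, ⟨?_, ?_⟩, ?_, ?_⟩ <;>
          first | assumption | linarith
  · have hθ : 0 < 2 - s.1 := by linarith
    have key : (2 - s.1) * (1 / (2 - s.1)) = 1 := by field_simp
    constructor
    · rintro (_ | _) ⟨x, y⟩
      · simp [block, CodedSystem.act, geo, hε, flip, mul_sub, hθ.ne']
        constructor <;> ring
      · simp [block, CodedSystem.act, geo, hε, flip, mul_sub]
        constructor <;> ring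
    · rintro (_ | _) ⟨x, y⟩ hz
      · simp only [mem_geo_cell_false] at hz
        obtain ⟨⟨hx0, hx1⟩, hy0, hy1⟩ := hz
        have a1 := mul_pos hθ hx0
        have a2 := mul_pos hθ hy0
        have a3 := mul_lt_mul_of_pos_left hx1 hθ
        have a4 := mul_lt_mul_of_pos_left hy1 hθ
        simp [block, CodedSystem.Follows, geo]
        refine ⟨⟨?_, ?_⟩, ?_, ?_⟩ <;> first | assumption | linarith
      · simp only [mem_geo_cell_true] at hz
        obtain ⟨⟨hx0, hx1⟩, hy0, hy1⟩ := hz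
        have a2 := mul_pos hθ hy0
        have a1 := mul_lt_mul_of_pos_left hx0 hθ
        have a3 := mul_lt_mul_of_pos_left hx1 hθ
        have a4 := mul_lt_mul_of_pos_left hy1 hθ
        rw [key] at a3
        simp [block, CodedSystem.Follows, geo, hε, flip]
        refine ⟨⟨⟨?_, ?_⟩, ?_, ?_⟩, ⟨⟨?_, ?_⟩, ?_, ?_⟩, ⟨?_, ?_⟩, ?_, ?_⟩ <;>
          first | assumption | linarith

/-! ### The sequence of renormalization steps -/

/-- The parameter after `k` renormalization steps. -/
def param (s : Param) (k : ℕ) : Param := nextParam^[k] s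

/-- The kinds of the successive renormalization steps. -/
def kinds (s : Param) (k : ℕ) : Kind := kindOf (param s k)

theorem param_succ (s : Param) (k : ℕ) : param s (k + 1) = nextParam (param s k) :=
  Function.iterate_succ_apply' _ _ _

theorem param_add (s : Param) (j k : ℕ) : param (param s j) k = param s (k + j) :=
  (Function.iterate_add_apply nextParam k j s).symm

theorem kinds_param (s : Param) (j : ℕ) : kinds (param s j) = fun k => kinds s (k + j) :=
  funext fun k => by rw [kinds, kinds, param_add]

theorem Good.iterate {s : Param} (hs : Good s) (k : ℕ) : Good (param s k) := by
  induction k with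
  | zero => exact hs
  | succ k ih => rw [param_succ]; exact ih.next

theorem Good.exists_cut {s : Param} (hs : Good s) : ∃ k, kinds s k = .cut := by
  -- a `refl` step with `1 < ℓ < 2` turns `1 / (ℓ - 1)` into `1 / (ℓ - 1) - 1`
  have h1 : ∀ N : ℕ, ∀ s : Param, Good s → s.2 = 1 → 1 / (s.1 - 1) < N → ∃ k, kinds s k = .cut := by
    intro N
    induction N with
    | zero =>
      intro s hs _ h
      have := hs.one_lt
      have : 0 < 1 / (s.1 - 1) := by apply one_div_pos.2; linarith
      simp at h
      linarith
    | succ N ih =>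
      intro s hs h1 hN
      rcases hs.cases with ⟨h, hk, -⟩ | ⟨-, h', -⟩ | ⟨h, -, -, h', -⟩
      · exact ⟨0, hk⟩
      · rw [h1] at h'; exact absurd h' (by decide)
      · obtain ⟨k, hk⟩ := ih _ hs.next (by rw [h']) (by
          rw [h']
          have h3 := hs.one_lt
          have h4 : (0 : ℝ) < 2 - s.1 := by linarith
          have h5 : (0 : ℝ) < s.1 - 1 := by linarith
          have : 1 / (1 / (2 - s.1) - 1) = 1 / (s.1 - 1) - 1 := by
            have : 1 / (2 - s.1) - 1 = (s.1 - 1) / (2 - s.1) := by field_simp; ring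
            rw [this]; field_simp; ring
          rw [this]
          push_cast at hN
          linarith)
        exact ⟨k + 1, by rw [← hk]; rfl⟩
  rcases hs.cases with ⟨h, hk, -⟩ | ⟨-, h', -, h, -⟩ | ⟨-, h', -, h, -⟩
  · exact ⟨0, hk⟩
  all_goals
    obtain ⟨N, hN⟩ := exists_nat_gt (1 / ((nextParam s).1 - 1))
    obtain ⟨k, hk⟩ := h1 N _ hs.next (by rw [h]) hN
    exact ⟨k + 1, by rw [← hk]; rfl⟩

theorem Good.exists_not_cut {s : Param} (hs : Good s) : ∃ k, kinds s k ≠ .cut := by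
  obtain ⟨N, hN⟩ := exists_nat_gt s.1
  induction N generalizing s with
  | zero => have := hs.one_lt; simp at hN; linarith
  | succ N ih =>
    rcases hs.cases with ⟨h, hk, h', -⟩ | ⟨-, -, hk, -⟩ | ⟨-, -, hk, -⟩
    · obtain ⟨k, hk⟩ := ih hs.next (by rw [h']; push_cast at hN; simp only; linarith)
      exact ⟨k + 1, hk⟩
    all_goals exact ⟨0, by rw [kinds, param, Function.iterate_zero_apply, hk]; simp⟩

theorem Good.mixing {s : Param} (hs : Good s) : Mixing (kinds s) where
  cut n := by
    obtain ⟨k, hk⟩ := (hs.iterate n).exists_cut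
    exact ⟨k + n, by omega, by rw [← hk, kinds_param]⟩
  not_cut n := by
    obtain ⟨k, hk⟩ := (hs.iterate n).exists_not_cut
    exact ⟨k + n, by omega, by rw [kinds_param] at hk; exact hk⟩

/-! ### Generic points -/

/-- The group `ℤ + ℤ ℓ`. -/
def Lat (ℓ : ℝ) : Set ℝ := {x | ∃ m n : ℤ, x = m + n * ℓ}

theorem countable_Lat (ℓ : ℝ) : (Lat ℓ).Countable := by
  have : Lat ℓ = range fun p : ℤ × ℤ => (p.1 + p.2 * ℓ : ℝ) := by
    ext x
    simp [Lat, eq_comm]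
  rw [this]
  exact countable_range _

theorem notMem_Lat_sub {ℓ x : ℝ} (hx : x ∉ Lat ℓ) (m n : ℤ) : (m + n * ℓ) - x ∉ Lat ℓ := by
  rintro ⟨m', n', h⟩
  exact hx ⟨m - m', n - n', by push_cast; linarith⟩

theorem notMem_Lat_add {ℓ x : ℝ} (hx : x ∉ Lat ℓ) (m n : ℤ) : x + (m + n * ℓ) ∉ Lat ℓ := by
  rintro ⟨m', n', h⟩
  exact hx ⟨m' - m, n' - n, by push_cast; linarith⟩

theorem notMem_Lat_flip {ℓ x : ℝ} (hx : x ∉ Lat ℓ) (ε : ℤˣ) : flip ε x ∉ Lat ℓ := by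
  rcases Int.units_eq_one_or ε with rfl | rfl
  · simpa [flip] using notMem_Lat_sub hx 1 0
  · simpa [flip] using hx

/-- The generic points of the rectangle `[0, ℓ] × [0, 1]`; their orbits avoid all sides. -/
def Gen (s : Param) : Set (ℝ × ℝ) :=
  {z | (0 < z.1 ∧ z.1 < s.1) ∧ (0 < z.2 ∧ z.2 < 1) ∧ z.1 ∉ Lat s.1 ∧ z.2 ∉ Lat s.1}

theorem Gen.mem_cell {s : Param} {z : ℝ × ℝ} (hz : z ∈ Gen s) :
    z.1 < 1 ∧ z ∈ (geo s).cell false ∨ 1 < z.1 ∧ z ∈ (geo s).cell true := by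
  have h1 : z.1 ≠ 1 := fun h => hz.2.2.1 ⟨1, 0, by simp [h]⟩
  rcases lt_or_gt_of_ne h1 with h | h
  · exact Or.inl ⟨h, ⟨hz.1.1, h⟩, hz.2.1⟩
  · exact Or.inr ⟨h, ⟨h, hz.1.2⟩, hz.2.1⟩

theorem Gen.map {s : Param} (hs : Good s) {z : ℝ × ℝ} (hz : z ∈ Gen s) {c : Letter}
    (hc : z ∈ (geo s).cell c) : (geo s).map c z ∈ Gen s := by
  have h1 := hs.one_lt
  obtain ⟨⟨hx0, hx1⟩, ⟨hy0, hy1⟩, hx, hy⟩ := hz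
  cases c
  · rw [mem_geo_cell_false] at hc
    refine ⟨⟨?_, ?_⟩, flip_mem hc.1.1 hc.1.2, ?_, notMem_Lat_flip hx _⟩
    · rw [geo_map_false]; simp only; linarith
    · rw [geo_map_false]; simp only; linarith
    · simpa [geo_map_false] using notMem_Lat_sub hy 0 1
  · rw [mem_geo_cell_true] at hc
    rw [geo_map_true]
    refine ⟨⟨?_, ?_⟩, ⟨?_, ?_⟩, ?_, ?_⟩
    · simp only; linarith [hc.1.1]
    · simp only; linarith [hc.1.1]
    · simp only; linarith
    · simp only; linarith
    · simpa [sub_eq_add_neg] using notMem_Lat_add hx (-1) 0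
    · simpa using notMem_Lat_sub hy 1 0

/-- An invariant set of pairs which lie in the right cells consists of coded points. -/
theorem CodedSystem.codes_of_invariant {X : Type*} {A : CodedSystem X}
    (Q : Set ((ℕ → Letter) × X)) (hQ : ∀ p ∈ Q, p.2 ∈ A.cell (p.1 0) ∧ A.next p ∈ Q)
    {p : (ℕ → Letter) × X} (hp : p ∈ Q) : A.Codes p := by
  intro n
  induction n generalizing p with
  | zero => exact (hQ p hp).1
  | succ n ih => exact ih (hQ p hp).2

theorem Gen.next {s : Param} (hs : Good s) {p : (ℕ → Letter) × (ℝ × ℝ)} (hz : p.2 ∈ Gen s)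
    (hc : (geo s).Codes p) (n : ℕ) : ((geo s).next^[n] p).2 ∈ Gen s := by
  induction n generalizing p with
  | zero => exact hz
  | succ n ih => exact ih (p := (geo s).next p) (Gen.map hs hz hc.mem) hc.next

/-- The coding of a point, in case it has one. -/
def code (s : Param) (z : ℝ × ℝ) (n : ℕ) : Letter :=
  decide (1 ≤ ((fun z => (geo s).map (decide (1 ≤ z.1)) z)^[n] z).1)

theorem next_code (s : Param) (z : ℝ × ℝ) :
    (geo s).next (code s z, z) =
      (code s ((geo s).map (code s z 0) z), (geo s).map (code s z 0) z) := rfl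

theorem Gen.codes {s : Param} (hs : Good s) {z : ℝ × ℝ} (hz : z ∈ Gen s) :
    (geo s).Codes (code s z, z) := by
  refine CodedSystem.codes_of_invariant {p | p.2 ∈ Gen s ∧ p.1 = code s p.2} ?_ ⟨hz, rfl⟩
  rintro ⟨v, z⟩ ⟨hz, hv⟩
  obtain rfl : v = code s z := hv
  have h : z ∈ (geo s).cell (code s z 0) := by
    rcases Gen.mem_cell hz with ⟨h, h'⟩ | ⟨h, h'⟩
    · have : code s z 0 = false := decide_eq_false (not_le.2 h)
      rwa [this]
    · have : code s z 0 = true := decide_eq_true h.le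
      rwa [this]
  refine ⟨h, ?_⟩
  rw [next_code]
  exact ⟨Gen.map hs hz h, rfl⟩

theorem notMem_Lat_rot {ℓ x : ℝ} (hℓ : ℓ - 1 ≠ 0) (hx : x ∉ Lat ℓ) :
    x / (ℓ - 1) ∉ Lat (1 / (ℓ - 1)) := by
  rintro ⟨m, n, h⟩
  refine hx ⟨n - m, m, ?_⟩
  field_simp at h
  push_cast
  linarith

theorem notMem_Lat_refl {ℓ x : ℝ} (hℓ : 2 - ℓ ≠ 0) (hx : x ∉ Lat ℓ) :
    x / (2 - ℓ) ∉ Lat (1 / (2 - ℓ)) := by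
  rintro ⟨m, n, h⟩
  refine hx ⟨2 * m + n, -m, ?_⟩
  field_simp at h
  push_cast
  linarith

/-- The embedding sends generic points to generic points. -/
theorem Gen.embed_mem {s : Param} (hs : Good s) {z : ℝ × ℝ} (hz : z ∈ Gen (nextParam s)) :
    embed s z ∈ Gen s := by
  have h1 := hs.one_lt
  obtain ⟨⟨hx0, hx1⟩, ⟨hy0, hy1⟩, hx, hy⟩ := hz
  rcases hs.cases with ⟨h, hk, hn, -, he⟩ | ⟨h, hε, hk, hn, -, he⟩ | ⟨h, hε, hk, hn, -, he⟩ <;>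
    rw [hn] at hx1 hx hy <;> rw [he]
  · refine ⟨⟨hx0, by simp only [id] at *; linarith⟩, ⟨hy0, hy1⟩, ?_, ?_⟩
    · rintro ⟨m, n, h⟩; exact hx ⟨m + n, n, by simp only [id] at h; push_cast; linarith⟩
    · rintro ⟨m, n, h⟩; exact hy ⟨m + n, n, by simp only [id] at h; push_cast; linarith⟩
  · have hθ : 0 < s.1 - 1 := by linarith
    have key : (s.1 - 1) * (1 / (s.1 - 1)) = 1 := by field_simp
    have a1 := mul_pos hθ hx0
    have a2 := mul_pos hθ hy0
    have a3 := mul_lt_mul_of_pos_left hx1 hθ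
    have a4 := mul_lt_mul_of_pos_left hy1 hθ
    rw [key] at a3
    have aux : ∀ x : ℝ, x ∉ Lat (1 / (s.1 - 1)) → (s.1 - 1) * x ∉ Lat s.1 := by
      rintro x hx ⟨m, n, h⟩
      refine hx ⟨n, m + n, ?_⟩
      field_simp
      push_cast
      linarith
    exact ⟨⟨a2, by simp only; linarith⟩, ⟨a1, by simp only; linarith⟩, aux _ hy, aux _ hx⟩
  · have hθ : 0 < 2 - s.1 := by linarith
    have key : (2 - s.1) * (1 / (2 - s.1)) = 1 := by field_simp
    have a1 := mul_pos hθ hx0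
    have a2 := mul_pos hθ hy0
    have a3 := mul_lt_mul_of_pos_left hx1 hθ
    have a4 := mul_lt_mul_of_pos_left hy1 hθ
    rw [key] at a3
    have aux : ∀ x : ℝ, x ∉ Lat (1 / (2 - s.1)) → (2 - s.1) * x ∉ Lat s.1 := by
      rintro x hx ⟨m, n, h⟩
      refine hx ⟨-n, m + 2 * n, ?_⟩
      field_simp
      push_cast
      linarith
    refine ⟨⟨a1, by simp only; linarith⟩, ⟨by simp only; linarith, by simp only; linarith⟩,
      aux _ hx, ?_⟩
    have := notMem_Lat_add (aux _ hy) (-1) 1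
    rwa [show (2 - s.1) * z.2 + (((-1 : ℤ) : ℝ) + ((1 : ℤ) : ℝ) * s.1) =
      (s.1 - 1) + (2 - s.1) * z.2 by push_cast; ring] at this

/-! ### Every generic point is periodic or renormalizable -/

/-- In the leftover square of a `rot` step the letters of the coding are all equal to `a`. -/
theorem codes_rot_leftover {s : Param} (hs : Good s) (hε : s.2 = -1) {z : ℝ × ℝ}
    (hx : s.1 - 1 < z.1 ∧ z.1 < 1) (hy : s.1 - 1 < z.2 ∧ z.2 < 1) :
    (geo s).Codes (fun _ => false, z) := by
  have h1 := hs.one_lt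
  refine CodedSystem.codes_of_invariant {p | p.1 = (fun _ => false) ∧
    (s.1 - 1 < p.2.1 ∧ p.2.1 < 1) ∧ (s.1 - 1 < p.2.2 ∧ p.2.2 < 1)} ?_ ⟨rfl, hx, hy⟩
  rintro ⟨v, z⟩ ⟨h0, hx, hy⟩
  simp only at h0 hx hy
  subst h0
  refine ⟨⟨⟨by linarith, hx.2⟩, by linarith, hy.2⟩, rfl, ?_⟩
  simp only [CodedSystem.next, geo_map_false, hε, flip_neg_one]
  exact ⟨⟨by linarith, by linarith⟩, hx⟩

/-- The leftover squares of a `refl` step are exchanged, and their codings alternate. -/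
theorem codes_refl_leftover {s : Param} (hs : Good s) (hε : s.2 = 1) (h2 : s.1 < 2) {z : ℝ × ℝ}
    (h : (0 < z.1 ∧ z.1 < s.1 - 1) ∧ (0 < z.2 ∧ z.2 < s.1 - 1) ∨
      (1 < z.1 ∧ z.1 < s.1) ∧ (2 - s.1 < z.2 ∧ z.2 < 1)) :
    ∃ v, shift^[2] v = v ∧ (geo s).Codes (v, z) := by
  have h1 := hs.one_lt
  set ab : ℕ → Letter := fun n => decide (n % 2 = 1)
  set ba : ℕ → Letter := fun n => decide (n % 2 = 0)
  have hab : shift ab = ba := by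
    funext n; simp only [shift, ab, ba, decide_eq_decide]; omega
  have hba : shift ba = ab := by
    funext n; simp only [shift, ab, ba, decide_eq_decide]; omega
  have key : ∀ p ∈ {p : (ℕ → Letter) × ℝ × ℝ |
      (p.1 = ab ∧ (0 < p.2.1 ∧ p.2.1 < s.1 - 1) ∧ (0 < p.2.2 ∧ p.2.2 < s.1 - 1)) ∨
      (p.1 = ba ∧ (1 < p.2.1 ∧ p.2.1 < s.1) ∧ (2 - s.1 < p.2.2 ∧ p.2.2 < 1))},
      (geo s).Codes p := by
    intro p hp
    refine CodedSystem.codes_of_invariant _ ?_ hp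
    rintro ⟨v, z⟩ (⟨h0, hx, hy⟩ | ⟨h0, hx, hy⟩) <;> simp only at h0 hx hy <;> subst h0
    · refine ⟨⟨⟨hx.1, by linarith⟩, hy.1, by linarith⟩, Or.inr ⟨hab, ?_⟩⟩
      simp only [CodedSystem.next]
      have : ab 0 = false := rfl
      rw [this, geo_map_false, hε, flip_one]
      exact ⟨⟨by simp only; linarith, by simp only; linarith⟩,
        by simp only; linarith, by simp only; linarith⟩
    · refine ⟨⟨hx, by linarith, by linarith⟩, Or.inl ⟨hba, ?_⟩⟩
      simp only [CodedSystem.next]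
      have : ba 0 = true := rfl
      rw [this, geo_map_true]
      exact ⟨⟨by simp only; linarith, by simp only; linarith⟩,
        by simp only; linarith, by simp only; linarith⟩
  rcases h with h | h
  · exact ⟨ab, by simp only [Function.iterate_succ, Function.iterate_zero, Function.comp_apply, hab,
      hba, id], key _ (Or.inl ⟨rfl, h⟩)⟩
  · exact ⟨ba, by simp only [Function.iterate_succ, Function.iterate_zero, Function.comp_apply, hab,
      hba, id], key _ (Or.inr ⟨rfl, h⟩)⟩

theorem mem_Gen_div {ℓ r p q : ℝ} (hr : 0 < r) (hL : ∀ x ∉ Lat ℓ, x / r ∉ Lat (1 / r))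
    (hp0 : 0 < p) (hp1 : p < 1) (hq0 : 0 < q) (hqr : q < r) (hp : p ∉ Lat ℓ) (hq : q ∉ Lat ℓ) :
    (p / r, q / r) ∈ Gen (1 / r, 1) ∧ (p < r → (p / r, q / r) ∈ (geo (1 / r, 1)).cell false) ∧
      (r < p → (p / r, q / r) ∈ (geo (1 / r, 1)).cell true) := by
  have h1 := div_pos hp0 hr
  have h2 := div_pos hq0 hr
  have h3 : q / r < 1 := (div_lt_one hr).2 hqr
  have h4 : p / r < 1 / r := by gcongr
  exact ⟨⟨⟨h1, h4⟩, ⟨h2, h3⟩, hL p hp, hL q hq⟩,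
    fun h => ⟨⟨h1, (div_lt_one hr).2 h⟩, h2, h3⟩, fun h => ⟨⟨(one_lt_div hr).2 h, h4⟩, h2, h3⟩⟩

/-- Every generic point either has a periodic coding, or is reached from the domain of the
renormalized system before the next return to this domain. -/
theorem Gen.exists_lift {s : Param} (hs : Good s) {v : ℕ → Letter} {z : ℝ × ℝ} (hz : z ∈ Gen s)
    (hv : (geo s).Codes (v, z)) :
    (∃ p, 1 ≤ p ∧ p ≤ 2 ∧ shift^[p] v = v) ∨
    ∃ v' y, y ∈ Gen (nextParam s) ∧ (geo (nextParam s)).Codes (v', y) ∧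
      ∃ i < blockLen (kindOf s) (v' 0),
        (v, z) = (geo s).next^[i] (CodedSystem.lift (kindOf s) (embed s) (v', y)) := by
  have h1 := hs.one_lt
  -- it suffices to find the point and the branches
  have key : ∀ c i y, i < blockLen (kindOf s) c → y ∈ Gen (nextParam s) →
      y ∈ (geo (nextParam s)).cell c →
      (geo s).act ((block (kindOf s) c).take i) (embed s y) = z →
      ∃ v' y, y ∈ Gen (nextParam s) ∧ (geo (nextParam s)).Codes (v', y) ∧
        ∃ i < blockLen (kindOf s) (v' 0), (v, z) = (geo s).next^[i]
          (CodedSystem.lift (kindOf s) (embed s) (v', y)) := by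
    intro c i y hi hy hyc hact
    have hcode := Gen.codes hs.next hy
    have h0 : code (nextParam s) y 0 = c := geo_cell_disjoint _ _ _ hcode.mem hyc
    refine ⟨_, y, hy, hcode, i, by rwa [h0], ?_⟩
    have h2 := (hs.renorm.codes hcode).iterate i
    have hlen : ((block (kindOf s) c).take i).length = i := by
      rw [List.length_take]; exact min_eq_left hi.le
    have h3 := CodedSystem.iterate_next_of_agree (A := geo s) (w := (block (kindOf s) c).take i)
      (p := CodedSystem.lift (kindOf s) (embed s) (code (nextParam s) y, y)) (by
        intro j hj
        rw [hlen] at hj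
        simp only [CodedSystem.lift]
        rw [substSeq_of_lt (by rw [h0]; exact hj.trans hi), h0]
        simp [hj])
    rw [hlen] at h3
    rw [h3] at h2 ⊢
    simp only [CodedSystem.lift] at h2 ⊢
    rw [hact] at h2 ⊢
    rw [hv.ext geo_cell_disjoint h2]
  obtain ⟨⟨hx0, hx1⟩, ⟨hy0, hy1⟩, hx, hy⟩ := id hz
  rcases hs.cases with ⟨h, hk, hn, -, he⟩ | ⟨h, hε, hk, hn, -, he⟩ | ⟨h, hε, hk, hn, -, he⟩ <;>
    rw [hk, hn, he] at key ⊢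
  · right
    have hsub : ∀ x ∉ Lat s.1, x ∉ Lat (s.1 - 1) := by
      rintro x hx ⟨m, n, h⟩
      exact hx ⟨m - n, n, by push_cast; linarith⟩
    rcases Gen.mem_cell hz with ⟨hz1, hc⟩ | ⟨hz1, hc⟩
    · exact key false 0 z (by decide)
        ⟨⟨hx0, by simp only; linarith⟩, ⟨hy0, hy1⟩, hsub _ hx, hsub _ hy⟩
        ⟨⟨hx0, hz1⟩, hy0, hy1⟩ rfl
    · have hne : z.1 ≠ s.1 - 1 := fun h => hx ⟨-1, 1, by rw [h]; push_cast; ring⟩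
      rcases lt_or_gt_of_ne hne with hlt | hgt
      · exact key true 0 z (by decide) ⟨⟨hx0, hlt⟩, ⟨hy0, hy1⟩, hsub _ hx, hsub _ hy⟩
          ⟨⟨hz1, hlt⟩, hy0, hy1⟩ rfl
      · have hf := flip_mem (ε := s.2) hy0 hy1
        have hff : flip s.2 (flip s.2 z.2) = z.2 := by
          rcases Int.units_eq_one_or s.2 with h | h <;> simp [h, flip]
        have hL : s.1 - z.1 ∉ Lat s.1 := by simpa using notMem_Lat_sub hx 0 1
        refine key false 1 (flip s.2 z.2, s.1 - z.1) (by decide) ⟨⟨hf.1, ?_⟩, ⟨?_, ?_⟩, ?_, ?_⟩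
          ⟨hf, ?_, ?_⟩ ?_
        any_goals simp only
        any_goals linarith
        · exact hsub _ (notMem_Lat_flip hy _)
        · exact hsub _ hL
        · simp [block, CodedSystem.act, geo_map_false, hff]
  · have hr : 0 < s.1 - 1 := by linarith
    have hL : ∀ x ∉ Lat s.1, x / (s.1 - 1) ∉ Lat (1 / (s.1 - 1)) :=
      fun x hx => notMem_Lat_rot hr.ne' hx
    have hθ : ∀ x ∉ Lat s.1, x ≠ s.1 - 1 := fun x hx h =>
      hx ⟨-1, 1, by rw [h]; push_cast; ring⟩
    have hx' : s.1 - z.1 ∉ Lat s.1 := by simpa using notMem_Lat_sub hx 0 1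
    have hy' : s.1 - z.2 ∉ Lat s.1 := by simpa using notMem_Lat_sub hy 0 1
    have hcancel : ∀ x, (s.1 - 1) * (x / (s.1 - 1)) = x := fun x => by field_simp
    rcases lt_or_gt_of_ne (hθ _ hx) with hxθ | hxθ
    · right
      have := mem_Gen_div hr hL hy0 hy1 hx0 hxθ hy hx
      rcases lt_or_gt_of_ne (hθ _ hy) with hyθ | hyθ
      · exact key false 0 _ (by decide) this.1 (this.2.1 hyθ)
          (by simp [CodedSystem.act, hcancel])
      · exact key true 0 _ (by decide) this.1 (this.2.2 hyθ)
          (by simp [CodedSystem.act, hcancel])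
    · rcases lt_or_gt_of_ne (hθ _ hy) with hyθ | hyθ
      · right
        have := mem_Gen_div hr hL (p := s.1 - z.1) (q := z.2) (by linarith) (by linarith) hy0 hyθ
          hx' hy
        rcases Gen.mem_cell hz with ⟨hz1, -⟩ | ⟨hz1, -⟩
        · exact key true 1 _ (by decide) this.1 (this.2.2 (by linarith))
            (by simp [block, CodedSystem.act, hcancel, geo_map_false, hε, flip_neg_one])
        · exact key false 1 _ (by decide) this.1 (this.2.1 (by linarith))
            (by simp [block, CodedSystem.act, hcancel, geo_map_false, hε, flip_neg_one])
      · rcases Gen.mem_cell hz with ⟨hz1, -⟩ | ⟨hz1, -⟩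
        · left
          have := codes_rot_leftover hs hε ⟨hxθ, hz1⟩ ⟨hyθ, hy1⟩
          exact ⟨1, le_rfl, by norm_num, by rw [hv.ext geo_cell_disjoint this]; rfl⟩
        · right
          have := mem_Gen_div hr hL (p := s.1 - z.2) (q := s.1 - z.1) (by linarith) (by linarith)
            (by linarith) (by linarith) hy' hx'
          exact key true 2 _ (by decide) this.1 (this.2.2 (by linarith))
            (by simp [block, CodedSystem.act, hcancel, geo_map_false, hε, flip_neg_one])
  · have hr : 0 < 2 - s.1 := by linarith
    have hL : ∀ x ∉ Lat s.1, x / (2 - s.1) ∉ Lat (1 / (2 - s.1)) :=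
      fun x hx => notMem_Lat_refl hr.ne' hx
    have hθ : ∀ x ∉ Lat s.1, x ≠ s.1 - 1 := fun x hx h =>
      hx ⟨-1, 1, by rw [h]; push_cast; ring⟩
    have hr2 : ∀ x ∉ Lat s.1, x ≠ 2 - s.1 := fun x hx h =>
      hx ⟨2, -1, by rw [h]; push_cast; ring⟩
    have hcancel : ∀ x, (2 - s.1) * (x / (2 - s.1)) = x := fun x => by field_simp
    have hsub : ∀ x ∉ Lat s.1, x - (s.1 - 1) ∉ Lat s.1 := fun x hx => by
      have := notMem_Lat_add hx 1 (-1)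
      rwa [show x + (((1 : ℤ) : ℝ) + ((-1 : ℤ) : ℝ) * s.1) = x - (s.1 - 1) by push_cast; ring]
        at this
    have hone : ∀ x ∉ Lat s.1, 1 - x ∉ Lat s.1 := fun x hx => by simpa using notMem_Lat_sub hx 1 0
    rcases Gen.mem_cell hz with ⟨hz1, -⟩ | ⟨hz1, -⟩
    · rcases lt_or_gt_of_ne (hθ _ hy) with hyθ | hyθ
      · rcases lt_or_gt_of_ne (hθ _ hx) with hxθ | hxθ
        · left
          obtain ⟨v', h', hv'⟩ := codes_refl_leftover hs hε h (Or.inl ⟨⟨hx0, hxθ⟩, hy0, hyθ⟩)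
          exact ⟨2, by norm_num, le_rfl, by rw [hv.ext geo_cell_disjoint hv', h']⟩
        · right
          have := mem_Gen_div hr hL (p := 1 - z.2) (q := 1 - z.1) (by linarith) (by linarith)
            (by linarith) (by linarith) (hone _ hy) (hone _ hx)
          exact key true 1 _ (by decide) this.1 (this.2.2 (by linarith))
            (by simp [block, CodedSystem.act, hcancel, geo_map_false, hε, flip_one])
      · right
        have := mem_Gen_div hr hL (p := z.1) (q := z.2 - (s.1 - 1)) (by linarith) (by linarith)
            (by linarith) (by linarith) hx (hsub _ hy)
        rcases lt_or_gt_of_ne (hr2 _ hx) with hxθ | hxθ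
        · exact key false 0 _ (by decide) this.1 (this.2.1 (by linarith))
            (by simp [CodedSystem.act, hcancel])
        · exact key true 0 _ (by decide) this.1 (this.2.2 (by linarith))
            (by simp [CodedSystem.act, hcancel])
    · rcases lt_or_gt_of_ne (hr2 _ hy) with hyθ | hyθ
      · right
        have := mem_Gen_div hr hL (p := z.1 - (s.1 - 1)) (q := z.2) (by linarith) (by linarith)
            (by linarith) (by linarith) (hsub _ hx) hy
        exact key true 2 _ (by decide) this.1 (this.2.2 (by linarith))
            (by
            simp only [block, CodedSystem.act, hcancel, geo_map_false, hε, flip_one, List.take]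
            exact Prod.ext (by simp only; ring) (by simp only; ring))
      · left
        obtain ⟨v', h', hv'⟩ := codes_refl_leftover hs hε h (Or.inr ⟨⟨hz1, hx1⟩, hyθ, hy1⟩)
        exact ⟨2, by norm_num, le_rfl, by rw [hv.ext geo_cell_disjoint hv', h']⟩

open CodedSystem

/-! ### Composition of the renormalizations -/

/-- The composition of the embeddings of `k` successive renormalizations. -/
def iterEmbed (s : Param) : ℕ → ℝ × ℝ → ℝ × ℝ
  | 0, z => z
  | k + 1, z => iterEmbed s k (embed (param s k) z)

/-- The composition of the lifts of `k` successive renormalizations. -/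
def iterLift (s : Param) (k : ℕ) (p : (ℕ → Letter) × (ℝ × ℝ)) : (ℕ → Letter) × (ℝ × ℝ) :=
  (iterSubst (kinds s) k p.1, iterEmbed s k p.2)

theorem iterLift_succ (s : Param) (k : ℕ) (p : (ℕ → Letter) × (ℝ × ℝ)) :
    iterLift s (k + 1) p = iterLift s k (lift (kinds s k) (embed (param s k)) p) := rfl

theorem iterate_next_iterLift {s : Param} (hs : Good s) (k : ℕ) (p : (ℕ → Letter) × (ℝ × ℝ))
    (m : ℕ) : (geo s).next^[wsum (height (kinds s) k) p.1 m] (iterLift s k p) =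
      iterLift s k ((geo (param s k)).next^[m] p) := by
  induction k generalizing p m with
  | zero =>
    simp only [height, wsum_const_one]
    rfl
  | succ k ih =>
    have h1 := ih (lift (kinds s k) (embed (param s k)) p) (wsum (blockLen (kinds s k)) p.1 m)
    have h2 := (hs.iterate k).renorm.iterate_next p m
    rw [lift, wsum_substSeq] at h1
    rw [param_succ, iterLift_succ, iterLift_succ, height]
    exact h1.trans (congrArg _ h2)

theorem Gen.iterEmbed_mem {s : Param} (hs : Good s) {k : ℕ} {z : ℝ × ℝ}
    (hz : z ∈ Gen (param s k)) : iterEmbed s k z ∈ Gen s := by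
  induction k generalizing z with
  | zero => exact hz
  | succ k ih =>
    rw [param_succ] at hz
    exact ih (Gen.embed_mem (hs.iterate k) hz)

theorem codes_iterLift {s : Param} (hs : Good s) {k : ℕ} {p : (ℕ → Letter) × (ℝ × ℝ)}
    (hp : (geo (param s k)).Codes p) : (geo s).Codes (iterLift s k p) := by
  induction k generalizing p with
  | zero => exact hp
  | succ k ih =>
    rw [param_succ] at hp
    exact ih ((hs.iterate k).renorm.codes hp)

/-- A generic point without a short period is reached from the domain of the `k`-th renormalized
system before the next return to this domain. -/
theorem Gen.exists_iterLift {s : Param} (hs : Good s) (k : ℕ) {v : ℕ → Letter} {z : ℝ × ℝ}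
    (hz : z ∈ Gen s) (hv : (geo s).Codes (v, z))
    (hper : ∀ p, 1 ≤ p → p ≤ 2 * 3 ^ k → shift^[p] v ≠ v) :
    ∃ v' y, y ∈ Gen (param s k) ∧ (geo (param s k)).Codes (v', y) ∧
      ∃ j < height (kinds s) k (v' 0), (v, z) = (geo s).next^[j] (iterLift s k (v', y)) := by
  induction k with
  | zero => exact ⟨v, z, hz, hv, 0, Nat.one_pos, rfl⟩
  | succ k ih =>
    obtain ⟨v', y, hy, hc, j, hj, hvz⟩ := ih fun p h1 h2 => hper p h1 (h2.trans (by
      rw [pow_succ]; omega))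
    have hv' : v = shift^[j] (iterSubst (kinds s) k v') := by
      have := congrArg Prod.fst hvz
      rwa [next_iterate_fst] at this
    rcases Gen.exists_lift (hs.iterate k) hy hc with ⟨p, hp1, hp2, hp⟩ |
      ⟨v'', y', hy', hc', i, hi, hvy⟩
    · exfalso
      refine hper (wsum (height (kinds s) k) v' p)
        (hp1.trans (le_wsum (height_pos _ _) _ _)) ?_ ?_
      · calc wsum (height (kinds s) k) v' p ≤ ∑ i ∈ Finset.range p, 3 ^ k :=
              Finset.sum_le_sum fun i _ => height_le _ _ _
          _ ≤ 2 * 3 ^ (k + 1) := by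
              rw [Finset.sum_const, Finset.card_range, smul_eq_mul, pow_succ]
              nlinarith [pow_pos (show 0 < 3 by norm_num) k]
      · rw [hv', ← Function.iterate_add_apply, add_comm, Function.iterate_add_apply,
          iterate_shift_iterSubst, hp]
    · have hv'' : v' = shift^[i] (substSeq (kinds s k) v'') := by
        have := congrArg Prod.fst hvy
        rwa [next_iterate_fst] at this
      have hj' : j < height (kinds s) k (substSeq (kinds s k) v'' i) := by
        rw [hv'', iterate_shift_apply, zero_add] at hj
        exact hj
      refine ⟨v'', y', by rwa [param_succ], by rwa [param_succ], _,
        (iterSubst_refine (κ := kinds s) hi hj').2, ?_⟩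
      rw [hvz, hvy, Function.iterate_add_apply, iterLift_succ]
      congr 1
      exact (iterate_next_iterLift hs k _ i).symm

/-! ### The graph of the parametrization -/

/-- The coded generic points whose coding is not eventually periodic with a period at most `n`. -/
def Aper (s : Param) (n : ℕ) : Set ((ℕ → Letter) × (ℝ × ℝ)) :=
  {p | p.2 ∈ Gen s ∧ (geo s).Codes p ∧ ∀ W ≤ n, ¬ EvPer (fun _ => 1) W p.1}

/-- The set of limits of coded generic points whose periods tend to infinity. It turns out to be the
graph of the map `h` from the subshift to the plane. -/
def limitSet (s : Param) : Set ((ℕ → Letter) × (ℝ × ℝ)) := ⋂ n, closure (Aper s n)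

theorem Aper_antitone (s : Param) : Antitone (Aper s) :=
  fun _ _ h _ hp => ⟨hp.1, hp.2.1, fun W hW => hp.2.2 W (hW.trans h)⟩

/-- Periods of a lifted word are at least as long as the towers. -/
theorem mem_Aper_iterLift {s : Param} (hs : Good s) {k n : ℕ}
    (hk : ∀ c, n < height (kinds s) k c) {p : (ℕ → Letter) × (ℝ × ℝ)}
    (hp : p.2 ∈ Gen (param s k)) (hc : (geo (param s k)).Codes p) : iterLift s k p ∈ Aper s n :=
  ⟨Gen.iterEmbed_mem hs hp, codes_iterLift hs hc, fun W hW h =>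
    absurd (h.of_iterSubst.le_of_forall hk) (by omega)⟩

theorem Aper.next {s : Param} (hs : Good s) {n : ℕ} {p : (ℕ → Letter) × (ℝ × ℝ)}
    (hp : p ∈ Aper s n) : (geo s).next p ∈ Aper s n :=
  ⟨Gen.next hs hp.1 hp.2.1 1, hp.2.1.next, fun W hW h =>
    hp.2.2 W hW ((evPer_iterate_shift 1).1 h)⟩

theorem Aper.iterate {s : Param} (hs : Good s) {n : ℕ} {p : (ℕ → Letter) × (ℝ × ℝ)}
    (hp : p ∈ Aper s n) (j : ℕ) : (geo s).next^[j] p ∈ Aper s n := by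
  induction j generalizing p with
  | zero => exact hp
  | succ j ih => exact ih (Aper.next hs hp)

/-- A generic point whose coding is not purely periodic with a period at most `n` has a coding
which is not eventually periodic with a period at most `N`, if `n` is large enough. -/
theorem exists_mem_Aper_of_not_periodic {s : Param} (hs : Good s) (N : ℕ) :
    ∃ n, ∀ v z, z ∈ Gen s → (geo s).Codes (v, z) → (∀ p, 1 ≤ p → p ≤ n → shift^[p] v ≠ v) →
      (v, z) ∈ Aper s N := by
  obtain ⟨k, hk⟩ := hs.mixing.exists_le_height (N + 1)
  refine ⟨2 * 3 ^ k, fun v z hz hv hper => ?_⟩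
  obtain ⟨v', y, hy, hc, j, -, h⟩ := Gen.exists_iterLift hs k hz hv hper
  rw [h]
  exact Aper.iterate hs (mem_Aper_iterLift hs (hk k le_rfl) hy hc) j

/-- Two weights which are comparable give comparable periods. -/
theorem EvPer.exists_of_weight {w w' : Letter → ℕ} {W : ℕ} {v : ℕ → Letter} (h : EvPer w W v)
    {C : ℕ} (hw : ∀ c, w' c ≤ C * w c) : ∃ W' ≤ C * W, EvPer w' W' v := by
  obtain ⟨M, p, hp, h, rfl⟩ := h
  refine ⟨_, ?_, M, p, hp, h, rfl⟩
  rw [wsum, wsum, Finset.mul_sum]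
  exact Finset.sum_le_sum fun i _ => hw _

theorem Aper.lift {s : Param} (hs : Good s) {n : ℕ} {p : (ℕ → Letter) × (ℝ × ℝ)}
    (hp : p ∈ Aper (nextParam s) n) :
    CodedSystem.lift (kindOf s) (embed s) p ∈ Aper s n := by
  refine ⟨Gen.embed_mem hs hp.1, hs.renorm.codes hp.2.1, fun W hW h => ?_⟩
  have h1 := EvPer.of_substSeq h
  rw [push_one] at h1
  obtain ⟨W', hW', h2⟩ := h1.exists_of_weight (w' := fun _ => 1) (C := 1) (fun c => by
    have := blockLen_pos (kindOf s) c; omega)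
  exact hp.2.2 W' (by omega) h2

/-- After an occurrence of the letter `b`, an orbit is in the domain of the renormalized system. -/
theorem Aper.exists_lift {s : Param} (hs : Good s) {n q : ℕ} {p : (ℕ → Letter) × (ℝ × ℝ)}
    (hp : p ∈ Aper s (3 * n + 2)) (hq : p.1 q = true) :
    ∃ p' ∈ Aper (nextParam s) n,
      (geo s).next^[q + 1] p = CodedSystem.lift (kindOf s) (embed s) p' := by
  obtain ⟨v, z⟩ := p
  obtain ⟨hz, hc, hper⟩ := hp
  rcases Gen.exists_lift hs hz hc with ⟨p, hp1, hp2, hp⟩ | ⟨v', y, hy, hc', i, hi, hvz⟩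
  · refine absurd ⟨0, p, hp1, by simpa using hp, rfl⟩ (hper _ ?_)
    rw [wsum_const_one]
    omega
  have hv : v = shift^[i] (substSeq (kindOf s) v') := by
    have := congrArg Prod.fst hvz
    rwa [next_iterate_fst] at this
  have hq' : substSeq (kindOf s) v' (q + i) = true :=
    (iterate_shift_apply _ i q).symm.trans (by rw [← hv]; exact hq)
  obtain ⟨m, hm⟩ := exists_wsum_of_substSeq_eq_true hq'
  refine ⟨(geo (nextParam s)).next^[m] (v', y), ⟨Gen.next hs.next hy hc' m, hc'.iterate m,
    fun W hW h => ?_⟩, ?_⟩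
  · rw [next_iterate_fst, evPer_iterate_shift] at h
    obtain ⟨W', hW', h2⟩ := h.exists_of_weight (w' := push (kindOf s) (fun _ => 1)) (C := 3)
      (fun c => by rw [push_one]; exact blockLen_le _ c)
    refine hper W' (by omega) ?_
    simp only [hv]
    exact (evPer_iterate_shift i).2 h2.substSeq
  · rw [hvz, ← Function.iterate_add_apply, ← hs.renorm.iterate_next, ← hm]
    congr 1
    omega

/-! ### Metric properties -/

theorem dist_flip (ε : ℤˣ) (x y : ℝ) : dist (flip ε x) (flip ε y) = dist x y := by
  rcases Int.units_eq_one_or ε with rfl | rfl <;> simp only [flip_one, flip_neg_one, dist_sub_left]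

/-- Both branches are Euclidean isometries which permute the directions of the axes, so they are
isometries for the supremum distance of the product as well. -/
theorem isometry_geo_map (s : Param) (c : Letter) : Isometry ((geo s).map c) := by
  refine Isometry.of_dist_eq fun z z' => ?_
  cases c
  · rw [geo_map_false, geo_map_false, Prod.dist_eq, Prod.dist_eq, max_comm]
    simp only [dist_flip, dist_sub_left]
  · rw [geo_map_true, geo_map_true, Prod.dist_eq, Prod.dist_eq]
    simp only [dist_sub_left, dist_sub_right]

theorem Good.dist_embed {s : Param} (hs : Good s) (z z' : ℝ × ℝ) :
    dist (embed s z) (embed s z') = ratio s * dist z z' := by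
  have hr := hs.ratio_pos
  rcases hs.cases with ⟨h, hk, hn, h', he⟩ | ⟨h, hε, hk, hn, h', he⟩ | ⟨h, hε, hk, hn, h', he⟩ <;>
    rw [h'] at hr <;> rw [h', he]
  · simp
  · simp only [Prod.dist_eq, Real.dist_eq, ← mul_sub, abs_mul, abs_of_pos hr]
    rw [max_comm, mul_max_of_nonneg _ _ hr.le]
  · simp only [Prod.dist_eq, Real.dist_eq, ← mul_sub, abs_mul, abs_of_pos hr, add_sub_add_left_eq_sub]
    rw [mul_max_of_nonneg _ _ hr.le]

theorem Good.embed_injective {s : Param} (hs : Good s) : Function.Injective (embed s) := by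
  intro z z' h
  have := hs.dist_embed z z'
  rw [h, dist_self] at this
  exact dist_eq_zero.1 ((mul_eq_zero.1 this.symm).resolve_left hs.ratio_pos.ne')

theorem Good.continuous_embed {s : Param} (hs : Good s) : Continuous (embed s) :=
  (LipschitzWith.of_dist_le_mul (K := ⟨ratio s, hs.ratio_pos.le⟩)
    fun z z' => (hs.dist_embed z z').le).continuous

theorem Good.continuous_lift {s : Param} (hs : Good s) :
    Continuous (CodedSystem.lift (kindOf s) (embed s)) :=
  ((continuous_substSeq _).comp continuous_fst).prodMk (hs.continuous_embed.comp continuous_snd)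

theorem Good.lift_injective {s : Param} (hs : Good s) :
    Function.Injective (CodedSystem.lift (kindOf s) (embed s)) := fun _ _ h =>
  Prod.ext (substSeq_injective _ (congrArg Prod.fst h)) (hs.embed_injective (congrArg Prod.snd h))

theorem continuous_next (s : Param) : Continuous (geo s).next := by
  refine (continuous_shift.comp continuous_fst).prodMk ?_
  refine continuous_iff_continuousAt.2 fun p => ?_
  have h1 : ContinuousAt (fun q : (ℕ → Letter) × (ℝ × ℝ) => (geo s).map (p.1 0) q.2) p :=
    ((isometry_geo_map s _).continuous.comp continuous_snd).continuousAt
  refine h1.congr ?_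
  have := (continuous_fst (X := ℕ → Letter) (Y := ℝ × ℝ)).continuousAt.eventually
    (eventually_agree p.1 1)
  filter_upwards [this] with q hq
  rw [hq 0 one_pos]

/-! ### Compactness and invariance of the limit set -/

/-- The closed rectangle `[0, ℓ] × [0, 1]`. -/
def domain (s : Param) : Set (ℝ × ℝ) := Icc 0 s.1 ×ˢ Icc 0 1

theorem isCompact_domain (s : Param) : IsCompact (domain s) := isCompact_Icc.prod isCompact_Icc

theorem closure_Aper_subset (s : Param) (n : ℕ) : closure (Aper s n) ⊆ univ ×ˢ domain s := by
  refine closure_minimal (fun p hp => ⟨mem_univ _, ?_⟩)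
    (isClosed_univ.prod (isCompact_domain s).isClosed)
  obtain ⟨⟨⟨hx0, hx1⟩, ⟨hy0, hy1⟩, -⟩, -⟩ := hp
  exact ⟨⟨hx0.le, hx1.le⟩, hy0.le, hy1.le⟩

theorem isCompact_closure_Aper (s : Param) (n : ℕ) : IsCompact (closure (Aper s n)) :=
  (isCompact_univ.prod (isCompact_domain s)).of_isClosed_subset isClosed_closure
    (closure_Aper_subset s n)

theorem isClosed_limitSet (s : Param) : IsClosed (limitSet s) :=
  isClosed_iInter fun _ => isClosed_closure

theorem limitSet_subset (s : Param) : limitSet s ⊆ univ ×ˢ domain s :=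
  (iInter_subset _ 0).trans (closure_Aper_subset s 0)

theorem isCompact_limitSet (s : Param) : IsCompact (limitSet s) :=
  (isCompact_closure_Aper s 0).of_isClosed_subset (isClosed_limitSet s) (iInter_subset _ 0)

/-- Words in the closure of the aperiodic pairs agree on every prefix with codings of generic
points. -/
theorem exists_agree_of_mem_closure {s : Param} {n : ℕ} {p : (ℕ → Letter) × (ℝ × ℝ)}
    (hp : p ∈ closure (Aper s n)) (m : ℕ) : ∃ q ∈ Aper s n, ∀ i < m, q.1 i = p.1 i := by
  have := (continuous_fst (X := ℕ → Letter) (Y := ℝ × ℝ)).continuousAt.eventually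
    (eventually_agree p.1 m)
  obtain ⟨q, h, hq⟩ := mem_closure_iff_nhds.1 hp _ this
  exact ⟨q, hq, h⟩

theorem next_mem_limitSet {s : Param} (hs : Good s) {p : (ℕ → Letter) × (ℝ × ℝ)}
    (hp : p ∈ limitSet s) : (geo s).next p ∈ limitSet s :=
  mem_iInter.2 fun n => map_mem_closure (continuous_next s) (mem_iInter.1 hp n)
    fun _ h => Aper.next hs h

theorem iterate_next_mem_limitSet {s : Param} (hs : Good s) {p : (ℕ → Letter) × (ℝ × ℝ)}
    (hp : p ∈ limitSet s) (n : ℕ) : (geo s).next^[n] p ∈ limitSet s := by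
  induction n generalizing p with
  | zero => exact hp
  | succ n ih => exact ih (next_mem_limitSet hs hp)

theorem lift_mem_limitSet {s : Param} (hs : Good s) {p : (ℕ → Letter) × (ℝ × ℝ)}
    (hp : p ∈ limitSet (nextParam s)) :
    CodedSystem.lift (kindOf s) (embed s) p ∈ limitSet s :=
  mem_iInter.2 fun n => map_mem_closure hs.continuous_lift (mem_iInter.1 hp n)
    fun _ h => Aper.lift hs h

theorem iterLift_mem_limitSet {s : Param} (hs : Good s) {k : ℕ} {p : (ℕ → Letter) × (ℝ × ℝ)}
    (hp : p ∈ limitSet (param s k)) : iterLift s k p ∈ limitSet s := by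
  induction k generalizing p with
  | zero => exact hp
  | succ k ih =>
    rw [param_succ] at hp
    exact ih (lift_mem_limitSet (hs.iterate k) hp)

/-- Descent in the limit set: after an occurrence of the letter `b`, the orbit of a point of the
limit set comes from the limit set of the renormalized system. -/
theorem exists_lift_of_mem_limitSet {s : Param} (hs : Good s) {p : (ℕ → Letter) × (ℝ × ℝ)}
    (hp : p ∈ limitSet s) {q : ℕ} (hq : p.1 q = true) :
    ∃ p' ∈ limitSet (nextParam s),
      (geo s).next^[q + 1] p = CodedSystem.lift (kindOf s) (embed s) p' := by
  have key : ∀ n, ∃ p' ∈ closure (Aper (nextParam s) n),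
      CodedSystem.lift (kindOf s) (embed s) p' = (geo s).next^[q + 1] p := by
    intro n
    have h1 : IsClosed (CodedSystem.lift (kindOf s) (embed s) '' closure (Aper (nextParam s) n)) :=
      ((isCompact_closure_Aper _ _).image hs.continuous_lift).isClosed
    refine h1.closure_subset ?_
    have h2 : p ∈ closure (Aper s (3 * n + 2) ∩ {r | r.1 q = true}) := by
      refine IsOpen.closure_inter ?_ ⟨mem_iInter.1 hp _, hq⟩
      exact (isOpen_discrete {c : Letter | c = true}).preimage
        ((continuous_apply (A := fun _ : ℕ => Letter) q).comp continuous_fst)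
    exact map_mem_closure ((continuous_next s).iterate (q + 1)) h2 fun r hr => by
      obtain ⟨p', hp', h⟩ := Aper.exists_lift hs hr.1 hr.2
      exact ⟨p', subset_closure hp', h.symm⟩
  obtain ⟨p', -, h⟩ := key 0
  refine ⟨p', mem_iInter.2 fun n => ?_, h.symm⟩
  obtain ⟨p'', hp'', h'⟩ := key n
  rwa [hs.lift_injective (h.trans h'.symm)]

/-! ### Scales -/

/-- The ratio of the similarity `iterEmbed s k`. -/
def scale (s : Param) (k : ℕ) : ℝ := ∏ i ∈ Finset.range k, ratio (param s i)

theorem scale_succ (s : Param) (k : ℕ) : scale s (k + 1) = scale s k * ratio (param s k) :=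
  Finset.prod_range_succ _ _

theorem Good.scale_pos {s : Param} (hs : Good s) (k : ℕ) : 0 < scale s k :=
  Finset.prod_pos fun i _ => (hs.iterate i).ratio_pos

theorem Good.dist_iterEmbed {s : Param} (hs : Good s) (k : ℕ) (z z' : ℝ × ℝ) :
    dist (iterEmbed s k z) (iterEmbed s k z') = scale s k * dist z z' := by
  induction k generalizing z z' with
  | zero => simp [iterEmbed, scale]
  | succ k ih => rw [iterEmbed, iterEmbed, ih, (hs.iterate k).dist_embed, scale_succ, mul_assoc]

/-- The relation between the sizes of the rectangles of successive levels. -/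
theorem Good.ratio_cases {s : Param} (hs : Good s) :
    (kindOf s = .cut ∧ 2 < s.1 ∧ ratio s = 1 ∧ (nextParam s).1 = s.1 - 1) ∨
    (kindOf s = .rot ∧ s.1 < 2 ∧ ratio s = s.1 - 1 ∧ ratio s * (nextParam s).1 = 1) ∨
    (kindOf s = .refl ∧ s.1 < 2 ∧ ratio s = 2 - s.1 ∧ ratio s * (nextParam s).1 = 1) := by
  have h1 := hs.one_lt
  rcases hs.cases with ⟨h, hk, hn, h', he⟩ | ⟨h, hε, hk, hn, h', he⟩ | ⟨h, hε, hk, hn, h', he⟩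
  · exact Or.inl ⟨hk, h, h', by rw [hn]⟩
  · refine Or.inr (Or.inl ⟨hk, h, h', ?_⟩)
    have : s.1 - 1 ≠ 0 := by linarith
    rw [hn, h']; simp only; field_simp
  · refine Or.inr (Or.inr ⟨hk, h, h', ?_⟩)
    have : 2 - s.1 ≠ 0 := by linarith
    rw [hn, h']; simp only; field_simp

/-- The half perimeter of the domains decreases, by the length of the small side at each `cut`
step. Hence the scales tend to `0`. -/
theorem Good.exists_scale_lt {s : Param} (hs : Good s) {δ : ℝ} (hδ : 0 < δ) :
    ∃ k₀, ∀ k ≥ k₀, scale s k < δ := by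
  have hanti : Antitone (scale s) := antitone_nat_of_succ_le fun k => by
    rw [scale_succ]
    refine mul_le_of_le_one_right (hs.scale_pos k).le ?_
    have := (hs.iterate k).one_lt
    rcases (hs.iterate k).ratio_cases with ⟨-, -, h, -⟩ | ⟨-, h', h, -⟩ | ⟨-, h', h, -⟩ <;>
      rw [h] <;> linarith
  have hP : ∀ k, scale s (k + 1) * (1 + (param s (k + 1)).1) ≤ scale s k * (1 + (param s k).1) ∧
      (kinds s k = .cut → scale s (k + 1) * (1 + (param s (k + 1)).1) ≤
        scale s k * (1 + (param s k).1) - scale s k) := by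
    intro k
    have h0 := hs.scale_pos k
    have h1 := (hs.iterate k).one_lt
    rw [scale_succ, param_succ, mul_assoc, show kinds s k = kindOf (param s k) from rfl]
    rcases (hs.iterate k).ratio_cases with ⟨hk, -, h, h'⟩ | ⟨hk, hl, h, h'⟩ | ⟨hk, hl, h, h'⟩
    · rw [hk, h, h']
      exact ⟨by nlinarith, fun _ => by nlinarith⟩
    · rw [hk, mul_add, h', h]
      exact ⟨by nlinarith, by simp⟩
    · rw [hk, mul_add, h', h]
      exact ⟨by nlinarith, by simp⟩
  by_contra! hcon
  have hge : ∀ k, δ ≤ scale s k := fun k => by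
    obtain ⟨j, hj, h⟩ := hcon k
    exact h.trans (hanti hj)
  have hmono : Antitone fun k => scale s k * (1 + (param s k).1) :=
    antitone_nat_of_succ_le fun k => (hP k).1
  have hN : ∀ N : ℕ, ∃ k, scale s k * (1 + (param s k).1) ≤ (1 + s.1) - N * δ := by
    intro N
    induction N with
    | zero => exact ⟨0, by simp [scale, param]⟩
    | succ N ih =>
      obtain ⟨k, hk⟩ := ih
      obtain ⟨j, hj, hc⟩ := hs.mixing.cut k
      refine ⟨j + 1, ?_⟩
      have h1 := (hP j).2 hc
      have h2 := hmono hj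
      simp only at h2
      have h3 := hge j
      push_cast
      linarith
  obtain ⟨N, hN'⟩ := exists_nat_gt ((1 + s.1) / δ)
  obtain ⟨k, hk⟩ := hN N
  rw [div_lt_iff₀ hδ] at hN'
  have := mul_pos (hs.scale_pos k) (show 0 < 1 + (param s k).1 by linarith [(hs.iterate k).one_lt])
  linarith

theorem isometry_iterate_next_snd (s : Param) (v : ℕ → Letter) (z z' : ℝ × ℝ) (n : ℕ) :
    dist ((geo s).next^[n] (v, z)).2 ((geo s).next^[n] (v, z')).2 = dist z z' := by
  induction n generalizing v z z' with
  | zero => rfl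
  | succ n ih =>
    rw [Function.iterate_succ_apply, Function.iterate_succ_apply, CodedSystem.next,
      CodedSystem.next, ih]
    exact (isometry_geo_map s _).dist_eq _ _

theorem dist_le_of_mem_domain {s : Param} (hs : Good s) {z z' : ℝ × ℝ} (hz : z ∈ domain s)
    (hz' : z' ∈ domain s) : dist z z' ≤ s.1 := by
  have h1 := hs.one_lt
  obtain ⟨⟨a, b⟩, c, d⟩ := hz
  obtain ⟨⟨a', b'⟩, c', d'⟩ := hz'
  rw [Prod.dist_eq, Real.dist_eq, Real.dist_eq]
  refine max_le (abs_le.2 ⟨by linarith, by linarith⟩) (abs_le.2 ⟨by linarith, by linarith⟩)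

/-! ### The limit set projects onto the subshift -/

theorem exists_Gen_mem {s : Param} {U : Set (ℝ × ℝ)} (hU : IsOpen U) {z : ℝ × ℝ} (hz : z ∈ U)
    (hx : 0 < z.1 ∧ z.1 < s.1) (hy : 0 < z.2 ∧ z.2 < 1) : ∃ z' ∈ Gen s, z' ∈ U := by
  have hd : Dense ((Lat s.1)ᶜ ×ˢ (Lat s.1)ᶜ : Set (ℝ × ℝ)) :=
    ((countable_Lat s.1).dense_compl ℝ).prod ((countable_Lat s.1).dense_compl ℝ)
  obtain ⟨z', h, hU'⟩ := hd.inter_open_nonempty (U ∩ Ioo 0 s.1 ×ˢ Ioo 0 1)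
    (hU.inter (isOpen_Ioo.prod isOpen_Ioo)) ⟨z, hz, hx, hy⟩
  exact ⟨z', ⟨h.2.1, h.2.2, hU'.1, hU'.2⟩, h.1⟩

/-- If `ℓ < 2`, then two letters `b` do not follow each other in a coding. -/
theorem not_true_true {s : Param} (h2 : s.1 < 2) {p : (ℕ → Letter) × (ℝ × ℝ)}
    (hp : (geo s).Codes p) (h0 : p.1 0 = true) : p.1 1 = false := by
  by_contra h1
  have m0 := hp 0
  have m1 := hp 1
  rw [Bool.not_eq_false] at h1
  rw [h0] at m0
  rw [h1] at m1
  simp only [Function.iterate_one, CodedSystem.next, h0, geo_map_true,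
    Function.iterate_zero_apply] at m0 m1
  rw [mem_geo_cell_true] at m0 m1
  simp only at m0 m1
  linarith [m0.1.2, m1.1.1]

/-- Any pair of letters other than `bb` occurs in a limit word with first step `rot` or `refl`. -/
theorem IsLimit.exists_pair {κ : ℕ → Kind} (h : Mixing κ) (hκ : κ 0 ≠ .cut) {u : ℕ → Letter}
    (hu : IsLimit κ u) {c d : Letter} (hcd : c = true → d = false) :
    ∃ q, u q = c ∧ u (q + 1) = d := by
  obtain ⟨u', hu'⟩ := (h.tail 1).exists_isLimit
  obtain ⟨q, hq⟩ := hu'.exists_eq_true (h.tail 1) (self_mem_subshift u')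
  rw [hu.eq_substSeq_tail h hu']
  have hb : block (κ 0) true = [false, false, true] := by
    cases hk : κ 0 <;> simp_all [block]
  have hl : blockLen (κ 0) (u' q) = 3 := by rw [hq, blockLen, hb]; rfl
  have h1 : ∀ r < 3, substSeq (κ 0) u' (wsum (blockLen (κ 0)) u' q + r) =
      [false, false, true].getD r la := by
    intro r hr
    rw [substSeq_wsum_add (by omega), hq, hb]
  have h3 : substSeq (κ 0) u' (wsum (blockLen (κ 0)) u' q + 2 + 1) = false := by
    have := substSeq_wsum_add (κ := κ 0) (v := u') (m := q + 1) (r := 0) (blockLen_pos _ _)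
    rw [wsum_succ, hl, add_zero] at this
    rw [add_assoc, this]
    cases hk : κ 0 <;> cases u' (q + 1) <;> simp_all [block]
  cases c <;> cases d
  · exact ⟨_, h1 0 (by norm_num), h1 1 (by norm_num)⟩
  · exact ⟨_, h1 1 (by norm_num), h1 2 (by norm_num)⟩
  · exact ⟨_, h1 2 (by norm_num), h3⟩
  · exact absurd (hcd rfl) (by decide)

theorem Good.lt_two_iff {s : Param} (hs : Good s) : kindOf s ≠ .cut ↔ s.1 < 2 := by
  rcases hs.ratio_cases with ⟨hk, h, -⟩ | ⟨hk, h, -⟩ | ⟨hk, h, -⟩ <;> simp [hk, h]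
  exact h.le

/-- A prefix of a word of the limit set is covered by two consecutive blocks of a high level, and
every pair of consecutive letters which is possible at this level occurs in the limit word. -/
theorem mem_subshift_of_mem_limitSet {s : Param} (hs : Good s) {u : ℕ → Letter}
    (hu : IsLimit (kinds s) u) {p : (ℕ → Letter) × (ℝ × ℝ)} (hp : p ∈ limitSet s) :
    p.1 ∈ subshift u := by
  refine mem_subshift_of_agree fun m => ?_
  obtain ⟨k₀, hk₀⟩ := hs.mixing.exists_le_height m
  obtain ⟨k, hk, hkc⟩ := hs.mixing.not_cut k₀
  obtain ⟨⟨v, z⟩, ⟨hz, hc, hper⟩, hagree⟩ :=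
    exists_agree_of_mem_closure (mem_iInter.1 hp (2 * 3 ^ k)) m
  obtain ⟨v', y, hy, hc', j, hj, hvz⟩ := Gen.exists_iterLift hs k hz hc fun p h1 h2 h3 =>
    hper p h2 ⟨0, p, h1, by simpa using h3, wsum_const_one _ _⟩
  have hv : v = shift^[j] (iterSubst (kinds s) k v') := by
    have := congrArg Prod.fst hvz
    rwa [next_iterate_fst] at this
  have hmix := hs.mixing.tail k
  obtain ⟨u', hu'⟩ := hmix.exists_isLimit
  obtain ⟨q, hq0, hq1⟩ := hu'.exists_pair hmix (by simpa using hkc) (c := v' 0) (d := v' 1)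
    (not_true_true ((hs.iterate k).lt_two_iff.1 hkc) hc')
  refine ⟨j + wsum (height (kinds s) k) u' q, fun i hi => ?_⟩
  rw [← hagree i hi, hv, hu.eq_iterSubst hs.mixing hu', ← add_assoc,
    ← iterate_shift_apply (iterSubst (kinds s) k u') _ (i + j), iterate_shift_iterSubst]
  simp only [iterate_shift_apply (iterSubst (kinds s) k v')]
  refine (iterSubst_congr _ k (m := 2) (fun r hr => ?_) (i + j) ?_).symm
  · rw [iterate_shift_apply]
    interval_cases r
    · rw [zero_add, hq0]
    · rw [add_comm, hq1]
  · rw [wsum_succ, wsum_one]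
    have := hk₀ k hk (v' 1)
    omega

theorem mem_cell_center (s : Param) : ((1 / 2, 1 / 2) : ℝ × ℝ) ∈ (geo s).cell false := by
  rw [mem_geo_cell_false]; norm_num

theorem isOpen_geo_cell (s : Param) (c : Letter) : IsOpen ((geo s).cell c) := by
  cases c
  · exact isOpen_Ioo.prod isOpen_Ioo
  · exact isOpen_Ioo.prod isOpen_Ioo

/-- The limit word is approximated by the codings of generic points in the base of the tower above
`a` of a high level. -/
theorem limit_mem_closure_Aper {s : Param} (hs : Good s) {u : ℕ → Letter}
    (hu : IsLimit (kinds s) u) (n : ℕ) : ∃ z, (u, z) ∈ closure (Aper s n) := by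
  have hclosed : IsClosed (Prod.fst '' closure (Aper s n)) :=
    ((isCompact_closure_Aper s n).image continuous_fst).isClosed
  suffices u ∈ Prod.fst '' closure (Aper s n) by
    obtain ⟨⟨_, z⟩, h, rfl⟩ := this
    exact ⟨z, h⟩
  refine hclosed.closure_subset (mem_closure_iff_nhds.2 fun t ht => ?_)
  -- words with long common prefixes belong to a given neighbourhood
  have hex : ∀ m : ℕ, ∃ p ∈ Aper s n, ∀ i < m, p.1 i = u i := by
    intro m
    obtain ⟨k, hk⟩ := hs.mixing.exists_le_height (max (n + 1) m)
    obtain ⟨y, hy, hyc⟩ := exists_Gen_mem (s := param s k) (isOpen_geo_cell _ false)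
      (mem_cell_center _) (by have := (hs.iterate k).one_lt; simp only; constructor <;> linarith)
      (by norm_num)
    have hcode := Gen.codes (hs.iterate k) hy
    have h0 : code (param s k) y 0 = false := geo_cell_disjoint _ _ _ hcode.mem hyc
    refine ⟨_, mem_Aper_iterLift hs (fun c => ?_) hy hcode, fun i hi => hu k _ h0 i ?_⟩
    · exact (le_max_left (n + 1) m).trans (hk k le_rfl c)
    · exact hi.trans_le ((le_max_right (n + 1) m).trans (hk k le_rfl _))
  choose p hp hpu using hex
  have hlim : Tendsto (fun m => (p m).1) atTop (𝓝 u) := tendsto_pi_nhds.2 fun i =>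
    tendsto_const_nhds.congr' (by
      filter_upwards [eventually_gt_atTop i] with m hm
      rw [hpu m i hm])
  obtain ⟨m, hm⟩ := (hlim.eventually ht).exists
  exact ⟨_, hm, p m, subset_closure (hp m), rfl⟩

/-- Every word of the subshift occurs in the limit set, since the words of the limit set form a
closed shift invariant set which contains the limit word. -/
theorem exists_mem_limitSet {s : Param} (hs : Good s) {u : ℕ → Letter}
    (hu : IsLimit (kinds s) u) {v : ℕ → Letter} (hv : v ∈ subshift u) :
    ∃ z, (v, z) ∈ limitSet s := by
  suffices subshift u ⊆ Prod.fst '' limitSet s by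
    obtain ⟨⟨_, z⟩, h, rfl⟩ := this hv
    exact ⟨z, h⟩
  refine subshift_subset ((isCompact_limitSet s).image continuous_fst).isClosed ?_ ?_
  · rintro _ ⟨p, hp, rfl⟩
    exact ⟨_, next_mem_limitSet hs hp, rfl⟩
  · have := IsCompact.nonempty_iInter_of_sequence_nonempty_isCompact_isClosed
      (fun n => (fun z : ℝ × ℝ => (u, z)) ⁻¹' closure (Aper s n) ∩ domain s)
      (fun n => inter_subset_inter_left _
        (preimage_mono (closure_mono (Aper_antitone s n.le_succ))))
      (fun n => by
        obtain ⟨z, hz⟩ := limit_mem_closure_Aper hs hu n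
        exact ⟨z, hz, (closure_Aper_subset s n hz).2⟩)
      ((isCompact_domain s).inter_left (isClosed_closure.preimage (by fun_prop)))
      (fun n => (isClosed_closure.preimage (by fun_prop)).inter (isCompact_domain s).isClosed)
    obtain ⟨z, hz⟩ := this
    exact ⟨(u, z), mem_iInter.2 fun n => (mem_iInter.1 hz n).1, rfl⟩

/-- Each word of the subshift parametrizes one point only: two candidates for the same word are at
the same distance, up to the scale, as two candidates at a renormalized level. -/
theorem eq_of_mem_limitSet {s : Param} (hs : Good s) {v : ℕ → Letter} {z z' : ℝ × ℝ}
    (hz : (v, z) ∈ limitSet s) (hz' : (v, z') ∈ limitSet s) : z = z' := by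
  have key : ∀ k, ∃ w y y', (w, y) ∈ limitSet (param s k) ∧ (w, y') ∈ limitSet (param s k) ∧
      dist z z' = scale s k * dist y y' := by
    intro k
    induction k with
    | zero => exact ⟨v, z, z', hz, hz', by simp [scale]⟩
    | succ k ih =>
      obtain ⟨w, y, y', hy, hy', hd⟩ := ih
      have hg := hs.iterate k
      obtain ⟨u, hu⟩ := hg.mixing.exists_isLimit
      obtain ⟨q, hq⟩ := hu.exists_eq_true hg.mixing (mem_subshift_of_mem_limitSet hg hu hy)
      obtain ⟨⟨w₁, x⟩, hx, h1⟩ := exists_lift_of_mem_limitSet hg hy hq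
      obtain ⟨⟨w₂, x'⟩, hx', h2⟩ := exists_lift_of_mem_limitSet hg hy' hq
      have e : w₁ = w₂ := by
        refine substSeq_injective (kindOf (param s k)) ?_
        have e1 := congrArg Prod.fst h1
        have e2 := congrArg Prod.fst h2
        rw [next_iterate_fst] at e1 e2
        exact e1.symm.trans e2
      subst e
      refine ⟨w₁, x, x', by rwa [param_succ], by rwa [param_succ], ?_⟩
      rw [hd, ← isometry_iterate_next_snd (param s k) w y y' (q + 1), h1, h2, scale_succ, mul_assoc]
      congr 1
      exact hg.dist_embed x x'
  refine eq_of_forall_dist_le fun δ hδ => ?_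
  obtain ⟨k₀, hk₀⟩ := hs.exists_scale_lt (half_pos hδ)
  obtain ⟨k, hk, hkc⟩ := hs.mixing.not_cut k₀
  obtain ⟨w, y, y', hy, hy', hd⟩ := key k
  have h1 := dist_le_of_mem_domain (hs.iterate k) (limitSet_subset _ hy).2 (limitSet_subset _ hy').2
  have h2 := (hs.iterate k).lt_two_iff.1 hkc
  have h3 := hk₀ k hk
  have h4 := hs.scale_pos k
  rw [hd]
  nlinarith

/-! ### The aperiodic set -/

/-- The parameter `(1 + θ, ε)` of the rectangle on which `T_(θ,ε)` acts. -/
def toGeo (ω : Param) : Param := (1 + ω.1, ω.2)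

theorem interior_square : interior square = Ioo 0 1 ×ˢ Ioo 0 1 := by
  rw [square, interior_prod_eq, interior_Icc]

theorem interior_rect (θ : ℝ) : interior (rect θ) = Ioo 1 (1 + θ) ×ˢ Ioo 0 1 := by
  rw [rect, interior_prod_eq, interior_Icc, interior_Icc]

theorem cell_false_eq (ω : Param) : (geo (toGeo ω)).cell false = interior square :=
  interior_square.symm

theorem cell_true_eq (ω : Param) : (geo (toGeo ω)).cell true = interior (rect ω.1) :=
  (interior_rect ω.1).symm

theorem T_eq_map {ω : Param} {c : Letter} {z : ℝ × ℝ} (hz : z ∈ (geo (toGeo ω)).cell c) :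
    T ω z = (geo (toGeo ω)).map c z := by
  cases c
  · rw [cell_false_eq] at hz
    rw [T, if_pos hz]; rfl
  · have h : z ∉ interior square := fun h => by
      rw [← cell_false_eq ω] at h
      exact absurd (geo_cell_disjoint _ _ _ h hz) (by decide)
    rw [cell_true_eq] at hz
    rw [T, if_neg h, if_pos hz]; rfl

theorem domT_eq (ω : Param) : domT ω = {z | ∃ c, z ∈ (geo (toGeo ω)).cell c} := by
  ext z
  rw [domT, ← cell_false_eq ω, ← cell_true_eq ω]
  simp

theorem notMem_boundarySet_of_mem_cell {ω : Param} {c : Letter} {z : ℝ × ℝ}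
    (hz : z ∈ (geo (toGeo ω)).cell c) : z ∉ boundarySet ω.1 := by
  have hsq : IsClosed square := isClosed_Icc.prod isClosed_Icc
  have hre : IsClosed (rect ω.1) := isClosed_Icc.prod isClosed_Icc
  rintro (h | h)
  · rw [hsq.frontier_eq] at h
    cases c
    · exact h.2 (by rwa [cell_false_eq] at hz)
    · exact absurd hz.1.1 (not_lt.2 h.1.1.2)
  · rw [hre.frontier_eq] at h
    cases c
    · exact absurd hz.1.2 (not_lt.2 h.1.1.1)
    · exact h.2 (by rwa [cell_true_eq] at hz)

theorem exists_mem_cell {ω : Param} {z : ℝ × ℝ} (hz : z ∈ square ∪ rect ω.1)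
    (hb : z ∉ boundarySet ω.1) : ∃ c, z ∈ (geo (toGeo ω)).cell c := by
  have hsq : IsClosed square := isClosed_Icc.prod isClosed_Icc
  have hre : IsClosed (rect ω.1) := isClosed_Icc.prod isClosed_Icc
  rw [boundarySet, hsq.frontier_eq, hre.frontier_eq] at hb
  rcases hz with h | h
  · refine ⟨false, ?_⟩
    rw [cell_false_eq]
    by_contra h'
    exact hb (Or.inl ⟨h, h'⟩)
  · refine ⟨true, ?_⟩
    rw [cell_true_eq]
    by_contra h'
    exact hb (Or.inr ⟨h, h'⟩)

theorem mem_square_union_rect {ω : Param} (hs : Good (toGeo ω)) {c : Letter} {z : ℝ × ℝ}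
    (hz : z ∈ (geo (toGeo ω)).cell c) :
    z ∈ square ∪ rect ω.1 ∧ T ω z ∈ square ∪ rect ω.1 := by
  have h1 : 0 < ω.1 := by have := hs.one_lt; simp only [toGeo] at this; linarith
  have aux : ∀ x y : ℝ, 0 ≤ x → x ≤ 1 + ω.1 → 0 ≤ y → y ≤ 1 → (x, y) ∈ square ∪ rect ω.1 := by
    intro x y hx hx' hy hy'
    rcases le_total x 1 with h | h
    · exact Or.inl ⟨⟨hx, h⟩, hy, hy'⟩
    · exact Or.inr ⟨⟨h, hx'⟩, hy, hy'⟩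
  rw [T_eq_map hz]
  cases c
  · rw [mem_geo_cell_false] at hz
    have := flip_mem (ε := ω.2) hz.1.1 hz.1.2
    refine ⟨aux z.1 z.2 ?_ ?_ ?_ ?_, aux _ _ ?_ ?_ this.1.le this.2.le⟩
    all_goals try simp only [toGeo]
    all_goals linarith
  · rw [mem_geo_cell_true] at hz
    simp only [toGeo] at hz
    refine ⟨aux z.1 z.2 ?_ ?_ ?_ ?_, aux _ _ ?_ ?_ ?_ ?_⟩ <;> linarith

theorem regularSet_next {ω : Param} (hs : Good (toGeo ω)) {z : ℝ × ℝ} (hz : z ∈ regularSet ω) :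
    T ω z ∈ regularSet ω := by
  obtain ⟨c, hc⟩ := exists_mem_cell hz.1 (hz.2 0)
  exact ⟨(mem_square_union_rect hs hc).2, fun k => hz.2 (k + 1)⟩

theorem coding_zero {ω : Param} {c : Letter} {z : ℝ × ℝ} (hz : z ∈ (geo (toGeo ω)).cell c) :
    coding ω z 0 = c := by
  cases c
  · rw [coding, if_pos]; exact hz.1.2
  · rw [coding, if_neg]; exact not_lt.2 hz.1.1.le

theorem next_coding {ω : Param} {z : ℝ × ℝ} (hz : z ∈ (geo (toGeo ω)).cell (coding ω z 0)) :
    (geo (toGeo ω)).next (coding ω z, z) = (coding ω (T ω z), T ω z) :=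
  Prod.ext rfl (T_eq_map hz).symm

/-- The coding of a regular point codes it. -/
theorem codes_coding {ω : Param} (hs : Good (toGeo ω)) {z : ℝ × ℝ} (hz : z ∈ regularSet ω) :
    (geo (toGeo ω)).Codes (coding ω z, z) := by
  refine codes_of_invariant {p | p.2 ∈ regularSet ω ∧ p.1 = coding ω p.2} ?_ ⟨hz, rfl⟩
  rintro ⟨v, z⟩ ⟨hz, hv⟩
  obtain rfl : v = coding ω z := hv
  obtain ⟨c, hc⟩ := exists_mem_cell hz.1 (hz.2 0)
  rw [← coding_zero hc] at hc
  refine ⟨hc, ?_⟩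
  rw [next_coding hc]
  exact ⟨regularSet_next hs hz, rfl⟩

/-- Coded points are regular. -/
theorem mem_regularSet_of_codes {ω : Param} (hs : Good (toGeo ω)) {v : ℕ → Letter} {z : ℝ × ℝ}
    (h : (geo (toGeo ω)).Codes (v, z)) : z ∈ regularSet ω := by
  refine ⟨(mem_square_union_rect hs h.mem).1, fun k => ?_⟩
  induction k generalizing v z with
  | zero => exact notMem_boundarySet_of_mem_cell h.mem
  | succ k ih =>
    rw [Function.iterate_succ_apply, T_eq_map h.mem]
    exact ih h.next

theorem coding_eq_of_codes {ω : Param} (hs : Good (toGeo ω)) {v : ℕ → Letter} {z : ℝ × ℝ}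
    (h : (geo (toGeo ω)).Codes (v, z)) : coding ω z = v :=
  (codes_coding hs (mem_regularSet_of_codes hs h)).ext geo_cell_disjoint h

/-- The coding is locally constant, in the sense of prefixes. -/
theorem eventually_agree_of_codes {s : Param} {v : ℕ → Letter} {z : ℝ × ℝ}
    (h : (geo s).Codes (v, z)) (m : ℕ) :
    ∀ᶠ z' in 𝓝 z, ∀ v', (geo s).Codes (v', z') → ∀ i < m, v' i = v i := by
  induction m generalizing v z with
  | zero => exact Eventually.of_forall fun _ _ _ i hi => absurd hi (Nat.not_lt_zero i)
  | succ m ih =>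
    have h1 := ih h.next
    have h2 := (isometry_geo_map s (v 0)).continuous.continuousAt.eventually h1
    filter_upwards [h2, (isOpen_geo_cell s (v 0)).mem_nhds h.mem] with z' h3 h4 v' h' i hi
    have h0 : v' 0 = v 0 := geo_cell_disjoint _ _ _ h'.mem h4
    rcases i with - | i
    · exact h0
    · refine h3 (shift v') ?_ i (by omega)
      have := h'.next
      simp only [CodedSystem.next, h0] at this
      exact this

theorem shift_iterate_eq_iff {v : ℕ → Letter} {p : ℕ} :
    shift^[p] v = v ↔ ∀ k, v (k + p) = v k := by
  rw [funext_iff]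
  simp only [iterate_shift_apply]

/-- The aperiodic set is the projection of the limit set. -/
theorem aperiodicSet_eq {ω : Param} (hs : Good (toGeo ω)) :
    aperiodicSet ω = Prod.snd '' limitSet (toGeo ω) := by
  apply Subset.antisymm
  · intro z hz
    have hN : ∀ N, z ∈ Prod.snd '' closure (Aper (toGeo ω) N) := by
      intro N
      obtain ⟨n, hn⟩ := exists_mem_Aper_of_not_periodic hs N
      have hclosed : IsClosed (Prod.snd '' closure (Aper (toGeo ω) N)) :=
        ((isCompact_closure_Aper _ N).image continuous_snd).isClosed
      refine closure_minimal (fun z₁ hz₁ => ?_) hclosed (mem_iInter.1 hz n)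
      obtain ⟨hreg, hper⟩ := hz₁
      have hcode := codes_coding hs hreg
      refine hclosed.closure_subset (mem_closure_iff_nhds.2 fun t ht => ?_)
      -- non-periodicity with a bounded period is an open condition
      have hev : ∀ p ∈ Finset.Icc 1 n, ∀ᶠ z' in 𝓝 z₁, ∀ v',
          (geo (toGeo ω)).Codes (v', z') → shift^[p] v' ≠ v' := by
        intro p hp
        rw [Finset.mem_Icc] at hp
        have : ∃ k, coding ω z₁ (k + p) ≠ coding ω z₁ k := by
          by_contra! h
          exact hper ⟨hreg, p, hp.1, hp.2, h⟩
        obtain ⟨k, hk⟩ := this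
        filter_upwards [eventually_agree_of_codes hcode (k + p + 1)] with z' h v' hv' hpv
        rw [shift_iterate_eq_iff] at hpv
        refine hk ?_
        rw [← h v' hv' (k + p) (by omega), ← h v' hv' k (by omega), hpv]
      have hev' := (Filter.eventually_all_finset (Finset.Icc 1 n)).2 hev
      obtain ⟨U, hU, hUo, hzU⟩ := mem_nhds_iff.1 (inter_mem ht hev')
      have h1 := hs.one_lt
      have hdom : (0 < z₁.1 ∧ z₁.1 < (toGeo ω).1) ∧ 0 < z₁.2 ∧ z₁.2 < 1 := by
        have : z₁ ∈ (geo (toGeo ω)).cell (coding ω z₁ 0) := hcode.mem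
        generalize coding ω z₁ 0 = c at this
        cases c
        · rw [mem_geo_cell_false] at this
          exact ⟨⟨this.1.1, by linarith [this.1.2]⟩, this.2⟩
        · rw [mem_geo_cell_true] at this
          exact ⟨⟨by linarith [this.1.1], this.1.2⟩, this.2⟩
      obtain ⟨z₂, hz₂, hz₂U⟩ := exists_Gen_mem hUo hzU hdom.1 hdom.2
      have hcode₂ := Gen.codes hs hz₂
      exact ⟨z₂, (hU hz₂U).1, _, subset_closure (hn _ z₂ hz₂ hcode₂ fun p hp1 hp2 =>
        (hU hz₂U).2 p (Finset.mem_Icc.2 ⟨hp1, hp2⟩) _ hcode₂), rfl⟩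
    have := IsCompact.nonempty_iInter_of_sequence_nonempty_isCompact_isClosed
      (fun n => (fun v : ℕ → Letter => (v, z)) ⁻¹' closure (Aper (toGeo ω) n))
      (fun n => preimage_mono (closure_mono (Aper_antitone _ n.le_succ)))
      (fun n => by
        obtain ⟨⟨v, _⟩, h, rfl⟩ := hN n
        exact ⟨v, h⟩)
      (isClosed_closure.preimage (by fun_prop)).isCompact
      (fun n => isClosed_closure.preimage (by fun_prop))
    obtain ⟨v, hv⟩ := this
    exact ⟨(v, z), mem_iInter.2 fun n => mem_iInter.1 hv n, rfl⟩
  · rintro _ ⟨p, hp, rfl⟩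
    refine mem_iInter.2 fun n => map_mem_closure continuous_snd (mem_iInter.1 hp n) ?_
    rintro ⟨v, z⟩ ⟨hz, hc, hper⟩
    refine ⟨mem_regularSet_of_codes hs hc, ?_⟩
    rintro ⟨-, q, hq1, hq2, hq⟩
    rw [coding_eq_of_codes hs hc] at hq
    exact hper q hq2 ⟨0, q, hq1, by simpa using shift_iterate_eq_iff.2 hq, wsum_const_one _ _⟩

/-! ### The parametrization of the aperiodic set -/

/-- A point of the limit set inside an open cell has the letter of this cell. -/
theorem limitSet_letter {s : Param} {p : (ℕ → Letter) × (ℝ × ℝ)} (hp : p ∈ limitSet s)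
    {c : Letter} (hc : p.2 ∈ (geo s).cell c) : p.1 0 = c := by
  have h1 := (continuous_fst (X := ℕ → Letter) (Y := ℝ × ℝ)).continuousAt.eventually
    (eventually_agree p.1 1)
  have h2 := (continuous_snd (X := ℕ → Letter) (Y := ℝ × ℝ)).continuousAt.eventually
    ((isOpen_geo_cell s c).mem_nhds hc)
  obtain ⟨q, ⟨hq1, hq2⟩, hq⟩ := mem_closure_iff_nhds.1 (mem_iInter.1 hp 0) _ (h1.and h2)
  rw [← hq1 0 one_pos]
  exact geo_cell_disjoint _ _ _ hq.2.1.mem hq2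

/-- In the fibre of the limit set above a regular point, the only word is the coding of this point.
-/
theorem codes_of_mem_limitSet {ω : Param} (hs : Good (toGeo ω)) {p : (ℕ → Letter) × (ℝ × ℝ)}
    (hp : p ∈ limitSet (toGeo ω)) (hreg : p.2 ∈ regularSet ω) : (geo (toGeo ω)).Codes p := by
  refine codes_of_invariant {p | p ∈ limitSet (toGeo ω) ∧ p.2 ∈ regularSet ω} ?_ ⟨hp, hreg⟩
  rintro p ⟨hp, hreg⟩
  obtain ⟨c, hc⟩ := exists_mem_cell hreg.1 (hreg.2 0)
  obtain rfl := limitSet_letter hp hc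
  refine ⟨hc, next_mem_limitSet hs hp, ?_⟩
  have := regularSet_next hs hreg
  rwa [T_eq_map hc] at this

/-- The limit set is the graph of a continuous function on the subshift. -/
theorem exists_parametrization {s : Param} (hs : Good s) {u : ℕ → Letter}
    (hu : IsLimit (kinds s) u) :
    ∃ h : subshift u → ℝ × ℝ, Continuous h ∧
      ∀ (v : subshift u) z, ((v : ℕ → Letter), z) ∈ limitSet s ↔ z = h v := by
  choose h hh using fun v : subshift u => exists_mem_limitSet hs hu v.2
  have hiff : ∀ (v : subshift u) z, ((v : ℕ → Letter), z) ∈ limitSet s ↔ z = h v :=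
    fun v z => ⟨fun hz => eq_of_mem_limitSet hs hz (hh v), fun hz => hz ▸ hh v⟩
  exact ⟨h, continuous_of_isClosed_graph (isCompact_domain s) (isClosed_limitSet s)
    (fun v => (limitSet_subset s (hh v)).2) (fun v z _ => hiff v z), hiff⟩

/-! ### First returns and floors of the towers -/

/-- Points inside a tower, above its base, are not in the domain of the renormalized system. -/
theorem act_take_ne_embed {s : Param} (hs : Good s) {c : Letter} {r : ℕ} (hr : 0 < r)
    (hrc : r < blockLen (kindOf s) c) {x y : ℝ × ℝ} (hx : x ∈ (geo (nextParam s)).cell c)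
    (hy : y ∈ Gen (nextParam s)) :
    (geo s).act ((block (kindOf s) c).take r) (embed s x) ≠ embed s y := by
  have h1 := hs.one_lt
  obtain ⟨⟨hy0, hy1⟩, ⟨hy2, hy3⟩, -⟩ := hy
  intro heq
  rcases hs.cases with ⟨h, hk, hn, -, he⟩ | ⟨h, hε, hk, hn, -, he⟩ | ⟨h, hε, hk, hn, -, he⟩ <;>
    rw [hk] at hrc heq <;> rw [hn] at hx hy1 <;> rw [he] at heq
  · cases c
    · obtain rfl : r = 1 := by simp [blockLen, block] at hrc; omega
      rw [mem_geo_cell_false] at hx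
      have := congrArg Prod.fst heq
      simp [block, act, geo_map_false] at this
      simp only at hy1
      linarith
    · simp [blockLen, block] at hrc; omega
  · have hθ : 0 < s.1 - 1 := by linarith
    have key : (s.1 - 1) * (1 / (s.1 - 1)) = 1 := by field_simp
    have b1 := mul_lt_mul_of_pos_left hy3 hθ
    have hfst := congrArg Prod.fst heq
    cases c
    · rw [mem_geo_cell_false] at hx
      have a1 := mul_lt_mul_of_pos_left hx.1.2 hθ
      obtain rfl : r = 1 := by simp [blockLen, block] at hrc; omega
      simp [block, act, geo_map_false] at hfst
      linarith
    · rw [mem_geo_cell_true] at hx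
      have a1 := mul_lt_mul_of_pos_left hx.1.2 hθ
      have a2 := mul_lt_mul_of_pos_left hx.2.2 hθ
      rw [key] at a1
      have hr' : r < 3 := by simpa [blockLen, block] using hrc
      interval_cases r <;> simp [block, act, geo_map_false, hε, flip_neg_one] at hfst <;> linarith
  · have hθ : 0 < 2 - s.1 := by linarith
    have key : (2 - s.1) * (1 / (2 - s.1)) = 1 := by field_simp
    have b1 := mul_pos hθ hy2
    have b2 := mul_lt_mul_of_pos_left hy1 hθ
    rw [key] at b2
    have hfst := congrArg Prod.fst heq
    have hsnd := congrArg Prod.snd heq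
    cases c
    · simp [blockLen, block] at hrc; omega
    · rw [mem_geo_cell_true] at hx
      have a1 := mul_lt_mul_of_pos_left hx.1.1 hθ
      have hr' : r < 3 := by simpa [blockLen, block] using hrc
      interval_cases r <;> simp [block, act, geo_map_false, hε, flip_one] at hfst hsnd <;> linarith

/-- The renormalized system is the first return map of the original one to the domain of the
renormalization. -/
theorem exists_of_iterate_next_lift_eq {s : Param} (hs : Good s) {i : ℕ}
    {p p' : (ℕ → Letter) × (ℝ × ℝ)} (hp : p.2 ∈ Gen (nextParam s))
    (hp' : (geo (nextParam s)).Codes p')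
    (h : (geo s).next^[i] (lift (kindOf s) (embed s) p') = lift (kindOf s) (embed s) p) :
    ∃ m, (geo (nextParam s)).next^[m] p' = p ∧ i = wsum (blockLen (kindOf s)) p'.1 m := by
  obtain ⟨m, r, rfl, hr⟩ := exists_wsum_add_lt (blockLen_pos (kindOf s)) p'.1 i
  rw [add_comm, Function.iterate_add_apply, hs.renorm.iterate_next] at h
  have h0 : ((geo (nextParam s)).next^[m] p').1 0 = p'.1 m := by
    rw [next_iterate_fst, iterate_shift_apply, zero_add]
  rcases Nat.eq_zero_or_pos r with rfl | hr0
  · exact ⟨m, hs.lift_injective h, rfl⟩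
  · exfalso
    rw [← h0] at hr
    refine act_take_ne_embed hs hr0 hr (hp'.iterate m).mem hp ?_
    have hlen : ((block (kindOf s) (((geo (nextParam s)).next^[m] p').1 0)).take r).length = r := by
      rw [List.length_take]; exact min_eq_left hr.le
    have h3 := iterate_next_of_agree (A := geo s)
      (w := (block (kindOf s) (((geo (nextParam s)).next^[m] p').1 0)).take r)
      (p := lift (kindOf s) (embed s) ((geo (nextParam s)).next^[m] p')) (by
        intro j hj
        rw [hlen] at hj
        simp only [lift]
        rw [substSeq_of_lt (hj.trans hr)]
        simp [hj])
    rw [hlen, h] at h3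
    exact (congrArg Prod.snd h3).symm

/-- An orbit returns to the domain of the `k`-th renormalized system exactly at the times given by
its induced orbit. -/
theorem exists_of_iterate_next_iterLift_eq {s : Param} (hs : Good s) {k i : ℕ}
    {p p' : (ℕ → Letter) × (ℝ × ℝ)} (hp : p.2 ∈ Gen (param s k))
    (hp' : (geo (param s k)).Codes p')
    (h : (geo s).next^[i] (iterLift s k p') = iterLift s k p) :
    ∃ m, (geo (param s k)).next^[m] p' = p ∧ i = wsum (height (kinds s) k) p'.1 m := by
  induction k generalizing p p' i with
  | zero => exact ⟨i, h, (wsum_const_one _ _).symm⟩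
  | succ k ih =>
    rw [param_succ] at hp hp'
    have hg := hs.iterate k
    obtain ⟨m, hm, rfl⟩ := ih (p := lift (kindOf (param s k)) (embed (param s k)) p)
      (p' := lift (kindOf (param s k)) (embed (param s k)) p') (Gen.embed_mem hg hp)
      (hg.renorm.codes hp') h
    obtain ⟨m', hm', rfl⟩ := exists_of_iterate_next_lift_eq hg hp hp' hm
    refine ⟨m', by rwa [param_succ], ?_⟩
    exact wsum_substSeq _ _ _ _

/-- The piecewise isometry is injective on the union of its open cells. -/
theorem next_injOn_codes {s : Param} {p p' : (ℕ → Letter) × (ℝ × ℝ)}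
    (hp : (geo s).Codes p) (hp' : (geo s).Codes p') (h : (geo s).next p = (geo s).next p') :
    p = p' := by
  obtain ⟨v, z⟩ := p
  obtain ⟨v', z'⟩ := p'
  have h1 : shift v = shift v' := congrArg Prod.fst h
  have h2 : (geo s).map (v 0) z = (geo s).map (v' 0) z' := congrArg Prod.snd h
  have m1 : z ∈ (geo s).cell (v 0) := hp.mem
  have m2 : z' ∈ (geo s).cell (v' 0) := hp'.mem
  -- the images of the two cells are on the two sides of the line `x = ℓ - 1`
  have aux : ∀ z z' : ℝ × ℝ, z ∈ (geo s).cell false → z' ∈ (geo s).cell true →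
      (geo s).map false z ≠ (geo s).map true z' := by
    intro z z' hz hz' h
    rw [mem_geo_cell_false] at hz
    rw [mem_geo_cell_true] at hz'
    have := congrArg Prod.fst h
    rw [geo_map_false, geo_map_true] at this
    simp only at this
    linarith
  have h0 : v 0 = v' 0 := by
    cases e : v 0 <;> cases e' : v' 0 <;> rw [e] at h2 m1 <;> rw [e'] at h2 m2
    · exact absurd h2 (aux _ _ m1 m2)
    · exact absurd h2.symm (aux _ _ m2 m1)
  rw [← h0] at h2
  refine Prod.ext (funext fun n => ?_) ((isometry_geo_map s _).injective h2)
  rcases n with - | n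
  · exact h0
  · exact congrFun h1 n

theorem iterate_next_injOn_codes {s : Param} {p p' : (ℕ → Letter) × (ℝ × ℝ)}
    (hp : (geo s).Codes p) (hp' : (geo s).Codes p') {n : ℕ}
    (h : (geo s).next^[n] p = (geo s).next^[n] p') : p = p' := by
  induction n generalizing p p' with
  | zero => exact h
  | succ n ih => exact next_injOn_codes hp hp' (ih hp.next hp'.next h)

theorem next_iterate_snd_congr {s : Param} {v v' : ℕ → Letter} {n : ℕ} (h : ∀ i < n, v i = v' i)
    (z : ℝ × ℝ) : ((geo s).next^[n] (v, z)).2 = ((geo s).next^[n] (v', z)).2 := by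
  induction n generalizing v v' z with
  | zero => rfl
  | succ n ih =>
    rw [Function.iterate_succ_apply, Function.iterate_succ_apply]
    simp only [CodedSystem.next]
    rw [h 0 (by omega)]
    exact ih (fun i hi => h (i + 1) (by omega)) _

/-- The similarity which sends the cell of the letter `c` of level `k` to the `j`-th floor of the
tower above it. -/
def floorMap (s : Param) (k : ℕ) (c : Letter) (j : ℕ) (z : ℝ × ℝ) : ℝ × ℝ :=
  ((geo s).next^[j] (iterLift s k (fun _ => c, z))).2

theorem iterate_next_iterLift_snd {s : Param} {k j : ℕ} {p : (ℕ → Letter) × (ℝ × ℝ)}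
    (hj : j < height (kinds s) k (p.1 0)) :
    ((geo s).next^[j] (iterLift s k p)).2 = floorMap s k (p.1 0) j p.2 := by
  refine next_iterate_snd_congr (fun i hi => ?_) _
  refine iterSubst_congr (kinds s) k (m := 1) (fun r hr => ?_) i ?_
  · obtain rfl : r = 0 := by omega
    rfl
  · rw [wsum_one]; omega

theorem Good.dist_floorMap {s : Param} (hs : Good s) (k : ℕ) (c : Letter) (j : ℕ) (z z' : ℝ × ℝ) :
    dist (floorMap s k c j z) (floorMap s k c j z') = scale s k * dist z z' := by
  rw [← hs.dist_iterEmbed]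
  exact isometry_iterate_next_snd s _ _ _ j

/-- The floors of a tower are pairwise disjoint. -/
theorem floorMap_disjoint {s : Param} (hs : Good s) {k : ℕ} {c : Letter} {j j' : ℕ}
    (hj' : j' < height (kinds s) k c) (hjj : j < j') {y y' : ℝ × ℝ} (hy : y ∈ Gen (param s k))
    (hy' : y' ∈ Gen (param s k)) (hc : y ∈ (geo (param s k)).cell c)
    (hc' : y' ∈ (geo (param s k)).cell c) : floorMap s k c j y ≠ floorMap s k c j' y' := by
  intro heq
  have hg := hs.iterate k
  have hcode := Gen.codes hg hy
  have hcode' := Gen.codes hg hy'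
  have h0 : code (param s k) y 0 = c := geo_cell_disjoint _ _ _ hcode.mem hc
  have h0' : code (param s k) y' 0 = c := geo_cell_disjoint _ _ _ hcode'.mem hc'
  have e1 := iterate_next_iterLift_snd (s := s) (k := k) (j := j) (p := (code (param s k) y, y))
    (by simp only [h0]; omega)
  have e2 := iterate_next_iterLift_snd (s := s) (k := k) (j := j') (p := (code (param s k) y', y'))
    (by simp only [h0']; omega)
  simp only [h0] at e1
  simp only [h0'] at e2
  have c1 := (codes_iterLift hs hcode).iterate j
  have c2 := (codes_iterLift hs hcode').iterate j'
  have e3 : (geo s).next^[j] (iterLift s k (code (param s k) y, y)) =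
      (geo s).next^[j'] (iterLift s k (code (param s k) y', y')) := by
    have e4 := e1.trans (heq.trans e2.symm)
    refine Prod.ext ?_ e4
    rw [← Prod.mk.eta (p := (geo s).next^[j] _)] at c1
    rw [← Prod.mk.eta (p := (geo s).next^[j'] _), ← e4] at c2
    exact c1.ext geo_cell_disjoint c2
  obtain ⟨d, rfl⟩ := Nat.exists_eq_add_of_lt hjj
  rw [add_assoc, Function.iterate_add_apply] at e3
  have e5 := iterate_next_injOn_codes (codes_iterLift hs hcode)
    ((codes_iterLift hs hcode').iterate (d + 1)) e3
  obtain ⟨m, -, hm⟩ := exists_of_iterate_next_iterLift_eq hs (p := (code (param s k) y, y)) hy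
    hcode' e5.symm
  rcases m with - | m
  · simp at hm
  · rw [wsum_succ'] at hm
    simp only [h0'] at hm
    omega

/-! ### Growth of the heights of the towers -/

/-- The quantity `λ_k (2 |a|_k + (ℓ_k - 1) |b|_k)`, where `λ_k` is the scale and `|a|_k, |b|_k` are
the heights of the towers of level `k`. It never decreases, and it tends to infinity. -/
def mass (s : Param) (k : ℕ) : ℝ :=
  scale s k * (2 * height (kinds s) k false + ((param s k).1 - 1) * height (kinds s) k true)

open Classical in
theorem height_false_succ (κ : ℕ → Kind) (k : ℕ) : (height κ (k + 1) false : ℝ) =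
    if κ k = .refl then (height κ k false : ℝ) else height κ k false + height κ k true := by
  rw [height, push]
  cases κ k <;> simp [block]

open Classical in
theorem height_true_succ (κ : ℕ → Kind) (k : ℕ) : (height κ (k + 1) true : ℝ) =
    if κ k = .cut then (height κ k true : ℝ) else 2 * height κ k false + height κ k true := by
  rw [height, push]
  cases κ k <;> simp [block] <;> ring

open Classical in
/-- The mass is preserved by `refl` steps. Other steps increase it by the height of the letter `b`
times the scale. -/
theorem Good.mass_succ {s : Param} (hs : Good s) (k : ℕ) : mass s (k + 1) =
    if kinds s k = .refl then mass s k else mass s k + scale s k * height (kinds s) k true := by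
  have h1 := (hs.iterate k).one_lt
  rw [mass, mass, scale_succ, height_false_succ, height_true_succ, param_succ]
  rcases (hs.iterate k).ratio_cases with ⟨hk, -, h, h'⟩ | ⟨hk, hl, h, h'⟩ | ⟨hk, hl, h, h'⟩ <;>
    simp only [show kinds s k = kindOf (param s k) from rfl, hk, reduceCtorEq, if_true, if_false]
  · rw [h, h']; ring
  · linear_combination (scale s k * (2 * height (kinds s) k false + height (kinds s) k true)) * h' +
      (scale s k * height (kinds s) k true) * h
  · linear_combination (scale s k * (2 * height (kinds s) k false + height (kinds s) k true)) * h' -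
      (scale s k * height (kinds s) k true) * h

theorem Good.mass_le_succ {s : Param} (hs : Good s) (k : ℕ) : mass s k ≤ mass s (k + 1) := by
  rw [hs.mass_succ]
  have := hs.scale_pos k
  split_ifs
  · exact le_rfl
  · exact le_add_of_nonneg_right (by positivity)

theorem Good.mass_mono {s : Param} (hs : Good s) : Monotone (mass s) :=
  monotone_nat_of_le_succ hs.mass_le_succ

theorem Good.two_le_mass {s : Param} (hs : Good s) (k : ℕ) : 2 ≤ mass s k := by
  refine le_trans ?_ (hs.mass_mono (Nat.zero_le k))
  have := hs.one_lt
  simp only [mass, scale, height, param, Finset.range_zero, Finset.prod_empty,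
    Function.iterate_zero, id, Nat.cast_one]
  linarith

/-- During a run of `cut` steps the mass increases by a definite amount. -/
theorem Good.exists_end_of_run {s : Param} (hs : Good s) {k : ℕ} (hk : 2 < (param s k).1) :
    ∃ j ≥ k, 2 < (param s j).1 ∧ (param s j).1 < 3 ∧
      mass s k + scale s k * height (kinds s) k true * (param s k).1 / 3 ≤ mass s (j + 1) := by
  obtain ⟨N, hN⟩ := exists_nat_gt (param s k).1
  induction N generalizing k with
  | zero => simp at hN; linarith
  | succ N ih =>
    have hY : 0 ≤ scale s k * height (kinds s) k true := by have := hs.scale_pos k; positivity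
    have h3 : (param s k).1 ≠ 3 := fun h => (hs.iterate k).irrational ⟨3, by rw [h]; norm_num⟩
    rcases (hs.iterate k).ratio_cases with ⟨hc, -, h, h'⟩ | ⟨-, hl, -⟩ | ⟨-, hl, -⟩
    rotate_left
    · linarith
    · linarith
    have hm := hs.mass_succ k
    rw [if_neg (by simp [kinds, hc])] at hm
    rcases lt_or_gt_of_ne h3 with h3 | h3
    · refine ⟨k, le_rfl, hk, h3, ?_⟩
      rw [hm]
      nlinarith
    · rw [← param_succ] at h'
      push_cast at hN
      obtain ⟨j, hj, hj2, hj3, hm'⟩ := ih (k := k + 1) (by linarith) (by linarith)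
      refine ⟨j, by omega, hj2, hj3, ?_⟩
      rw [hm, scale_succ, h, mul_one, height_true_succ, if_pos (show kinds s k = .cut from hc),
        h'] at hm'
      nlinarith

/-- The mass tends to infinity: every maximal run of `cut` steps which follows another step
increases it by at least `2 / 3`. -/
theorem Good.exists_lt_mass {s : Param} (hs : Good s) (C : ℝ) : ∃ k, C ≤ mass s k := by
  suffices ∀ N : ℕ, ∃ k, N * (2 / 3) ≤ mass s k by
    obtain ⟨N, hN⟩ := exists_nat_ge (C * (3 / 2))
    obtain ⟨k, hk⟩ := this N
    exact ⟨k, by linarith⟩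
  intro N
  induction N with
  | zero => exact ⟨0, by have := hs.two_le_mass 0; push_cast; linarith⟩
  | succ N ih =>
    obtain ⟨k, hk⟩ := ih
    -- a step of kind `rot` or `refl` followed by a step of kind `cut`
    obtain ⟨i, hi, hic, hc⟩ : ∃ i ≥ k, kinds s i ≠ .cut ∧ kinds s (i + 1) = .cut := by
      obtain ⟨i, hi, hic⟩ := hs.mixing.not_cut k
      obtain ⟨j, hj, hjc⟩ := hs.mixing.cut i
      induction j, hj using Nat.le_induction with
      | base => exact absurd hjc hic
      | succ j hj ih =>
        by_cases h : kinds s j = .cut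
        · exact ih h
        · exact ⟨j, by omega, h, hjc⟩
    have hi1 := (hs.iterate i).one_lt
    have h2 : 2 < (param s (i + 1)).1 := by
      rcases (hs.iterate (i + 1)).ratio_cases with ⟨-, h, -⟩ | ⟨h, -⟩ | ⟨h, -⟩
      · exact h
      all_goals exact absurd (hc.symm.trans h) (by simp)
    obtain ⟨j, -, -, -, hj⟩ := hs.exists_end_of_run h2
    refine ⟨j + 1, le_trans ?_ hj⟩
    have hY : scale s (i + 1) * height (kinds s) (i + 1) true * (param s (i + 1)).1 =
        scale s i * (2 * height (kinds s) i false + height (kinds s) i true) := by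
      rw [scale_succ, height_true_succ, if_neg hic, param_succ]
      rcases (hs.iterate i).ratio_cases with ⟨h, -⟩ | ⟨-, -, -, h⟩ | ⟨-, -, -, h⟩
      · exact absurd h hic
      all_goals linear_combination scale s i *
        (2 * height (kinds s) i false + height (kinds s) i true) * h
    rw [hY]
    have hl : (param s i).1 < 2 := (hs.iterate i).lt_two_iff.1 hic
    have h3 : mass s i ≤
        scale s i * (2 * height (kinds s) i false + height (kinds s) i true) := by
      refine mul_le_mul_of_nonneg_left ?_ (hs.scale_pos i).le
      have : (0 : ℝ) ≤ height (kinds s) i true := by positivity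
      nlinarith
    have h4 := hs.two_le_mass i
    have h5 := hs.mass_mono (show k ≤ i + 1 by omega)
    push_cast
    linarith

/-- There are levels of bounded eccentricity for which the towers are arbitrarily high compared to
the inverse of the scale. -/
theorem Good.exists_high_towers {s : Param} (hs : Good s) (C : ℝ) :
    ∃ k, 2 < (param s k).1 ∧ (param s k).1 < 3 ∧
      C ≤ scale s k * (height (kinds s) k false + height (kinds s) k true) := by
  obtain ⟨k, hk⟩ := hs.exists_lt_mass (3 * C)
  obtain ⟨i, hi, hc⟩ := hs.mixing.cut k
  have h2 : 2 < (param s i).1 := by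
    rcases (hs.iterate i).ratio_cases with ⟨-, h, -⟩ | ⟨h, -⟩ | ⟨h, -⟩
    · exact h
    all_goals exact absurd (hc.symm.trans h) (by simp)
  obtain ⟨j, hij, hj2, hj3, hj⟩ := hs.exists_end_of_run h2
  refine ⟨j, hj2, hj3, ?_⟩
  have h1 := hs.mass_mono (show k ≤ j + 1 - 1 by omega)
  have h0 := hs.scale_pos j
  have h4 : (0 : ℝ) ≤ scale s j * height (kinds s) j false := by positivity
  have h5 : (0 : ℝ) ≤ scale s j * height (kinds s) j true := by positivity
  rw [Nat.add_sub_cancel] at h1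
  have h2 := hk.trans h1
  rw [mass] at h2
  nlinarith

/-! ### The boundary is negligible -/

/-- The part in the rectangle `[0, ℓ] × [0, 1]` of the lines which bound the cells. -/
def sides (s : Param) : Set (ℝ × ℝ) :=
  domain s ∩ {z | z.1 = 0 ∨ z.1 = 1 ∨ z.1 = s.1 ∨ z.2 = 0 ∨ z.2 = 1}

open Classical in
/-- The floors of the tower above the letter `c` which meet the sides. -/
def touching (s : Param) (k : ℕ) (c : Letter) : Finset ℕ :=
  {j ∈ Finset.range (height (kinds s) k c) | ∃ y ∈ domain (param s k), floorMap s k c j y ∈ sides s}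

theorem Good.scale_le_one {s : Param} (hs : Good s) (k : ℕ) : scale s k ≤ 1 := by
  refine Finset.prod_le_one (fun i _ => (hs.iterate i).ratio_pos.le) fun i _ => ?_
  have := (hs.iterate i).one_lt
  rcases (hs.iterate i).ratio_cases with ⟨-, -, h, -⟩ | ⟨-, h', h, -⟩ | ⟨-, h', h, -⟩ <;>
    rw [h] <;> linarith

theorem Good.continuous_floorMap {s : Param} (hs : Good s) (k : ℕ) (c : Letter) (j : ℕ) :
    Continuous (floorMap s k c j) :=
  (LipschitzWith.of_dist_le_mul (K := ⟨scale s k, (hs.scale_pos k).le⟩)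
    fun z z' => (hs.dist_floorMap k c j z z').le).continuous

theorem Good.floorMap_injective {s : Param} (hs : Good s) (k : ℕ) (c : Letter) (j : ℕ) :
    Function.Injective (floorMap s k c j) := by
  intro z z' h
  have := hs.dist_floorMap k c j z z'
  rw [h, dist_self] at this
  exact dist_eq_zero.1 ((mul_eq_zero.1 this.symm).resolve_left (hs.scale_pos k).ne')

/-- A floor of a tower of level `k` is a copy of a cell scaled by `scale s k`, and the Lebesgue
measure of the plane is the Hausdorff measure of dimension two for the supremum distance. -/
theorem Good.volume_floorMap_ge {s : Param} (hs : Good s) (k : ℕ) (c : Letter) (j : ℕ)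
    (A : Set (ℝ × ℝ)) :
    ENNReal.ofReal (scale s k ^ 2) * volume A ≤ volume (floorMap s k c j '' A) := by
  have h0 := hs.scale_pos k
  have hanti : AntilipschitzWith (scale s k)⁻¹.toNNReal (floorMap s k c j) := by
    refine AntilipschitzWith.of_le_mul_dist fun z z' => ?_
    rw [hs.dist_floorMap]
    rw [Real.coe_toNNReal _ (inv_pos.2 h0).le, inv_mul_cancel_left₀ h0.ne']
  have h := hanti.le_hausdorffMeasure_image (d := 2) (by norm_num) A
  rw [hausdorffMeasure_prod_real] at h
  refine (mul_le_mul_right h _).trans (le_of_eq ?_)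
  rw [← mul_assoc]
  have : ENNReal.ofReal (scale s k ^ 2) *
      ((scale s k)⁻¹.toNNReal : ENNReal) ^ (2 : ℝ) = 1 := by
    rw [show ((scale s k)⁻¹.toNNReal : ENNReal) = ENNReal.ofReal (scale s k)⁻¹ from rfl,
      show (2 : ℝ) = ((2 : ℕ) : ℝ) by norm_num, ENNReal.rpow_natCast,
      ← ENNReal.ofReal_pow (inv_pos.2 h0).le, ← ENNReal.ofReal_mul (by positivity),
      ← mul_pow, mul_inv_cancel₀ h0.ne', one_pow, ENNReal.ofReal_one]
  rw [this, one_mul]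

/-- The generic points of a cell. -/
def genCell (s : Param) (c : Letter) : Set (ℝ × ℝ) :=
  (Ioo (bif c then 1 else 0) (bif c then s.1 else 1) \ Lat s.1) ×ˢ (Ioo 0 1 \ Lat s.1)

theorem genCell_subset {s : Param} (hs : Good s) {c : Letter} {z : ℝ × ℝ} (hz : z ∈ genCell s c) :
    z ∈ Gen s ∧ z ∈ (geo s).cell c := by
  have h1 := hs.one_lt
  obtain ⟨⟨⟨a, b⟩, hx⟩, ⟨hy0, hy1⟩, hy⟩ := hz
  cases c
  · exact ⟨⟨⟨a, lt_trans b h1⟩, ⟨hy0, hy1⟩, hx, hy⟩, ⟨a, b⟩, hy0, hy1⟩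
  · exact ⟨⟨⟨lt_trans one_pos a, b⟩, ⟨hy0, hy1⟩, hx, hy⟩, ⟨a, b⟩, hy0, hy1⟩

theorem measurableSet_genCell (s : Param) (c : Letter) : MeasurableSet (genCell s c) :=
  (measurableSet_Ioo.diff (countable_Lat _).measurableSet).prod
    (measurableSet_Ioo.diff (countable_Lat _).measurableSet)

theorem one_le_volume_genCell {s : Param} (h2 : 2 < s.1) (c : Letter) :
    1 ≤ volume (genCell s c) := by
  have h0 : volume (Lat s.1) = 0 := (countable_Lat _).measure_zero _
  rw [genCell, Measure.volume_eq_prod, Measure.prod_prod, measure_sdiff_null h0,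
    measure_sdiff_null h0, Real.volume_Ioo, Real.volume_Ioo, sub_zero, ENNReal.ofReal_one, mul_one]
  rw [← ENNReal.ofReal_one]
  refine ENNReal.ofReal_le_ofReal ?_
  cases c
  · simp
  · simp only [cond_true]; linarith

/-- A neighbourhood of the sides. -/
def strips (ℓ δ : ℝ) : Set (ℝ × ℝ) :=
  (⋃ c ∈ ({0, 1, ℓ} : Finset ℝ), Icc (c - δ) (c + δ) ×ˢ Icc (-3) 5) ∪
    ⋃ c ∈ ({0, 1} : Finset ℝ), Icc (-3) 5 ×ˢ Icc (c - δ) (c + δ)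

theorem volume_strips_le {ℓ δ : ℝ} (hδ : 0 ≤ δ) :
    volume (strips ℓ δ) ≤ ENNReal.ofReal (80 * δ) := by
  have h1 : ∀ c : ℝ, volume (Icc (c - δ) (c + δ) ×ˢ Icc (-3 : ℝ) 5) = ENNReal.ofReal (16 * δ) := by
    intro c
    rw [Measure.volume_eq_prod, Measure.prod_prod, Real.volume_Icc, Real.volume_Icc,
      ← ENNReal.ofReal_mul (by linarith)]
    congr 1; ring
  have h2 : ∀ c : ℝ, volume (Icc (-3 : ℝ) 5 ×ˢ Icc (c - δ) (c + δ)) = ENNReal.ofReal (16 * δ) := by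
    intro c
    rw [Measure.volume_eq_prod, Measure.prod_prod, Real.volume_Icc, Real.volume_Icc,
      ← ENNReal.ofReal_mul (by norm_num)]
    congr 1; ring
  have h3 : ∀ (t : Finset ℝ) (n : ℕ), t.card ≤ n →
      ∑ c ∈ t, ENNReal.ofReal (16 * δ) ≤ n * ENNReal.ofReal (16 * δ) := by
    intro t n h
    rw [Finset.sum_const, nsmul_eq_mul]
    gcongr
  calc volume (strips ℓ δ) ≤ _ := measure_union_le _ _
    _ ≤ (3 : ℕ) * ENNReal.ofReal (16 * δ) + (2 : ℕ) * ENNReal.ofReal (16 * δ) := by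
      refine add_le_add ((measure_biUnion_finset_le _ _).trans ?_)
        ((measure_biUnion_finset_le _ _).trans ?_)
      · simp only [h1]
        exact h3 _ _ Finset.card_le_three
      · simp only [h2]
        exact h3 _ _ Finset.card_le_two
    _ = ENNReal.ofReal (80 * δ) := by
      rw [← add_mul, ← Nat.cast_add, ← ENNReal.ofReal_natCast, ← ENNReal.ofReal_mul (by norm_num)]
      congr 1; push_cast; ring

theorem mem_strips {s : Param} (h2 : s.1 ≤ 2) {δ : ℝ} (hδ : δ ≤ 3) {z z' : ℝ × ℝ}
    (hz : z ∈ sides s) (h : dist z' z ≤ δ) : z' ∈ strips s.1 δ := by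
  obtain ⟨⟨⟨hx0, hx1⟩, hy0, hy1⟩, hc⟩ := hz
  rw [Prod.dist_eq, max_le_iff, Real.dist_eq, Real.dist_eq, abs_le, abs_le] at h
  obtain ⟨⟨a, b⟩, c, d⟩ := h
  have hX : z'.1 ∈ Icc (-3 : ℝ) 5 := ⟨by linarith, by linarith⟩
  have hY : z'.2 ∈ Icc (-3 : ℝ) 5 := ⟨by linarith, by linarith⟩
  have e : ∀ c : ℝ, z.1 = c → z'.1 ∈ Icc (c - δ) (c + δ) := by
    rintro c rfl; exact ⟨by linarith, by linarith⟩
  have e' : ∀ c : ℝ, z.2 = c → z'.2 ∈ Icc (c - δ) (c + δ) := by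
    rintro c rfl; exact ⟨by linarith, by linarith⟩
  rcases hc with h | h | h | h | h
  · exact Or.inl (mem_biUnion (x := 0) (by simp) ⟨e _ h, hY⟩)
  · exact Or.inl (mem_biUnion (x := 1) (by simp) ⟨e _ h, hY⟩)
  · exact Or.inl (mem_biUnion (x := s.1) (by simp) ⟨e _ h, hY⟩)
  · exact Or.inr (mem_biUnion (x := 0) (by simp) ⟨hX, e' _ h⟩)
  · exact Or.inr (mem_biUnion (x := 1) (by simp) ⟨hX, e' _ h⟩)

/-- The floors which meet the sides are disjoint and contained in a small neighbourhood of the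
sides; comparing areas bounds their number. -/
theorem Good.card_touching_le {s : Param} (hs : Good s) (h2 : s.1 ≤ 2) {k : ℕ}
    (hk2 : 2 < (param s k).1) (hk3 : (param s k).1 < 3) (c : Letter) :
    (touching s k c).card * scale s k ≤ 240 := by
  classical
  have h0 := hs.scale_pos k
  have hg := hs.iterate k
  set A := genCell (param s k) c with hA
  have hdisj : ∀ i ∈ touching s k c, ∀ j ∈ touching s k c, i < j →
      Disjoint (floorMap s k c i '' A) (floorMap s k c j '' A) := by
    intro i hi j hj hij
    rw [Set.disjoint_left]
    rintro _ ⟨y, hy, rfl⟩ ⟨y', hy', h⟩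
    have hjlt := Finset.mem_range.1 (Finset.mem_filter.1 hj).1
    exact floorMap_disjoint hs hjlt hij (genCell_subset hg hy).1 (genCell_subset hg hy').1
      (genCell_subset hg hy).2 (genCell_subset hg hy').2 h.symm
  have hsub : (⋃ j ∈ touching s k c, floorMap s k c j '' A) ⊆ strips s.1 (3 * scale s k) := by
    refine iUnion₂_subset fun j hj => ?_
    rintro _ ⟨y', hy', rfl⟩
    obtain ⟨-, y, hy, hyb⟩ := Finset.mem_filter.1 hj
    refine mem_strips h2 (by linarith [hs.scale_le_one k]) hyb ?_
    rw [hs.dist_floorMap, mul_comm]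
    have hd : y' ∈ domain (param s k) := by
      obtain ⟨⟨a, b⟩, ⟨c, d⟩, -⟩ := (genCell_subset hg hy').1
      exact ⟨⟨a.le, b.le⟩, c.le, d.le⟩
    exact mul_le_mul_of_nonneg_right ((dist_le_of_mem_domain hg hd hy).trans hk3.le) h0.le
  have hmeas : ∀ j, MeasurableSet (floorMap s k c j '' A) := fun j =>
    ((hs.continuous_floorMap k c j).measurableEmbedding
      (hs.floorMap_injective k c j)).measurableSet_image.2 (measurableSet_genCell _ _)
  have key : (touching s k c).card * ENNReal.ofReal (scale s k ^ 2) ≤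
      ENNReal.ofReal (80 * (3 * scale s k)) := by
    calc (touching s k c).card * ENNReal.ofReal (scale s k ^ 2)
        = ∑ j ∈ touching s k c, ENNReal.ofReal (scale s k ^ 2) := by
          rw [Finset.sum_const, nsmul_eq_mul]
      _ ≤ ∑ j ∈ touching s k c, volume (floorMap s k c j '' A) := by
          refine Finset.sum_le_sum fun j _ => le_trans ?_ (hs.volume_floorMap_ge k c j A)
          exact le_mul_of_one_le_right' (one_le_volume_genCell hk2 c)
      _ = volume (⋃ j ∈ touching s k c, floorMap s k c j '' A) := by
          refine (measure_biUnion_finset ?_ fun j _ => hmeas j).symm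
          intro i hi j hj hij
          rcases lt_or_gt_of_ne hij with h | h
          · exact hdisj i hi j hj h
          · exact (hdisj j hj i hi h).symm
      _ ≤ _ := (measure_mono hsub).trans (volume_strips_le (by positivity))
  rw [← ENNReal.ofReal_natCast, ← ENNReal.ofReal_mul (by positivity),
    ENNReal.ofReal_le_ofReal_iff (by positivity)] at key
  have : (touching s k c).card * scale s k * scale s k ≤ 240 * scale s k := by nlinarith
  exact le_of_mul_le_mul_right this h0

/-- A point of the limit set can fail to be in the cell of its letter on the sides only. -/
theorem mem_sides_of_mem_limitSet {s : Param} {p : (ℕ → Letter) × (ℝ × ℝ)}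
    (hp : p ∈ limitSet s) (h : p.2 ∉ (geo s).cell (p.1 0)) : p.2 ∈ sides s := by
  have hd := (limitSet_subset s hp).2
  refine ⟨hd, ?_⟩
  by_contra hc
  simp only [mem_ofPred_eq, not_or] at hc
  obtain ⟨a, b, c, d, e⟩ := hc
  obtain ⟨⟨hx0, hx1⟩, hy0, hy1⟩ := hd
  have hy : 0 < p.2.2 ∧ p.2.2 < 1 := ⟨lt_of_le_of_ne hy0 (Ne.symm d), lt_of_le_of_ne hy1 e⟩
  have hcell : ∃ c, p.2 ∈ (geo s).cell c := by
    rcases lt_or_gt_of_ne b with h | h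
    · exact ⟨false, ⟨lt_of_le_of_ne hx0 (Ne.symm a), h⟩, hy⟩
    · exact ⟨true, ⟨h, lt_of_le_of_ne hx1 c⟩, hy⟩
  obtain ⟨c, hc⟩ := hcell
  rw [limitSet_letter hp hc] at h
  exact h hc

/-- When `2 < ℓ < 3`, both letters occur among three consecutive letters of the codings. -/
theorem exists_letter {s : Param} (h2 : 2 < s.1) (h3 : s.1 < 3)
    {p : (ℕ → Letter) × (ℝ × ℝ)} (hp : p ∈ limitSet s) (c : Letter) :
    ∃ i < 3, p.1 i = c := by
  obtain ⟨q, hq, hqp⟩ := exists_agree_of_mem_closure (mem_iInter.1 hp 0) 3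
  suffices ∃ i < 3, q.1 i = c by
    obtain ⟨i, hi, h⟩ := this
    exact ⟨i, hi, by rw [← hqp i hi, h]⟩
  obtain ⟨v, z⟩ := q
  have m0 := hq.2.1 0
  have m1 := hq.2.1 1
  have m2 := hq.2.1 2
  simp only [Function.iterate_succ, Function.iterate_zero, Function.comp_apply, id,
    CodedSystem.next, shift] at m0 m1 m2
  by_contra! hne
  have e0 := hne 0 (by norm_num)
  have e1 := hne 1 (by norm_num)
  have e2 := hne 2 (by norm_num)
  simp only at e0 e1 e2
  cases c
  · replace e0 := Bool.eq_true_of_not_eq_false e0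
    replace e1 := Bool.eq_true_of_not_eq_false e1
    replace e2 := Bool.eq_true_of_not_eq_false e2
    simp only [zero_add, e0, e1, e2, mem_geo_cell_true, geo_map_true] at m0 m1 m2
    linarith [m0.1.2, m2.1.1]
  · replace e0 := Bool.eq_false_of_not_eq_true e0
    replace e1 := Bool.eq_false_of_not_eq_true e1
    replace e2 := Bool.eq_false_of_not_eq_true e2
    simp only [zero_add, e0, e1, e2, mem_geo_cell_false, geo_map_false] at m0 m1 m2
    linarith [m0.2.2, m1.1.2]

theorem add_le_wsum {s : Param} (h2 : 2 < s.1) (h3 : s.1 < 3)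
    {p : (ℕ → Letter) × (ℝ × ℝ)} (hp : p ∈ limitSet s) (w : Letter → ℕ) :
    w false + w true ≤ wsum w p.1 3 := by
  obtain ⟨i, hi, hi'⟩ := exists_letter h2 h3 hp false
  obtain ⟨j, hj, hj'⟩ := exists_letter h2 h3 hp true
  have hij : i ≠ j := by rintro rfl; rw [hi'] at hj'; cases hj'
  have : ∑ r ∈ ({i, j} : Finset ℕ), w (p.1 r) ≤ wsum w p.1 3 := by
    refine Finset.sum_le_sum_of_subset fun r hr => ?_
    rw [Finset.mem_insert, Finset.mem_singleton] at hr
    rw [Finset.mem_range]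
    omega
  rwa [Finset.sum_pair hij, hi', hj'] at this

open Classical in
/-- An orbit segment of length `|a|_k + |b|_k` runs along at most four towers of level `k`. -/
theorem Good.card_visits_le {s : Param} (hs : Good s) {k : ℕ} (h2 : 2 < (param s k).1)
    (h3 : (param s k).1 < 3) {p : (ℕ → Letter) × (ℝ × ℝ)} (hp : p ∈ limitSet s) :
    ({i ∈ Finset.range (height (kinds s) k false + height (kinds s) k true) |
      ((geo s).next^[i] p).2 ∉ (geo s).cell (p.1 i)} : Finset ℕ).card ≤
      4 * max (touching s k false).card (touching s k true).card := by
  obtain ⟨u, hu⟩ := hs.mixing.exists_isLimit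
  obtain ⟨u', hu'⟩ := (hs.mixing.tail k).exists_isLimit
  have hv := mem_subshift_of_mem_limitSet hs hu hp
  rw [hu.eq_iterSubst hs.mixing hu'] at hv
  obtain ⟨v', hv', j, hj, hvj⟩ := exists_iterSubst_of_mem_subshift hv
  have hg := hs.iterate k
  obtain ⟨z', hz'⟩ := exists_mem_limitSet hg (by rw [kinds_param]; exact hu') hv'
  have hpj : p = (geo s).next^[j] (iterLift s k (v', z')) := by
    have h1 := iterate_next_mem_limitSet hs (iterLift_mem_limitSet hs hz') j
    have h4 : ((geo s).next^[j] (iterLift s k (v', z'))).1 = p.1 := by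
      rw [next_iterate_fst, hvj]; rfl
    refine Prod.ext h4.symm (eq_of_mem_limitSet hs (v := p.1) hp ?_)
    rw [← h4]; exact h1
  set w := height (kinds s) k
  have hw : ∀ c, 0 < w c := height_pos (kinds s) k
  have hL : j + (w false + w true) ≤ wsum w v' 4 := by
    have h5 := add_le_wsum h2 h3 (next_mem_limitSet hg hz') w
    rw [wsum_succ' w v' 3]
    have h6 : wsum w ((geo (param s k)).next (v', z')).1 3 = wsum w (shift v') 3 := rfl
    omega
  have hinj : ({i ∈ Finset.range (w false + w true) |
      ((geo s).next^[i] p).2 ∉ (geo s).cell (p.1 i)} : Finset ℕ).card ≤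
      ((Finset.range 4).sigma fun m => touching s k (v' m)).card := by
    refine Finset.card_le_card_of_surjOn (fun q => wsum w v' q.1 + q.2 - j) ?_
    intro i hi
    obtain ⟨hi, hbad⟩ := Finset.mem_filter.1 (Finset.mem_coe.1 hi)
    rw [Finset.mem_range] at hi
    obtain ⟨m, r, hmr, hr⟩ := exists_wsum_add_lt hw v' (i + j)
    have hm : m < 4 := by
      by_contra! hm
      have := wsum_mono w v' hm
      omega
    refine ⟨⟨m, r⟩, ?_, by simp only; omega⟩
    rw [Finset.mem_coe, Finset.mem_sigma]
    refine ⟨Finset.mem_range.2 hm, Finset.mem_filter.2 ⟨Finset.mem_range.2 hr, ?_⟩⟩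
    have hy := iterate_next_mem_limitSet hg hz' m
    have hfst : ((geo (param s k)).next^[m] (v', z')).1 0 = v' m := by
      rw [next_iterate_fst, iterate_shift_apply, zero_add]
    refine ⟨_, (limitSet_subset _ hy).2, ?_⟩
    have e : (geo s).next^[i] p = (geo s).next^[r] (iterLift s k
        ((geo (param s k)).next^[m] (v', z'))) := by
      rw [hpj, ← Function.iterate_add_apply, hmr, add_comm, Function.iterate_add_apply]
      congr 1
      exact iterate_next_iterLift hs k (v', z') m
    have e2 := iterate_next_iterLift_snd (s := s) (k := k) (j := r)
      (p := (geo (param s k)).next^[m] (v', z')) (by rw [hfst]; exact hr)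
    rw [hfst] at e2
    rw [← e2, ← e]
    refine mem_sides_of_mem_limitSet (iterate_next_mem_limitSet hs hp i) ?_
    rwa [next_iterate_fst, iterate_shift_apply, zero_add]
  refine hinj.trans ?_
  rw [Finset.card_sigma]
  refine (Finset.sum_le_card_nsmul _ _ (max (touching s k false).card (touching s k true).card)
    fun m _ => ?_).trans (by simp)
  cases v' m
  · exact le_max_left _ _
  · exact le_max_right _ _

open Classical in
/-- A set which is visited at most `C` times by every orbit segment of length `L` has measure at
most `C / L`. -/
theorem mul_measure_le_of_visits {X : Type*} [MeasurableSpace X] {μ : Measure X}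
    [IsProbabilityMeasure μ] {f : X → X} (hf : MeasurePreserving f μ μ) {E : Set X}
    (hE : MeasurableSet E) {L C : ℕ}
    (h : ∀ x, ({i ∈ Finset.range L | f^[i] x ∈ E} : Finset ℕ).card ≤ C) : L * μ E ≤ C := by
  calc L * μ E = ∑ i ∈ Finset.range L, μ (f^[i] ⁻¹' E) := by
        rw [Finset.sum_congr rfl fun i _ => (hf.iterate i).measure_preimage hE.nullMeasurableSet]
        simp
    _ = ∑ i ∈ Finset.range L, ∫⁻ x, (f^[i] ⁻¹' E).indicator 1 x ∂μ := by
        refine Finset.sum_congr rfl fun i _ => (lintegral_indicator_one ?_).symm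
        exact (hf.iterate i).measurable hE
    _ = ∫⁻ x, ∑ i ∈ Finset.range L, (f^[i] ⁻¹' E).indicator 1 x ∂μ := by
        refine (lintegral_finsetSum _ fun i _ => ?_).symm
        exact measurable_one.indicator ((hf.iterate i).measurable hE)
    _ ≤ ∫⁻ _, C ∂μ := by
        refine lintegral_mono fun x => ?_
        simp only [indicator, mem_preimage, Pi.one_apply]
        rw [Finset.sum_boole]
        exact_mod_cast h x
    _ = C := by simp

/-- For every invariant probability measure on the subshift, almost every point is the coding of its
image. -/
theorem ae_codes {s : Param} (hs : Good s) (h2 : s.1 ≤ 2) {u : ℕ → Letter}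
    {h : subshift u → ℝ × ℝ} (hc : Continuous h)
    (hh : ∀ (v : subshift u) z, ((v : ℕ → Letter), z) ∈ limitSet s ↔ z = h v)
    {m : Measure (subshift u)} [IsProbabilityMeasure m]
    (hm : MeasurePreserving (subshiftMap u) m m) :
    ∀ᵐ v : subshift u ∂m, (geo s).Codes ((v : ℕ → Letter), h v) := by
  classical
  have hmem : ∀ v : subshift u, ((v : ℕ → Letter), h v) ∈ limitSet s := fun v => (hh v _).2 rfl
  have hiter : ∀ (v : subshift u) n, (((subshiftMap u)^[n] v : subshift u) : ℕ → Letter) =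
      shift^[n] v := by
    intro v n
    induction n generalizing v with
    | zero => rfl
    | succ n ih => rw [Function.iterate_succ_apply, ih]; rfl
  have hnext : ∀ (v : subshift u) n, ((geo s).next^[n] ((v : ℕ → Letter), h v)).2 =
      h ((subshiftMap u)^[n] v) := by
    intro v n
    refine (hh _ _).1 ?_
    have := iterate_next_mem_limitSet hs (hmem v) n
    rw [hiter, ← next_iterate_fst (A := geo s) ((v : ℕ → Letter), h v) n]
    exact this
  obtain ⟨E, hE⟩ : ∃ E : Set (subshift u), ∀ v, v ∈ E ↔ h v ∉ (geo s).cell ((v : ℕ → Letter) 0) :=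
    ⟨{v | h v ∉ (geo s).cell ((v : ℕ → Letter) 0)}, fun _ => Iff.rfl⟩
  have hEm : MeasurableSet E := by
    have : E = ⋃ c, {v : subshift u | (v : ℕ → Letter) 0 = c} ∩ (h ⁻¹' (geo s).cell c)ᶜ := by
      ext v
      simp [hE]
    rw [this]
    refine MeasurableSet.iUnion fun c => MeasurableSet.inter ?_ ?_
    · exact measurableSet_eq_fun ((measurable_pi_apply 0).comp measurable_subtype_coe)
        measurable_const
    · exact ((isOpen_geo_cell s c).preimage hc).measurableSet.compl
  have hzero : m E = 0 := by
    have key : ∀ C : ℕ, 0 < C → m E ≤ (C : ENNReal)⁻¹ := by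
      intro C hC
      obtain ⟨k, hk2, hk3, hk⟩ := hs.exists_high_towers (C * 960)
      have h0 := hs.scale_pos k
      have hv := mul_measure_le_of_visits hm hEm (fun v => by
        have := hs.card_visits_le hk2 hk3 (hmem v)
        simp only [hnext] at this
        refine le_trans (Finset.card_le_card fun i hi => ?_) this
        rw [Finset.mem_filter] at hi
        obtain ⟨hi, hiE⟩ := hi
        rw [hE, hiter, iterate_shift_apply, zero_add] at hiE
        exact Finset.mem_filter.2 ⟨hi, hiE⟩)
      set L := height (kinds s) k false + height (kinds s) k true
      have hmax : (4 * max (touching s k false).card (touching s k true).card : ℕ) * C ≤ L := by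
        have a1 := hs.card_touching_le h2 hk2 hk3 false
        have a2 := hs.card_touching_le h2 hk2 hk3 true
        have a3 : ((max (touching s k false).card (touching s k true).card : ℕ) : ℝ) * scale s k ≤
            240 := by
          rcases max_choice (touching s k false).card (touching s k true).card with e | e <;> rw [e]
          · exact a1
          · exact a2
        have a4 : (C : ℝ) * 960 ≤ scale s k * L := by
          refine hk.trans (le_of_eq ?_); rw [← Nat.cast_add]
        have a5 : ((4 * max (touching s k false).card (touching s k true).card : ℕ) * C : ℝ) *
            scale s k ≤ L * scale s k := by
          push_cast at a3 ⊢
          have : (0 : ℝ) ≤ C := by positivity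
          nlinarith
        have := le_of_mul_le_mul_right a5 h0
        exact_mod_cast this
      have hLpos : 0 < L := by have := height_pos (kinds s) k false; omega
      rw [ENNReal.le_inv_iff_mul_le]
      have hL0 : (L : ENNReal) ≠ 0 := by exact_mod_cast hLpos.ne'
      have hLt : (L : ENNReal) ≠ ⊤ := ENNReal.natCast_ne_top L
      rw [← ENNReal.mul_le_mul_iff_right hL0 hLt, mul_one, ← mul_assoc]
      exact (mul_le_mul_left hv _).trans (by exact_mod_cast hmax)
    by_contra hne
    obtain ⟨C, hC⟩ := ENNReal.exists_inv_nat_lt hne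
    rcases Nat.eq_zero_or_pos C with rfl | hC0
    · simp at hC
    · exact absurd (key C hC0) (not_le.2 hC)
  have hall : ∀ n, ∀ᵐ v ∂m, (subshiftMap u)^[n] v ∉ E := fun n =>
    measure_mono_null (by intro v hv; simpa using hv)
      (((hm.iterate n).measure_preimage hEm.nullMeasurableSet).trans hzero)
  filter_upwards [ae_all_iff.2 hall] with v hv n
  have h1 := hv n
  rw [hE, not_not, hiter, iterate_shift_apply, zero_add] at h1
  rwa [hnext]

/-! ### Exchanges of two intervals -/

/-- The exchange of the intervals `(0, A)` and `(A, A + B)`, which is the rotation by `B` on a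
circle of length `A + B`. -/
def iet (A B : ℝ) : CodedSystem ℝ where
  map c x := bif c then x - A else x + B
  cell c := bif c then Ioo A (A + B) else Ioo 0 A

/-- The lengths of the intervals before a renormalization step, in terms of the lengths after this
step. -/
def lengths (κ : Kind) (p : ℝ × ℝ) : ℝ × ℝ :=
  match κ with
  | .cut => (p.1, p.1 + p.2)
  | .rot => (p.1 + 2 * p.2, p.1 + p.2)
  | .refl => (p.1 + 2 * p.2, p.2)

/-- The embedding of the domain of the renormalized interval exchange. -/
def ietEmbed (κ : Kind) (p : ℝ × ℝ) (x : ℝ) : ℝ :=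
  match κ with
  | .rot => p.1 + p.2 - x
  | _ => x

/-- The interval exchanges are renormalized to each other by the same substitutions as the piecewise
isometries. -/
theorem iet_renorm (κ : Kind) {p : ℝ × ℝ} (h1 : 0 < p.1) (h2 : 0 < p.2) :
    Renorm (iet (lengths κ p).1 (lengths κ p).2) (iet p.1 p.2) κ (ietEmbed κ p) := by
  constructor
  · rintro c x
    cases κ <;> cases c <;> simp [block, act, iet, lengths, ietEmbed] <;> ring
  · rintro c x hx
    cases κ <;> cases c <;> simp [iet] at hx <;> obtain ⟨hx1, hx2⟩ := hx <;>
      simp only [block, Follows, iet, lengths, ietEmbed, cond_true, cond_false, mem_Ioo, and_true] <;>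
      constructorm* _ ∧ _ <;> linarith

/-- A point outside a countable set has an orbit which avoids the end points of the intervals. -/
theorem exists_iet_codes {A B : ℝ} (hA : 0 < A) (hB : 0 < B) :
    ∃ v x, (iet A B).Codes (v, x) ∧ v 0 = false := by
  set L : Set ℝ := range fun q : ℤ × ℤ => q.1 * A + q.2 * B with hL
  have hLc : L.Countable := countable_range _
  obtain ⟨x, hx, hxL⟩ : ∃ x ∈ Ioo 0 A, x ∈ Lᶜ :=
    (hLc.dense_compl ℝ).exists_mem_open isOpen_Ioo ⟨A / 2, by linarith, by linarith⟩ |>.imp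
      fun x h => ⟨h.2, h.1⟩
  have hLadd : ∀ (m n : ℤ) {y : ℝ}, y ∉ L → y + (m * A + n * B) ∉ L := by
    rintro m n y hy ⟨⟨m', n'⟩, h⟩
    refine hy ⟨⟨m' - m, n' - n⟩, ?_⟩
    simp only at h ⊢
    push_cast
    linarith
  let code : ℝ → ℕ → Letter := fun x n =>
    decide (A ≤ (fun x => (iet A B).map (decide (A ≤ x)) x)^[n] x)
  have hcode : ∀ p ∈ {p : (ℕ → Letter) × ℝ | p.2 ∈ Ioo 0 (A + B) ∧ p.2 ∉ L ∧ p.1 = code p.2},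
      (iet A B).Codes p := by
    intro p hp
    refine codes_of_invariant _ ?_ hp
    rintro ⟨v, y⟩ ⟨⟨hy0, hy1⟩, hyL, hv⟩
    obtain rfl : v = code y := hv
    simp only at hy0 hy1 hyL
    have hyA : y ≠ A := fun h => hyL ⟨⟨1, 0⟩, by simp [h]⟩
    have hn : (iet A B).next (code y, y) =
        (code ((iet A B).map (code y 0) y), (iet A B).map (code y 0) y) := rfl
    rw [hn]
    rcases lt_or_gt_of_ne hyA with h | h
    · have h0 : code y 0 = false := decide_eq_false (not_le.2 h)
      simp only [h0]
      refine ⟨⟨hy0, h⟩, ⟨?_, ?_⟩, ?_, rfl⟩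
      · simp only [iet, cond_false]; linarith
      · simp only [iet, cond_false]; linarith
      · simpa [iet] using hLadd 0 1 hyL
    · have h0 : code y 0 = true := decide_eq_true h.le
      simp only [h0]
      refine ⟨⟨h, hy1⟩, ⟨?_, ?_⟩, ?_, rfl⟩
      · simp only [iet, cond_true]; linarith
      · simp only [iet, cond_true]; linarith
      · simpa [iet, ← sub_eq_add_neg] using hLadd (-1) 0 hyL
  exact ⟨code x, x, hcode _ ⟨⟨hx.1, hx.2.trans (by linarith)⟩, hxL, rfl⟩,
    decide_eq_false (not_le.2 hx.2)⟩

theorem exists_iet_codes_iterSubst {κ : ℕ → Kind} {p : ℕ → ℝ × ℝ}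
    (hpos : ∀ k, 0 < (p k).1 ∧ 0 < (p k).2) (hp : ∀ k, p k = lengths (κ k) (p (k + 1))) {k : ℕ}
    {v : ℕ → Letter} {x : ℝ} (h : (iet (p k).1 (p k).2).Codes (v, x)) :
    ∃ y, (iet (p 0).1 (p 0).2).Codes (iterSubst κ k v, y) := by
  induction k generalizing v x with
  | zero => exact ⟨x, h⟩
  | succ k ih =>
    have := (iet_renorm (κ k) (hpos (k + 1)).1 (hpos (k + 1)).2).codes h
    rw [← hp k] at this
    exact ih this

theorem lengths_smul (κ : Kind) (c : ℝ) (p : ℝ × ℝ) : lengths κ (c • p) = c • lengths κ p := by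
  cases κ <;> simp [lengths, mul_add, mul_left_comm]

theorem continuous_lengths (κ : Kind) : Continuous (lengths κ) := by
  cases κ <;> unfold lengths <;> fun_prop

/-- There is a consistent choice of positive lengths at all levels, by compactness. -/
theorem Mixing.exists_lengths {κ : ℕ → Kind} (h : Mixing κ) :
    ∃ p : ℕ → ℝ × ℝ, (∀ k, 0 < (p k).1 ∧ 0 < (p k).2) ∧ (∀ k, p k = lengths (κ k) (p (k + 1))) ∧
      (p 0).1 + (p 0).2 = 1 := by
  set K : Set (ℕ → ℝ × ℝ) := univ.pi fun _ => Icc 0 1 ×ˢ Icc 0 1 with hK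
  have hKc : IsCompact K := isCompact_univ_pi fun _ => isCompact_Icc.prod isCompact_Icc
  set C : ℕ → Set (ℕ → ℝ × ℝ) := fun N => (K ∩ {p | (p 0).1 + (p 0).2 = 1}) ∩
    ⋂ k, ⋂ (_ : k < N), {p | p k = lengths (κ k) (p (k + 1))} with hC
  have hne : ∀ N, ∀ κ : ℕ → Kind, ∃ p : ℕ → ℝ × ℝ,
      (∀ k, (0 ≤ (p k).1 ∧ (p k).1 ≤ 1) ∧ 0 ≤ (p k).2 ∧ (p k).2 ≤ 1) ∧
      (p 0).1 + (p 0).2 = 1 ∧ ∀ k < N, p k = lengths (κ k) (p (k + 1)) := by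
    intro N
    induction N with
    | zero =>
      intro κ
      exact ⟨fun _ => (1 / 2, 1 / 2), fun k => by norm_num, by norm_num,
        fun k hk => absurd hk (Nat.not_lt_zero k)⟩
    | succ N ih =>
      intro κ
      obtain ⟨p, hp, hsum, hrec⟩ := ih fun k => κ (k + 1)
      obtain ⟨⟨a0, -⟩, b0, -⟩ := hp 0
      set q := lengths (κ 0) (p 0) with hq
      set c := q.1 + q.2 with hc
      have hq' : 0 ≤ q.1 ∧ 0 ≤ q.2 ∧ 1 ≤ c := by
        rw [hc, hq]
        cases κ 0 <;> simp only [lengths] <;> refine ⟨?_, ?_, ?_⟩ <;> linarith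
      have hc0 : 0 < c := by linarith
      have hci : 0 ≤ c⁻¹ := (inv_pos.2 hc0).le
      have hci1 : c⁻¹ ≤ 1 := inv_le_one_of_one_le₀ hq'.2.2
      have hcc : c⁻¹ * q.1 + c⁻¹ * q.2 = 1 := by
        rw [← mul_add]; exact inv_mul_cancel₀ hc0.ne'
      have h1 := mul_nonneg hci hq'.1
      have h2 := mul_nonneg hci hq'.2.1
      refine ⟨fun k => c⁻¹ • Nat.casesOn k q fun k => p k, ?_, hcc, ?_⟩
      · rintro (_ | k)
        · exact ⟨⟨h1, show c⁻¹ * q.1 ≤ 1 by linarith⟩, h2, show c⁻¹ * q.2 ≤ 1 by linarith⟩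
        · obtain ⟨⟨a, b⟩, a', b'⟩ := hp k
          exact ⟨⟨mul_nonneg hci a, mul_le_one₀ hci1 a b⟩, mul_nonneg hci a',
            mul_le_one₀ hci1 a' b'⟩
      · rintro (_ | k) hk
        · exact (lengths_smul _ _ _).symm
        · rw [lengths_smul]
          exact congrArg _ (hrec k (by omega))
  have hclosed : ∀ N, IsClosed (C N) := by
    intro N
    refine (hKc.isClosed.inter (isClosed_eq ?_ continuous_const)).inter
      (isClosed_iInter fun k => isClosed_iInter fun _ => isClosed_eq (continuous_apply k) ?_)
    · fun_prop
    · exact (continuous_lengths _).comp (continuous_apply (k + 1))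
  obtain ⟨p, hp⟩ := IsCompact.nonempty_iInter_of_sequence_nonempty_isCompact_isClosed C
    (fun N p hp => ⟨hp.1, mem_iInter₂.2 fun k hk => mem_iInter₂.1 hp.2 k (by omega)⟩)
    (fun N => by
      obtain ⟨p, h1, h2, h3⟩ := hne N κ
      exact ⟨p, ⟨fun k _ => ⟨(h1 k).1, (h1 k).2⟩, h2⟩, mem_iInter₂.2 h3⟩)
    (hKc.of_isClosed_subset (hclosed 0) fun p hp => hp.1.1) hclosed
  have hp' := fun N => mem_iInter.1 hp N
  have hsum : (p 0).1 + (p 0).2 = 1 := (hp' 0).1.2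
  have hrec : ∀ k, p k = lengths (κ k) (p (k + 1)) := fun k =>
    mem_iInter₂.1 (hp' (k + 1)).2 k (by omega)
  have hnn : ∀ k, 0 ≤ (p k).1 ∧ 0 ≤ (p k).2 := fun k =>
    ⟨((hp' 0).1.1 k trivial).1.1, ((hp' 0).1.1 k trivial).2.1⟩
  have hnz : ∀ k, 0 < (p k).1 + (p k).2 := by
    intro k
    induction k with
    | zero => rw [hsum]; exact one_pos
    | succ k ih =>
      obtain ⟨a, b⟩ := hnn (k + 1)
      rw [hrec k] at ih
      cases hk : κ k <;> simp only [hk, lengths] at ih <;> linarith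
  refine ⟨p, fun k => ⟨?_, ?_⟩, hrec, hsum⟩
  · obtain ⟨j, hj, hjc⟩ := h.not_cut k
    refine lt_of_le_of_ne (hnn k).1 fun h0 => ?_
    have hz : ∀ i ≥ k, i ≤ j → (p i).1 = 0 := by
      intro i hi
      induction i, hi using Nat.le_induction with
      | base => exact fun _ => h0.symm
      | succ i hi ih =>
        intro hij
        obtain ⟨a, b⟩ := hnn (i + 1)
        have h1 := ih (by omega)
        rw [hrec i] at h1
        cases hk : κ i <;> simp only [hk, lengths] at h1 <;> linarith
    have h1 := hz j hj le_rfl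
    have h2 := hnz (j + 1)
    obtain ⟨a, b⟩ := hnn (j + 1)
    rw [hrec j] at h1
    cases hk : κ j
    · exact hjc hk
    all_goals simp only [hk, lengths] at h1; linarith
  · obtain ⟨j, hj, hjc⟩ := h.cut k
    refine lt_of_le_of_ne (hnn k).2 fun h0 => ?_
    have hz : ∀ i ≥ k, i ≤ j → (p i).2 = 0 := by
      intro i hi
      induction i, hi using Nat.le_induction with
      | base => exact fun _ => h0.symm
      | succ i hi ih =>
        intro hij
        obtain ⟨a, b⟩ := hnn (i + 1)
        have h1 := ih (by omega)
        rw [hrec i] at h1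
        cases hk : κ i <;> simp only [hk, lengths] at h1 <;> linarith
    have h1 := hz j hj le_rfl
    have h2 := hnz (j + 1)
    obtain ⟨a, b⟩ := hnn (j + 1)
    rw [hrec j] at h1
    simp only [hjc, lengths] at h1
    linarith

/-! ### Codings of rotations -/

/-- The coding of the orbit of `x` under the rotation by `α`: the letter is `b` when the orbit
passes over an integer. -/
def rotCode (α x : ℝ) (n : ℕ) : Letter := decide (⌊x + (n + 1) * α⌋ ≠ ⌊x + n * α⌋)

theorem rotCode_add_int (α x : ℝ) (m : ℤ) : rotCode α (x + m) = rotCode α x := by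
  funext n
  rw [rotCode, rotCode, add_right_comm, add_right_comm x (m : ℝ), Int.floor_add_intCast,
    Int.floor_add_intCast]
  simp

theorem iterate_shift_rotCode (α x : ℝ) (n : ℕ) :
    shift^[n] (rotCode α x) = rotCode α (x + n * α) := by
  funext i
  rw [iterate_shift_apply, rotCode, rotCode]
  rw [show x + n * α + (i + 1) * α = x + (((i + n : ℕ) : ℝ) + 1) * α by push_cast; ring,
    show x + n * α + i * α = x + ((i + n : ℕ) : ℝ) * α by push_cast; ring]

/-- The exchange of intervals of lengths `1 - α` and `α` is the rotation by `α` of `ℝ / ℤ`. -/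
theorem eq_rotCode_of_iet_codes {α : ℝ} (hα : 0 < α) {v : ℕ → Letter} {x : ℝ}
    (h : (iet (1 - α) α).Codes (v, x)) : v = rotCode α x := by
  have key : ∀ c : Letter, ∀ x ∈ (iet (1 - α) α).cell c, rotCode α x 0 = c ∧
      rotCode α ((iet (1 - α) α).map c x) = shift (rotCode α x) := by
    intro c x hx
    have hs : shift (rotCode α x) = rotCode α (x + α) := by
      simpa using iterate_shift_rotCode α x 1
    cases c
    · obtain ⟨h0, h1⟩ : 0 < x ∧ x < 1 - α := hx
      refine ⟨decide_eq_false ?_, hs.symm⟩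
      have e1 : ⌊x⌋ = 0 := Int.floor_eq_zero_iff.2 ⟨h0.le, by linarith⟩
      have e2 : ⌊x + α⌋ = 0 := Int.floor_eq_zero_iff.2 ⟨by linarith, by linarith⟩
      simp [e1, e2]
    · obtain ⟨h0, h1⟩ : 1 - α < x ∧ x < 1 - α + α := hx
      refine ⟨decide_eq_true ?_, ?_⟩
      · have e2 : ⌊x + α⌋ = ⌊x + α - 1⌋ + 1 := by rw [Int.floor_sub_one]; ring
        have e3 : ⌊x⌋ < 1 := Int.floor_lt.2 (by push_cast; linarith)
        have e4 : 0 ≤ ⌊x + α - 1⌋ := Int.le_floor.2 (by push_cast; linarith)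
        simp only [Nat.cast_zero, zero_add, one_mul, zero_mul, add_zero]
        omega
      · rw [hs, ← rotCode_add_int α (x + α) (-1)]
        simp only [iet, cond_true]
        congr 1
        push_cast; ring
  funext n
  induction n generalizing v x with
  | zero => exact (key _ _ h.mem).1.symm
  | succ n ih =>
    have h1 := ih h.next
    have h2 := (key _ _ h.mem).2
    simp only at h1 h2
    rw [h2] at h1
    exact h1

/-- All prefixes of the limit word are prefixes of codings of one rotation, since the heights of the
towers tend to infinity. -/
theorem IsLimit.exists_rotCode {κ : ℕ → Kind} (h : Mixing κ) {u : ℕ → Letter} (hu : IsLimit κ u) :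
    ∃ α, 0 < α ∧ α < 1 ∧ ∀ N, ∃ x, ∀ n < N, u n = rotCode α x n := by
  obtain ⟨p, hpos, hp, hsum⟩ := h.exists_lengths
  have h1 := hpos 0
  refine ⟨(p 0).2, h1.2, by linarith, fun N => ?_⟩
  obtain ⟨k, hk⟩ := h.exists_le_height N
  obtain ⟨v, x, hv, h0⟩ := exists_iet_codes (hpos k).1 (hpos k).2
  obtain ⟨y, hy⟩ := exists_iet_codes_iterSubst hpos hp hv
  rw [show (p 0).1 = 1 - (p 0).2 by linarith] at hy
  refine ⟨y, fun n hn => ?_⟩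
  rw [← eq_rotCode_of_iet_codes h1.2 hy]
  exact (hu k v h0 n (hn.trans_le (hk k le_rfl false))).symm

/-! ### Density of the orbits of irrational rotations -/

theorem denseRange_nsmul_coe {α : ℝ} (hα : Irrational α) :
    DenseRange fun k : ℕ => k • (α : UnitAddCircle) :=
  denseRange_zsmul_iff_nsmul.1 (AddCircle.denseRange_zsmul_coe_iff.2 (by rwa [div_one]))

/-- The positive orbit of `0` under an irrational rotation meets every interval. -/
theorem exists_nat_int_mem_Ioo {α : ℝ} (hα : Irrational α) {a b : ℝ} (hab : a < b) :
    ∃ (k : ℕ) (m : ℤ), k * α + m ∈ Ioo a b := by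
  have hopen : IsOpen ((fun x : ℝ => (x : UnitAddCircle)) '' Ioo a b) :=
    QuotientAddGroup.isOpenMap_coe _ isOpen_Ioo
  obtain ⟨k, x, hx, hk⟩ := (denseRange_nsmul_coe hα).exists_mem_open hopen
    ((nonempty_Ioo.2 hab).image _)
  simp only at hk
  rw [← AddCircle.coe_nsmul, ← sub_eq_zero, ← AddCircle.coe_sub, AddCircle.coe_eq_zero_iff] at hk
  obtain ⟨m, hm⟩ := hk
  refine ⟨k, m, ?_⟩
  have : k * α + m = x := by
    simp only [nsmul_eq_mul, zsmul_eq_mul, mul_one] at hm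
    linarith
  rwa [this]

/-! ### Words which code a rotation -/

/-- All prefixes of the word `u` are prefixes of codings of the rotation by the irrational number
`α`. -/
structure CodesRotation (α : ℝ) (u : ℕ → Letter) : Prop where
  pos : 0 < α
  lt_one : α < 1
  irrational : Irrational α
  exists_prefix : ∀ N, ∃ x, ∀ n < N, u n = rotCode α x n

/-- The limit word codes a rotation, and the angle of the rotation is irrational because the limit
word is not eventually periodic. -/
theorem IsLimit.exists_codesRotation {κ : ℕ → Kind} (h : Mixing κ) {u : ℕ → Letter}
    (hu : IsLimit κ u) : ∃ α, CodesRotation α u := by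
  obtain ⟨α, h0, h1, hpre⟩ := hu.exists_rotCode h
  refine ⟨α, h0, h1, ?_, hpre⟩
  -- the codings of a rational rotation are periodic, with a common period
  rintro ⟨q, rfl⟩
  have hd : ∀ x, shift^[q.den] (rotCode q x) = rotCode q x := by
    intro x
    rw [iterate_shift_rotCode, ← rotCode_add_int (q : ℝ) x q.num]
    congr 2
    exact_mod_cast Rat.den_mul_eq_num q
  refine hu.not_evPer h q.den ⟨0, q.den, q.pos, ?_, wsum_const_one _ _⟩
  rw [zero_add, Function.iterate_zero_apply]
  funext n
  obtain ⟨x, hx⟩ := hpre (n + q.den + 1)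
  rw [iterate_shift_apply, hx _ (by omega), hx n (by omega), ← iterate_shift_apply (rotCode q x), hd]

/-- Adding `α ∈ (0, 1)` increases the integer part by `0` or `1`. -/
theorem floor_succ_eq {α : ℝ} (h0 : 0 < α) (h1 : α < 1) (x : ℝ) (n : ℕ) :
    ⌊x + (n + 1 : ℕ) * α⌋ = ⌊x + n * α⌋ + (rotCode α x n).toNat := by
  have e1 : ⌊x + n * α⌋ ≤ ⌊x + (n + 1) * α⌋ := Int.floor_le_floor (by linarith)
  have e2 : ⌊x + (n + 1) * α⌋ < ⌊x + n * α⌋ + 2 := by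
    refine Int.floor_lt.2 ?_
    have := Int.lt_floor_add_one (x + n * α)
    push_cast
    linarith
  rw [rotCode]
  push_cast
  by_cases h : ⌊x + (n + 1) * α⌋ = ⌊x + n * α⌋
  · simp [h]
  · simp only [ne_eq, h, not_false_eq_true, decide_true, Bool.toNat_true]
    push_cast
    omega

theorem wsum_rotCode {α : ℝ} (h0 : 0 < α) (h1 : α < 1) (x : ℝ) (m : ℕ) :
    (wsum Bool.toNat (rotCode α x) m : ℤ) = ⌊x + m * α⌋ - ⌊x⌋ := by
  induction m with
  | zero => simp
  | succ m ih =>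
    rw [wsum_succ, floor_succ_eq h0 h1]
    push_cast
    rw [ih]
    ring

/-- The number `t` is an angle of the word `v`: the number of letters `b` in the prefixes of `v` is
the one prescribed by the rotation, up to the ambiguity when the orbit of `t` meets `ℤ`. -/
def IsAngle (α : ℝ) (v : ℕ → Letter) (t : ℝ) : Prop :=
  ∀ m : ℕ, (wsum Bool.toNat v m : ℝ) ≤ t + m * α ∧ t + m * α ≤ wsum Bool.toNat v m + 1

theorem IsAngle.mem_Icc {α : ℝ} {v : ℕ → Letter} {t : ℝ} (h : IsAngle α v t) : t ∈ Icc 0 1 := by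
  have := h 0
  simp only [wsum_zero, Nat.cast_zero, zero_mul, add_zero, zero_add] at this
  exact this

theorem isAngle_rotCode {α : ℝ} (h0 : 0 < α) (h1 : α < 1) {x : ℝ} (hx : x ∈ Ico 0 1) :
    IsAngle α (rotCode α x) x := by
  intro m
  have h2 := wsum_rotCode h0 h1 x m
  rw [Int.floor_eq_zero_iff.2 hx, sub_zero] at h2
  have h3 : (wsum Bool.toNat (rotCode α x) m : ℝ) = ⌊x + m * α⌋ := by exact_mod_cast h2
  rw [h3]
  exact ⟨Int.floor_le _, (Int.lt_floor_add_one _).le⟩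

/-- By density of the orbits, two different angles are separated by an integer after some number of
rotations. -/
theorem IsAngle.unique {α : ℝ} (hα : Irrational α) {v : ℕ → Letter} {t t' : ℝ}
    (h : IsAngle α v t) (h' : IsAngle α v t') : t = t' := by
  by_contra hne
  wlog hlt : t < t' generalizing t t'
  · exact this h' h (Ne.symm hne) (lt_of_le_of_ne (not_lt.1 hlt) (Ne.symm hne))
  -- an integer `q` separates `t + m α` from `t' + m α`
  obtain ⟨m, q, h1, h2⟩ := exists_nat_int_mem_Ioo hα (neg_lt_neg hlt)
  have h3 := (h m).1
  have h4 := (h' m).2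
  have h5 : (wsum Bool.toNat v m : ℤ) < -q := by
    have : (wsum Bool.toNat v m : ℝ) < -q := by linarith
    exact_mod_cast this
  have h6 : -q < (wsum Bool.toNat v m : ℤ) + 1 := by
    have : (-q : ℝ) < wsum Bool.toNat v m + 1 := by linarith
    exact_mod_cast this
  omega

theorem IsAngle.shift {α : ℝ} {v : ℕ → Letter} {t : ℝ} (h : IsAngle α v t) :
    IsAngle α (shift v) (t + α - (v 0).toNat) := by
  intro m
  have := h (m + 1)
  rw [wsum_succ'] at this
  push_cast at this
  constructor <;> linarith

/-- If the orbit of the angle avoids the integers, then the angle determines the word. -/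
theorem IsAngle.eq_rotCode {α : ℝ} (h0 : 0 < α) (h1 : α < 1) {v : ℕ → Letter} {t : ℝ}
    (h : IsAngle α v t) (ht : ∀ (m : ℕ) (q : ℤ), t + m * α ≠ q) : v = rotCode α t := by
  have hfl : ∀ m : ℕ, ⌊t + m * α⌋ = wsum Bool.toNat v m := by
    intro m
    refine Int.floor_eq_iff.2 ⟨by exact_mod_cast (h m).1, ?_⟩
    refine lt_of_le_of_ne (by exact_mod_cast (h m).2) ?_
    have := ht m (wsum Bool.toNat v m + 1)
    exact_mod_cast this
  funext m
  have h2 := floor_succ_eq h0 h1 t m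
  rw [hfl, hfl, wsum_succ] at h2
  have h3 : (v m).toNat = (rotCode α t m).toNat := by push_cast at h2; omega
  revert h3
  cases v m <;> cases rotCode α t m <;> simp

theorem CodesRotation.exists_rotCode {α : ℝ} {u : ℕ → Letter} (hu : CodesRotation α u)
    {v : ℕ → Letter} (hv : v ∈ subshift u) (N : ℕ) :
    ∃ x ∈ Ico (0 : ℝ) 1, ∀ n < N, v n = rotCode α x n := by
  obtain ⟨k, hk⟩ := exists_agree_of_mem_subshift hv N
  obtain ⟨x, hx⟩ := hu.exists_prefix (N + k)
  refine ⟨Int.fract (x + k * α), ⟨Int.fract_nonneg _, Int.fract_lt_one _⟩, fun n hn => ?_⟩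
  rw [← hk n hn, hx _ (by omega), ← iterate_shift_apply (rotCode α x), iterate_shift_rotCode]
  conv_lhs => rw [← Int.fract_add_floor (x + k * α), rotCode_add_int]

/-- The angle is the supremum of the differences between the number of letters `b` in a prefix and
its expected value; the prefixes are those of codings of the rotation, so all constraints are
compatible. -/
theorem CodesRotation.exists_isAngle {α : ℝ} {u : ℕ → Letter} (hu : CodesRotation α u)
    {v : ℕ → Letter} (hv : v ∈ subshift u) : ∃ t, IsAngle α v t := by
  have key : ∀ m m' : ℕ, (wsum Bool.toNat v m : ℝ) - m * α ≤ wsum Bool.toNat v m' + 1 - m' * α := by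
    intro m m'
    obtain ⟨x, hx, h⟩ := hu.exists_rotCode hv (m + m')
    have h1 := isAngle_rotCode hu.pos hu.lt_one hx
    have e1 : wsum Bool.toNat v m = wsum Bool.toNat (rotCode α x) m :=
      wsum_congr _ fun i hi => h i (by omega)
    have e2 : wsum Bool.toNat v m' = wsum Bool.toNat (rotCode α x) m' :=
      wsum_congr _ fun i hi => h i (by omega)
    rw [e1, e2]
    linarith [(h1 m).1, (h1 m').2]
  refine ⟨⨆ m : ℕ, ((wsum Bool.toNat v m : ℝ) - m * α), fun m => ⟨?_, ?_⟩⟩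
  · have := le_ciSup (f := fun m : ℕ => ((wsum Bool.toNat v m : ℝ) - m * α))
      ⟨_, by rintro _ ⟨m, rfl⟩; exact key m 0⟩ m
    linarith
  · have : (⨆ m : ℕ, ((wsum Bool.toNat v m : ℝ) - m * α)) ≤ wsum Bool.toNat v m + 1 - m * α :=
      ciSup_le fun m' => key m' m
    linarith

/-- Codings of rotations are continuous from the right. -/
theorem eventually_rotCode_eq (α x : ℝ) (N : ℕ) :
    ∀ᶠ x' in 𝓝[>] x, ∀ n < N, rotCode α x' n = rotCode α x n := by
  have key : ∀ c : ℝ, ∀ᶠ x' in 𝓝[>] x, ⌊x' + c⌋ = ⌊x + c⌋ := by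
    intro c
    have h1 : x < ⌊x + c⌋ + 1 - c := by linarith [Int.lt_floor_add_one (x + c)]
    filter_upwards [Ioo_mem_nhdsGT h1] with x' hx'
    exact Int.floor_eq_iff.2 ⟨by linarith [Int.floor_le (x + c), hx'.1], by linarith [hx'.2]⟩
  refine (eventually_all_finite (finite_lt_nat N)).2 fun n _ => ?_
  filter_upwards [key (n * α), key ((n + 1) * α)] with x' h1 h2
  rw [rotCode, rotCode, h1, h2]

/-- All codings of the rotation belong to the subshift. -/
theorem CodesRotation.rotCode_mem_subshift {α : ℝ} {u : ℕ → Letter} (hu : CodesRotation α u)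
    (x : ℝ) : rotCode α x ∈ subshift u := by
  choose X hX hpre using hu.exists_rotCode (self_mem_subshift u)
  obtain ⟨y, -, φ, hφ, hy⟩ := isCompact_Icc.tendsto_subseq
    fun N => ⟨(hX N).1, (hX N).2.le⟩
  refine mem_subshift_of_agree fun N => ?_
  obtain ⟨x', hxx', hx'⟩ := mem_nhdsGT_iff_exists_Ioo_subset.1 (eventually_rotCode_eq α x N)
  obtain ⟨k, m, h1, h2⟩ := exists_nat_int_mem_Ioo hu.irrational
    (sub_lt_sub_right (mem_Ioi.1 hxx') y)
  have hlim : ∀ᶠ j in atTop, X (φ j) + (k * α + m) ∈ Ioo x x' := by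
    refine (hy.add_const (k * α + m : ℝ)).eventually (Ioo_mem_nhds ?_ ?_) <;> linarith
  obtain ⟨j, hj, hjN⟩ := (hlim.and (eventually_ge_atTop (N + k))).exists
  refine ⟨k, fun i hi => ?_⟩
  have h3 := hφ.le_apply (x := j)
  rw [hpre (φ j) _ (by omega), ← hx' hj i hi, ← add_assoc, rotCode_add_int,
    ← iterate_shift_apply (rotCode α (X (φ j))), iterate_shift_rotCode]

/-- The angle depends continuously on the word. -/
theorem CodesRotation.exists_angle {α : ℝ} {u : ℕ → Letter} (hu : CodesRotation α u) :
    ∃ τ : subshift u → ℝ, Continuous τ ∧ ∀ v : subshift u, IsAngle α v (τ v) := by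
  choose τ hτ using fun v : subshift u => hu.exists_isAngle v.2
  refine ⟨τ, continuous_of_isClosed_graph (K := Icc 0 1)
    (G := {p : (ℕ → Letter) × ℝ | IsAngle α p.1 p.2}) isCompact_Icc ?_ (fun v => (hτ v).mem_Icc)
    fun v x _ => ⟨fun h => h.unique hu.irrational (hτ v), fun h => h ▸ hτ v⟩, hτ⟩
  have hw : ∀ m, Continuous fun p : (ℕ → Letter) × ℝ => (wsum Bool.toNat p.1 m : ℝ) := by
    intro m
    have h1 : Continuous fun v : ℕ → Letter => (wsum Bool.toNat v m : ℝ) :=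
      continuous_iff_continuousAt.2 fun v => by
        refine (continuousAt_const (y := (wsum Bool.toNat v m : ℝ))).congr ?_
        filter_upwards [eventually_agree v m] with w hw
        rw [wsum_congr _ hw]
    exact h1.comp continuous_fst
  have : {p : (ℕ → Letter) × ℝ | IsAngle α p.1 p.2} = ⋂ m : ℕ,
      ({p | (wsum Bool.toNat p.1 m : ℝ) ≤ p.2 + m * α} ∩
        {p | p.2 + m * α ≤ wsum Bool.toNat p.1 m + 1}) := by
    ext p
    simp only [IsAngle, mem_iInter]
    rfl
  rw [this]
  refine isClosed_iInter fun m => (isClosed_le (hw m) ?_).inter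
    (isClosed_le ?_ ((hw m).add continuous_const)) <;> fun_prop

/-! ### Sturmian words -/

/-- For a finite set of reals in `(0, 1)`, the number of elements up to a point takes all values. -/
theorem exists_card_filter_le {s : Finset ℝ} (hs : ∀ x ∈ s, 0 < x ∧ x < 1) {j : ℕ}
    (hj : j ≤ s.card) : ∃ x ∈ Ico (0 : ℝ) 1, {y ∈ s | y ≤ x}.card = j := by
  rcases j with - | j
  · refine ⟨0, ⟨le_rfl, one_pos⟩, Finset.card_eq_zero.2 (Finset.filter_eq_empty_iff.2 ?_)⟩
    exact fun y hy => not_le.2 (hs y hy).1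
  · set e := s.orderEmbOfFin rfl
    have hmem := s.orderEmbOfFin_mem rfl ⟨j, hj⟩
    refine ⟨e ⟨j, hj⟩, ⟨(hs _ hmem).1.le, (hs _ hmem).2⟩, ?_⟩
    have : {y ∈ s | y ≤ e ⟨j, hj⟩} = (Finset.Iic (⟨j, hj⟩ : Fin s.card)).map e.toEmbedding := by
      ext y
      rw [Finset.mem_filter, Finset.mem_map]
      constructor
      · rintro ⟨hy, hle⟩
        rw [← Finset.mem_coe, ← s.range_orderEmbOfFin rfl] at hy
        obtain ⟨i, rfl⟩ := hy
        exact ⟨i, Finset.mem_Iic.2 (e.le_iff_le.1 hle), rfl⟩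
      · rintro ⟨i, hi, rfl⟩
        exact ⟨s.orderEmbOfFin_mem rfl i, e.le_iff_le.2 (Finset.mem_Iic.1 hi)⟩
    rw [this, Finset.card_map, Fin.card_Iic]

/-- The number of indices `1 ≤ m ≤ n` for which `x + m α` has passed over one more integer than
`m α`; it determines the prefix of length `n` of the coding of `x`. -/
def passings (α : ℝ) (n : ℕ) (x : ℝ) : ℕ :=
  {y ∈ (Finset.Icc 1 n).image fun m : ℕ => 1 - Int.fract (m * α) | y ≤ x}.card

theorem injective_fract_mul {α : ℝ} (hα : Irrational α) :
    Function.Injective fun m : ℕ => 1 - Int.fract (m * α) := by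
  intro m m' h
  by_contra hne
  have h1 : Int.fract (m * α) = Int.fract (m' * α) := by simp only at h; linarith
  obtain ⟨z, hz⟩ := Int.fract_eq_fract.1 h1
  have hd : ((m : ℤ) - m' : ℤ) ≠ 0 := sub_ne_zero.2 (by exact_mod_cast hne)
  refine (hα.intCast_mul hd) ⟨z, ?_⟩
  push_cast
  linarith

theorem floor_add_eq {x y : ℝ} (hx : x ∈ Ico (0 : ℝ) 1) :
    ⌊x + y⌋ = ⌊y⌋ + if 1 - Int.fract y ≤ x then 1 else 0 := by
  have h1 := Int.fract_add_floor y
  have h2 := Int.fract_nonneg y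
  have h3 := Int.fract_lt_one y
  split_ifs with h
  · refine Int.floor_eq_iff.2 ⟨?_, ?_⟩ <;> push_cast <;> linarith [hx.2]
  · refine Int.floor_eq_iff.2 ⟨?_, ?_⟩ <;> push_cast <;> linarith [hx.1]

theorem rotCode_agree_iff {α : ℝ} (h0 : 0 < α) (h1 : α < 1) (n : ℕ) {x x' : ℝ}
    (hx : x ∈ Ico (0 : ℝ) 1) (hx' : x' ∈ Ico (0 : ℝ) 1) :
    (∀ i < n, rotCode α x i = rotCode α x' i) ↔ passings α n x = passings α n x' := by
  have hfl : (∀ i < n, rotCode α x i = rotCode α x' i) ↔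
      ∀ m ∈ Finset.Icc 1 n, (1 - Int.fract (m * α) ≤ x ↔ 1 - Int.fract (m * α) ≤ x') := by
    have e0 : ⌊x⌋ = 0 := Int.floor_eq_zero_iff.2 hx
    have e0' : ⌊x'⌋ = 0 := Int.floor_eq_zero_iff.2 hx'
    have e1 : ∀ m : ℕ, (⌊x + m * α⌋ = ⌊x' + m * α⌋ ↔
        (1 - Int.fract (m * α) ≤ x ↔ 1 - Int.fract (m * α) ≤ x')) := by
      intro m
      rw [floor_add_eq hx, floor_add_eq hx']
      by_cases a : 1 - Int.fract (m * α) ≤ x <;> by_cases b : 1 - Int.fract (m * α) ≤ x' <;>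
        simp [a, b]
    constructor
    · intro h m hm
      rw [← e1]
      have w1 := wsum_rotCode h0 h1 x m
      have w2 := wsum_rotCode h0 h1 x' m
      rw [wsum_congr _ fun i hi => h i (lt_of_lt_of_le hi (Finset.mem_Icc.1 hm).2), w2, e0, e0'] at w1
      omega
    · intro h i hi
      have hall : ∀ m ≤ n, ⌊x + m * α⌋ = ⌊x' + m * α⌋ := by
        intro m hm
        rcases Nat.eq_zero_or_pos m with rfl | hm0
        · simp [e0, e0']
        · exact (e1 m).2 (h m (Finset.mem_Icc.2 ⟨hm0, hm⟩))
      have f1 := floor_succ_eq h0 h1 x i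
      have f2 := floor_succ_eq h0 h1 x' i
      rw [hall i hi.le, hall (i + 1) hi, f2] at f1
      have h3 : (rotCode α x i).toNat = (rotCode α x' i).toNat := by omega
      revert h3
      cases rotCode α x i <;> cases rotCode α x' i <;> simp
  rw [hfl]
  set s := (Finset.Icc 1 n).image fun m : ℕ => 1 - Int.fract (m * α) with hs
  have hfilter : (∀ m ∈ Finset.Icc 1 n, (1 - Int.fract (m * α) ≤ x ↔ 1 - Int.fract (m * α) ≤ x')) ↔
      {y ∈ s | y ≤ x} = {y ∈ s | y ≤ x'} := by
    rw [Finset.filter_inj', hs]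
    simp only [Finset.mem_image]
    exact ⟨by rintro h _ ⟨m, hm, rfl⟩; exact h m hm, fun h m hm => h ⟨m, hm, rfl⟩⟩
  rw [hfilter, passings, passings, ← hs]
  refine ⟨fun h => by rw [h], fun h => ?_⟩
  -- the two sets are nested
  rcases le_total x x' with hxx | hxx
  · exact Finset.eq_of_subset_of_card_le
      (Finset.monotone_filter_right _ fun y _ hy => le_trans hy hxx) h.ge
  · exact (Finset.eq_of_subset_of_card_le
      (Finset.monotone_filter_right _ fun y _ hy => le_trans hy hxx) h.le).symm

theorem CodesRotation.isSturmian {α : ℝ} {u : ℕ → Letter} (hu : CodesRotation α u) :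
    IsSturmian u := by
  intro n
  have hα := hu.irrational
  set s := (Finset.Icc 1 n).image fun m : ℕ => 1 - Int.fract (m * α) with hs
  have hcard : s.card = n := by
    rw [hs, Finset.card_image_of_injective _ (injective_fract_mul hα), Nat.card_Icc]; omega
  have hs1 : ∀ y ∈ s, 0 < y ∧ y < 1 := by
    intro y hy
    obtain ⟨m, hm, rfl⟩ := Finset.mem_image.1 hy
    have hm0 : m ≠ 0 := by have := (Finset.mem_Icc.1 hm).1; omega
    have h2 := Int.fract_lt_one (m * α)
    have h3 : 0 < Int.fract (m * α) := by
      refine Int.fract_pos.2 fun h => ?_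
      exact (hα.natCast_mul hm0) ⟨⌊m * α⌋, by rw [h]; simp⟩
    exact ⟨by linarith, by linarith⟩
  choose! X hX hXj using fun (j : ℕ) (hj : j ≤ n) => exists_card_filter_le hs1 (hj.trans hcard.ge)
  set W : ℝ → List Letter := fun x => List.ofFn fun i : Fin n => rotCode α x i with hW
  have hWeq : ∀ {x x'}, x ∈ Ico (0 : ℝ) 1 → x' ∈ Ico (0 : ℝ) 1 →
      (W x = W x' ↔ passings α n x = passings α n x') := by
    intro x x' hx hx'
    rw [← rotCode_agree_iff hu.pos hu.lt_one n hx hx', hW]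
    simp only [List.ofFn_inj, funext_iff]
    exact ⟨fun h i hi => h ⟨i, hi⟩, fun h i => h i i.2⟩
  have hfac : factors u n = (fun j => W (X j)) '' (Finset.range (n + 1) : Set ℕ) := by
    ext w
    constructor
    · rintro ⟨k, rfl⟩
      obtain ⟨x, hx, h⟩ := hu.exists_rotCode (iterate_shift_mem_subshift (self_mem_subshift u) k) n
      have hle : passings α n x ≤ n := (Finset.card_filter_le _ _).trans hcard.le
      refine ⟨passings α n x, Finset.mem_coe.2 (Finset.mem_range.2 (by omega)), ?_⟩
      have h2 : W (X (passings α n x)) = W x := (hWeq (hX _ hle) hx).2 (hXj _ hle)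
      simp only [h2]
      rw [hW]
      simp only [List.ofFn_inj]
      funext i
      rw [← h i i.2, iterate_shift_apply, add_comm]
    · rintro ⟨j, hj, rfl⟩
      obtain ⟨k, hk⟩ := exists_agree_of_mem_subshift (hu.rotCode_mem_subshift (X j)) n
      refine ⟨k, ?_⟩
      rw [hW]
      simp only [List.ofFn_inj]
      funext i
      rw [add_comm, hk i i.2]
  rw [hfac, Set.InjOn.ncard_image, Set.ncard_coe_finset, Finset.card_range]
  intro i hi j hj h
  have hi' : i ≤ n := by have := Finset.mem_range.1 (Finset.mem_coe.1 hi); omega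
  have hj' : j ≤ n := by have := Finset.mem_range.1 (Finset.mem_coe.1 hj); omega
  have h2 := (hWeq (hX i hi') (hX j hj')).1 h
  rw [← hXj i hi', ← hXj j hj']
  exact h2

/-! ### Unique ergodicity -/

instance : IsProbabilityMeasure (volume : Measure UnitAddCircle) := ⟨UnitAddCircle.measure_univ⟩

/-- An irrational rotation is uniquely ergodic: integrals of continuous functions are invariant
under a dense set of translations, hence under all translations. -/
theorem eq_volume_of_measurePreserving_add {α : ℝ} (hα : Irrational α) {ν : Measure UnitAddCircle}
    [IsProbabilityMeasure ν]
    (h : MeasurePreserving (fun x : UnitAddCircle => x + (α : UnitAddCircle)) ν ν) :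
    ν = volume := by
  have hmap : ∀ x : UnitAddCircle, ν.map (fun y => x + y) = ν := by
    intro x
    have hm : ∀ x : UnitAddCircle, Measurable fun y => x + y := fun x => measurable_const_add x
    have : IsProbabilityMeasure (ν.map fun y => x + y) :=
      Measure.isProbabilityMeasure_map (hm x).aemeasurable
    refine ext_of_forall_integral_eq_of_IsFiniteMeasure fun f => ?_
    have hint : ∀ x, ∫ y, f y ∂ν.map (fun y => x + y) = ∫ y, f (x + y) ∂ν := fun x =>
      integral_map (hm x).aemeasurable f.continuous.aestronglyMeasurable
    have hcont : Continuous fun x => ∫ y, f (x + y) ∂ν := by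
      refine continuous_of_dominated (bound := fun _ => ‖f‖) (fun x => ?_) (fun x => ?_)
        (integrable_const _) (Eventually.of_forall fun y => ?_)
      · exact (f.continuous.comp (continuous_const_add x)).aestronglyMeasurable
      · exact Eventually.of_forall fun y => f.norm_coe_le_norm _
      · exact f.continuous.comp (continuous_id.add continuous_const)
    have heq : (fun x => ∫ y, f (x + y) ∂ν) = fun _ => ∫ y, f y ∂ν := by
      refine hcont.ext_on (denseRange_nsmul_coe hα) continuous_const ?_
      rintro _ ⟨k, rfl⟩
      have hk := (h.iterate k).map_eq
      rw [add_right_iterate] at hk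
      simp only
      rw [← hint, show (fun y => k • (α : UnitAddCircle) + y) = fun y => y + k • (α : UnitAddCircle)
        from funext fun y => add_comm _ _, hk]
    rw [hint, congrFun heq x]
  have : ν.IsAddLeftInvariant := ⟨hmap⟩
  have h1 := Measure.isAddLeftInvariant_eq_smul ν (volume : Measure UnitAddCircle)
  have h2 := congrArg (fun μ : Measure UnitAddCircle => μ univ) h1
  simp only [measure_univ, Measure.smul_apply, ENNReal.smul_def, smul_eq_mul, mul_one] at h2
  have h3 : Measure.addHaarScalarFactor ν (volume : Measure UnitAddCircle) = 1 := by
    exact_mod_cast h2.symm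
  rw [h1, h3, one_smul]

/-- The representative in `[0, 1)` of a point of the circle. -/
def rep (y : UnitAddCircle) : ℝ := AddCircle.measurableEquivIco 1 0 y

theorem measurable_rep : Measurable rep :=
  measurable_subtype_coe.comp (AddCircle.measurableEquivIco 1 0).measurable

theorem rep_mem (y : UnitAddCircle) : rep y ∈ Ico (0 : ℝ) 1 := by
  obtain ⟨h1, h2⟩ := (AddCircle.measurableEquivIco 1 0 y).2
  exact ⟨h1, h2.trans_eq (zero_add 1)⟩

theorem coe_rep (y : UnitAddCircle) : (rep y : UnitAddCircle) = y :=
  (AddCircle.equivIco 1 0).symm_apply_apply y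

theorem measurable_rotCode (α : ℝ) : Measurable (rotCode α) := by
  refine measurable_pi_lambda _ fun n => ?_
  have h1 : Measurable fun q : ℤ × ℤ => decide (q.1 ≠ q.2) := measurable_of_countable _
  exact h1.comp ((Int.measurable_floor.comp (measurable_id.add_const _)).prodMk
    (Int.measurable_floor.comp (measurable_id.add_const _)))

theorem rotCode_eq_of_coe_eq {α x x' : ℝ} (h : (x : UnitAddCircle) = x') :
    rotCode α x = rotCode α x' := by
  rw [← sub_eq_zero, ← AddCircle.coe_sub, AddCircle.coe_eq_zero_iff] at h
  obtain ⟨m, hm⟩ := h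
  rw [← rotCode_add_int α x' m]
  congr 1
  rw [zsmul_eq_mul, mul_one] at hm
  linarith

/-- The semiconjugacy between the subshift and the rotation, which is invertible outside a countable
set. -/
theorem CodesRotation.exists_semiconj {α : ℝ} {u : ℕ → Letter} (hu : CodesRotation α u) :
    ∃ (π : subshift u → UnitAddCircle) (ψ : UnitAddCircle → subshift u), Continuous π ∧
      Measurable ψ ∧ (∀ v, π (subshiftMap u v) = π v + (α : UnitAddCircle)) ∧
      (∀ y, ψ (y + (α : UnitAddCircle)) = subshiftMap u (ψ y)) ∧ (∀ y, π (ψ y) = y) ∧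
      ∃ Γ : Set UnitAddCircle, Γ.Countable ∧ (∀ y, y + (α : UnitAddCircle) ∈ Γ ↔ y ∈ Γ) ∧
        ∀ v, π v ∉ Γ → ψ (π v) = v := by
  obtain ⟨τ, hτc, hτ⟩ := hu.exists_angle
  refine ⟨fun v => (τ v : UnitAddCircle), fun y => ⟨rotCode α (rep y), hu.rotCode_mem_subshift _⟩,
    (AddCircle.continuous_mk' 1).comp hτc,
    ((measurable_rotCode α).comp measurable_rep).subtype_mk, fun v => ?_, fun y => ?_, fun y => ?_,
    range fun k : ℤ => k • (α : UnitAddCircle), countable_range _, fun y => ?_, fun v hv => ?_⟩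
  · have h1 : τ (subshiftMap u v) = τ v + α - ((v : ℕ → Letter) 0).toNat :=
      (hτ (subshiftMap u v)).unique hu.irrational (hτ v).shift
    simp only [h1, AddCircle.coe_sub, AddCircle.coe_add]
    rw [sub_eq_self, AddCircle.coe_eq_zero_iff]
    exact ⟨((v : ℕ → Letter) 0).toNat, by simp⟩
  · refine Subtype.ext ?_
    have h1 : shift (rotCode α (rep y)) = rotCode α (rep y + α) := by
      simpa using iterate_shift_rotCode α (rep y) 1
    refine Eq.trans (rotCode_eq_of_coe_eq ?_) h1.symm
    rw [AddCircle.coe_add, coe_rep, coe_rep]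
  · have h1 : τ ⟨rotCode α (rep y), hu.rotCode_mem_subshift _⟩ = rep y :=
      (hτ ⟨rotCode α (rep y), hu.rotCode_mem_subshift _⟩).unique hu.irrational
        (isAngle_rotCode hu.pos hu.lt_one (rep_mem y))
    simp only [h1]
    exact coe_rep y
  · constructor
    · rintro ⟨k, hk⟩
      exact ⟨k - 1, by simp only at hk ⊢; rw [sub_smul, hk, one_smul, add_sub_cancel_right]⟩
    · rintro ⟨k, rfl⟩
      exact ⟨k + 1, by simp only [add_smul, one_smul]⟩
  · refine Subtype.ext ?_
    have h1 := (hτ v).eq_rotCode hu.pos hu.lt_one fun m q hq => hv ⟨-m, ?_⟩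
    · rw [h1]
      exact rotCode_eq_of_coe_eq (coe_rep _)
    · have h2 : τ v = q • (1 : ℝ) - (m : ℤ) • α := by
        rw [zsmul_eq_mul, zsmul_eq_mul, mul_one, ← hq]; push_cast; ring
      simp only [h2, AddCircle.coe_sub, AddCircle.coe_zsmul, AddCircle.coe_period, smul_zero,
        zero_sub, neg_smul]

/-! ### The substitutions as compositions of elementary steps -/

/-- The extension to finite words of the composition of the first `k` elementary substitutions. -/
def iterBlock (κ : ℕ → Kind) : ℕ → List Letter → List Letter
  | 0, w => w
  | k + 1, w => iterBlock κ k (w.flatMap (block (κ k)))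

theorem length_iterBlock (κ : ℕ → Kind) (k : ℕ) (w : List Letter) :
    (iterBlock κ k w).length = (w.map (height κ k)).sum := by
  induction k generalizing w with
  | zero => simp [iterBlock, height]
  | succ k ih =>
    rw [iterBlock, ih, height]
    induction w with
    | nil => rfl
    | cons c w ihw =>
      rw [List.flatMap_cons, List.map_append, List.sum_append, ihw, List.map_cons, List.sum_cons,
        push]

theorem getElem?_flatMap_block {κ : Kind} {w : List Letter} {v : ℕ → Letter}
    (h : ∀ i < w.length, w[i]? = some (v i)) :
    ∀ i < (w.flatMap (block κ)).length, (w.flatMap (block κ))[i]? = some (substSeq κ v i) := by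
  induction w generalizing v with
  | nil => intro i hi; simp at hi
  | cons c w ih =>
    obtain rfl : c = v 0 := by simpa using h 0 (by simp)
    intro i hi
    rw [List.flatMap_cons] at hi ⊢
    rcases lt_or_ge i (blockLen κ (v 0)) with hlt | hge
    · have hlt' : i < (block κ (v 0)).length := hlt
      rw [List.getElem?_append_left hlt', substSeq_of_lt hlt, List.getD_eq_getElem _ _ hlt',
        List.getElem?_eq_getElem hlt']
    · obtain ⟨j, rfl⟩ := Nat.exists_eq_add_of_le hge
      have hge' : (block κ (v 0)).length ≤ blockLen κ (v 0) + j := hge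
      rw [List.getElem?_append_right hge', ← Nat.add_comm j, substSeq_add]
      have e : j + blockLen κ (v 0) - (block κ (v 0)).length = j := Nat.add_sub_cancel ..
      rw [e]
      refine ih (fun i hi => ?_) j ?_
      · have := h (i + 1) (by simpa using hi)
        rwa [List.getElem?_cons_succ] at this
      · rw [List.length_append] at hi
        have : (block κ (v 0)).length = blockLen κ (v 0) := rfl
        omega

theorem getElem?_iterBlock {κ : ℕ → Kind} {k : ℕ} {w : List Letter} {v : ℕ → Letter}
    (h : ∀ i < w.length, w[i]? = some (v i)) :
    ∀ i < (iterBlock κ k w).length, (iterBlock κ k w)[i]? = some (iterSubst κ k v i) := by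
  induction k generalizing w v with
  | zero => exact h
  | succ k ih => exact ih (getElem?_flatMap_block h)

theorem iterBlock_add (κ : ℕ → Kind) (k n : ℕ) (w : List Letter) :
    iterBlock κ k (iterBlock (fun i => κ (i + k)) n w) = iterBlock κ (n + k) w := by
  induction n generalizing w with
  | zero => rw [zero_add]; rfl
  | succ n ih => rw [iterBlock, ih, Nat.succ_add_eq_add_succ, Nat.add_succ, iterBlock]

/-- The composition of an elementary substitution with `k` steps of kind `cut`. -/
theorem iterBlock_succ_of_cut {κ : ℕ → Kind} {k : ℕ} (h : ∀ i, 1 ≤ i → i ≤ k → κ i = .cut)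
    (w : List Letter) : iterBlock κ (k + 1) w =
      (w.flatMap fun c => bif c then [true] else false :: List.replicate k true).flatMap
        (block (κ 0)) := by
  induction k generalizing w with
  | zero =>
    have : (fun c : Letter => bif c then [true] else [false]) = fun c => [c] := by
      funext c; cases c <;> rfl
    simp [iterBlock, this]
  | succ k ih =>
    rw [iterBlock, ih fun i h1 h2 => h i h1 (by omega), h (k + 1) (by omega) le_rfl]
    congr 1
    rw [List.flatMap_assoc]
    congr 1
    funext c
    cases c <;> simp [block, List.replicate_succ']

theorem flip_mem_Ioo {ω : Param} (h0 : 0 < ω.1) (h1 : ω.1 < 1) :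
    0 < flip ω.2 ω.1 ∧ flip ω.2 ω.1 < 1 := flip_mem h0 h1

theorem irrational_inv_flip {ω : Param} (h : Irrational ω.1) : Irrational (1 / flip ω.2 ω.1) := by
  rw [one_div]
  rcases Int.units_eq_one_or ω.2 with hε | hε <;> rw [hε]
  · rw [flip_one]; simpa using (h.natCast_sub 1).inv
  · rw [flip_neg_one]; exact h.inv

theorem good_toGeo {ω : Param} (h : Irrational ω.1) (h0 : 0 < ω.1) : Good (toGeo ω) :=
  ⟨by simp only [toGeo]; linarith, by simpa [toGeo] using h.natCast_add 1⟩

theorem one_le_digit {ω : Param} (h0 : 0 < ω.1) (h1 : ω.1 < 1) : 1 ≤ digit ω := by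
  obtain ⟨a, b⟩ := flip_mem_Ioo h0 h1
  exact Nat.le_floor (by rw [Nat.cast_one]; exact ((one_lt_div a).2 b).le)

theorem S_fst_mem {ω : Param} (h : Irrational ω.1) (h0 : 0 < ω.1) (h1 : ω.1 < 1) :
    Irrational (S ω).1 ∧ 0 < (S ω).1 ∧ (S ω).1 < 1 := by
  obtain ⟨a, b⟩ := flip_mem_Ioo h0 h1
  have hi : Irrational (S ω).1 := (irrational_inv_flip h).sub_natCast _
  have e1 : (digit ω : ℝ) ≤ 1 / flip ω.2 ω.1 := Nat.floor_le (by positivity)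
  have e2 : 1 / flip ω.2 ω.1 < digit ω + 1 := Nat.lt_floor_add_one _
  refine ⟨hi, lt_of_le_of_ne ?_ hi.ne_zero.symm, ?_⟩ <;> simp only [S] <;> linarith

theorem kindOf_toGeo {ω : Param} (h1 : ω.1 < 1) :
    kindOf (toGeo ω) = if ω.2 = -1 then .rot else .refl := by
  have : ¬ 2 < 1 + ω.1 := by linarith
  by_cases hε : ω.2 = -1 <;> simp [kindOf, toGeo, this, hε]

theorem nextParam_toGeo {ω : Param} (h1 : ω.1 < 1) :
    nextParam (toGeo ω) = (1 / flip ω.2 ω.1, 1) := by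
  rcases Int.units_eq_one_or ω.2 with hε | hε
  · have hk : kindOf (toGeo ω) = .refl := by rw [kindOf_toGeo h1, hε]; simp
    rw [nextParam, hk, hε, flip_one]
    simp only [toGeo]
    congr 2
    ring
  · have hk : kindOf (toGeo ω) = .rot := by rw [kindOf_toGeo h1, hε]; simp
    rw [nextParam, hk, hε, flip_neg_one]
    simp only [toGeo]
    congr 2
    ring

/-- The parameters during the run of `cut` steps. -/
theorem param_toGeo {ω : Param} (h : Irrational ω.1) (h0 : 0 < ω.1) (h1 : ω.1 < 1) {j : ℕ}
    (hj : j < digit ω) :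
    param (toGeo ω) (j + 1) = (1 / flip ω.2 ω.1 - j, (-1) ^ j) ∧
      ∀ i, 1 ≤ i → i ≤ j → kinds (toGeo ω) i = .cut := by
  induction j with
  | zero =>
    rw [param_succ]
    exact ⟨by simpa [param] using nextParam_toGeo h1, fun i h1 h2 => by omega⟩
  | succ j ih =>
    obtain ⟨ih1, ih2⟩ := ih (by omega)
    have hx : (digit ω : ℝ) < 1 / flip ω.2 ω.1 := by
      refine lt_of_le_of_ne (Nat.floor_le ?_) fun he => (irrational_inv_flip h) ⟨digit ω, ?_⟩
      · exact one_div_nonneg.2 (flip_mem_Ioo h0 h1).1.le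
      · rw [← he]; simp
    have hj' : (j : ℝ) + 2 ≤ digit ω := by exact_mod_cast hj
    have hk : kindOf (param (toGeo ω) (j + 1)) = .cut := by
      rw [ih1, kindOf, if_pos]
      simp only
      linarith
    refine ⟨?_, fun i h1 h2 => ?_⟩
    · rw [param_succ, nextParam, hk, ih1]
      simp only
      rw [pow_succ, mul_neg, mul_one]
      push_cast
      rw [sub_sub]
    · rcases Nat.lt_or_ge i (j + 1) with h | h
      · exact ih2 i h1 (by omega)
      · obtain rfl : i = j + 1 := by omega
        exact hk

/-- One step of the renormalization map `S` is made of `digit ω` elementary steps. -/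
theorem param_digit {ω : Param} (h : Irrational ω.1) (h0 : 0 < ω.1) (h1 : ω.1 < 1) :
    param (toGeo ω) (digit ω) = toGeo (S ω) := by
  obtain ⟨n, hn⟩ := Nat.exists_eq_add_of_le' (one_le_digit h0 h1)
  have := (param_toGeo h h0 h1 (j := n) (by omega)).1
  rw [hn, this, toGeo, S, hn]
  refine Prod.ext ?_ ?_
  · simp only; push_cast; ring
  · simp only; rw [pow_add, pow_add]; simp

theorem substWord_eq_iterBlock {ω : Param} (h : Irrational ω.1) (h0 : 0 < ω.1) (h1 : ω.1 < 1)
    (w : List Letter) : substWord ω w = iterBlock (kinds (toGeo ω)) (digit ω) w := by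
  obtain ⟨n, hn⟩ := Nat.exists_eq_add_of_le' (one_le_digit h0 h1)
  have hk := (param_toGeo h h0 h1 (j := n) (by omega)).2
  rw [hn, iterBlock_succ_of_cut hk, substWord, List.flatMap_assoc]
  congr 1
  funext c
  have h2 : kinds (toGeo ω) 0 = if ω.2 = -1 then .rot else .refl := kindOf_toGeo h1
  rw [h2]
  rcases Int.units_eq_one_or ω.2 with hε | hε <;> cases c <;>
    simp [subst, hε, hn, block, List.flatMap_replicate]

theorem exists_sadicPrefix_eq {ω : Param} (h : Irrational ω.1) (h0 : 0 < ω.1) (h1 : ω.1 < 1)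
    (ℓ : ℕ) : ∃ N ≥ ℓ, sadicPrefix ℓ ω = iterBlock (kinds (toGeo ω)) N [la] := by
  induction ℓ generalizing ω with
  | zero => exact ⟨digit ω, Nat.zero_le _, substWord_eq_iterBlock h h0 h1 _⟩
  | succ ℓ ih =>
    obtain ⟨hS, hS0, hS1⟩ := S_fst_mem h h0 h1
    obtain ⟨N, hN, e⟩ := ih hS hS0 hS1
    refine ⟨N + digit ω, by have := one_le_digit h0 h1; omega, ?_⟩
    rw [sadicPrefix, e, substWord_eq_iterBlock h h0 h1, ← param_digit h h0 h1, kinds_param,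
      iterBlock_add]

theorem IsLimit.isLimitWord {ω : Param} (h : Irrational ω.1) (h0 : 0 < ω.1) (h1 : ω.1 < 1)
    {u : ℕ → Letter} (hu : IsLimit (kinds (toGeo ω)) u) :
    IsLimitWord (fun ℓ => sadicPrefix ℓ ω) u := by
  intro n
  obtain ⟨k, hk⟩ := (good_toGeo h h0).mixing.exists_le_height (n + 1)
  filter_upwards [eventually_ge_atTop k] with ℓ hℓ
  obtain ⟨N, hN, e⟩ := exists_sadicPrefix_eq h h0 h1 ℓ
  have hlt : n < height (kinds (toGeo ω)) N false := hk N (hℓ.trans hN) false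
  rw [e, getElem?_iterBlock (v := fun _ => false), hu N _ rfl n hlt]
  · intro i hi
    obtain rfl : i = 0 := by simpa using hi
    rfl
  · rw [length_iterBlock]
    simpa using hlt

/-! ### Measures and conjugacy -/

theorem volume_eq_zero_of_countable {Γ : Set UnitAddCircle} (hΓ : Γ.Countable) :
    volume Γ = 0 := by
  have : NullSingletonClass (volume : Measure UnitAddCircle) := by
    refine ⟨fun x => ?_⟩
    have := AddCircle.volume_closedBall (T := (1 : ℝ)) (x := x) 0
    rw [Metric.closedBall_zero] at this
    simpa using this
  exact hΓ.measure_zero _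

theorem measurableSet_codes {s : Param} {u : ℕ → Letter} {h : subshift u → ℝ × ℝ}
    (hc : Continuous h) :
    MeasurableSet {v : subshift u | (geo s).Codes ((v : ℕ → Letter), h v)} := by
  have hn : ∀ n, Continuous fun v : subshift u =>
      ((geo s).next^[n] ((v : ℕ → Letter), h v)).2 := fun n =>
    continuous_snd.comp (((continuous_next s).iterate n).comp (continuous_subtype_val.prodMk hc))
  have : {v : subshift u | (geo s).Codes ((v : ℕ → Letter), h v)} =
      ⋂ n, ⋃ c, {v : subshift u | (v : ℕ → Letter) n = c} ∩
        (fun v : subshift u => ((geo s).next^[n] ((v : ℕ → Letter), h v)).2) ⁻¹' (geo s).cell c := by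
    ext v
    simp [CodedSystem.Codes]
  rw [this]
  refine MeasurableSet.iInter fun n => MeasurableSet.iUnion fun c => MeasurableSet.inter ?_ ?_
  · exact measurableSet_eq_fun ((measurable_pi_apply n).comp measurable_subtype_coe)
      measurable_const
  · exact ((isOpen_geo_cell s c).preimage (hn n)).measurableSet

section Conjugacy

variable {α : ℝ} {u : ℕ → Letter} {π : subshift u → UnitAddCircle} {ψ : UnitAddCircle → subshift u}

theorem measurable_subshiftMap (u : ℕ → Letter) : Measurable (subshiftMap u) :=
  (continuous_shift.measurable.comp measurable_subtype_coe).subtype_mk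

theorem measurePreserving_map_volume (hψ : Measurable ψ)
    (h : ∀ y, ψ (y + (α : UnitAddCircle)) = subshiftMap u (ψ y)) :
    MeasurePreserving (subshiftMap u) (volume.map ψ) (volume.map ψ) := by
  refine ⟨measurable_subshiftMap u, ?_⟩
  rw [Measure.map_map (measurable_subshiftMap u) hψ,
    show subshiftMap u ∘ ψ = ψ ∘ fun y => y + (α : UnitAddCircle) from funext fun y => (h y).symm,
    ← Measure.map_map hψ (measurable_add_const _), map_add_right_eq_self]

/-- An invariant probability measure on the subshift is the law of the coding of a uniform random
point, since its image on the circle is the Lebesgue measure. -/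
theorem eq_map_volume (hα : Irrational α) (hπ : Measurable π) (hψ : Measurable ψ)
    (h : ∀ v, π (subshiftMap u v) = π v + (α : UnitAddCircle)) {Γ : Set UnitAddCircle}
    (hΓ : Γ.Countable) (hinv : ∀ v, π v ∉ Γ → ψ (π v) = v) {m : Measure (subshift u)}
    [IsProbabilityMeasure m] (hm : MeasurePreserving (subshiftMap u) m m) :
    m = volume.map ψ := by
  have : IsProbabilityMeasure (m.map π) := Measure.isProbabilityMeasure_map hπ.aemeasurable
  have h1 : m.map π = volume := by
    refine eq_volume_of_measurePreserving_add hα ⟨measurable_add_const _, ?_⟩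
    rw [Measure.map_map (measurable_add_const _) hπ,
      show (fun y => y + (α : UnitAddCircle)) ∘ π = π ∘ subshiftMap u from
        funext fun v => (h v).symm, ← Measure.map_map hπ hm.measurable, hm.map_eq]
  rw [← h1, Measure.map_map hψ hπ]
  refine Eq.trans Measure.map_id.symm (Measure.map_congr ?_)
  have h2 : m (π ⁻¹' Γ) = 0 := by
    rw [← Measure.map_apply hπ hΓ.measurableSet, h1, volume_eq_zero_of_countable hΓ]
  filter_upwards [compl_mem_ae_iff.2 h2] with v hv
  exact (hinv v hv).symm

/-- Transport of a conjugacy through a map `h` on the subshift which is a semiconjugacy and is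
injective on an invariant set `V` of full measure. -/
theorem isMeasurablyConjugate {D : Set (ℝ × ℝ)} {F : ℝ × ℝ → ℝ × ℝ} {h : subshift u → ℝ × ℝ}
    (hc : Continuous h) (hπ : Measurable π) (hψ : Measurable ψ)
    (hπα : ∀ v, π (subshiftMap u v) = π v + (α : UnitAddCircle))
    (hψα : ∀ y, ψ (y + (α : UnitAddCircle)) = subshiftMap u (ψ y)) (hπψ : ∀ y, π (ψ y) = y)
    {V : Set (subshift u)} (hV : MeasurableSet V) (hVm : (volume.map ψ) Vᶜ = 0)
    (hVs : MapsTo (subshiftMap u) V V) (hψπ : ∀ v ∈ V, ψ (π v) = v) (hinj : InjOn h V)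
    (hD : MapsTo h V D) (hF : ∀ v ∈ V, F (h v) = h (subshiftMap u v)) :
    IsMeasurablyConjugate D F ((volume.map ψ).map h)
      (fun x : UnitAddCircle => x + (α : UnitAddCircle)) volume := by
  have hcl : MeasurableSet (subshift u) := (isClosed_subshift u).measurableSet
  have : StandardBorelSpace (subshift u) := hcl.standardBorel
  have : StandardBorelSpace V := hV.standardBorel
  have hemb : MeasurableEmbedding fun v : V => h v :=
    (hc.measurable.comp measurable_subtype_coe).measurableEmbedding
      fun v w hvw => Subtype.ext (hinj v.2 w.2 hvw)
  obtain ⟨φ, hφ, hφh⟩ := hemb.exists_measurable_extend (hπ.comp measurable_subtype_coe)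
    fun _ => ⟨0⟩
  have hφV : ∀ v ∈ V, φ (h v) = π v := fun v hv => congrFun hφh ⟨v, hv⟩
  have hA : MeasurableSet (h '' V) := by
    have : h '' V = range fun v : V => h v := by rw [image_eq_range]
    rw [this]
    exact hemb.measurableSet_range
  have hVae : ∀ᵐ v ∂(volume.map ψ), v ∈ V := hVm
  refine ⟨h '' V, ψ ⁻¹' V, φ, h ∘ ψ, hD.image_subset, hA, hψ hV, ?_, ?_, ?_, ?_, hφ,
    hc.measurable.comp hψ, ?_, fun y hy => ⟨ψ y, hy, rfl⟩, ?_, ?_, ?_, ?_⟩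
  · rw [Measure.map_apply hc.measurable hA.compl]
    exact measure_mono_null (fun v hv hvV => hv ⟨v, hvV, rfl⟩) hVm
  · rw [← preimage_compl, ← Measure.map_apply hψ hV.compl]
    exact hVm
  · rintro _ ⟨v, hv, rfl⟩
    exact ⟨_, hVs hv, (hF v hv).symm⟩
  · intro y hy
    simp only [mem_preimage, hψα]
    exact hVs hy
  · rintro _ ⟨v, hv, rfl⟩
    rw [mem_preimage, hφV v hv, hψπ v hv]
    exact hv
  · rintro _ ⟨v, hv, rfl⟩
    rw [hφV v hv, Function.comp_apply, hψπ v hv]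
  · intro y hy
    rw [Function.comp_apply, hφV _ hy, hπψ]
  · rintro _ ⟨v, hv, rfl⟩
    rw [hF v hv, hφV _ (hVs hv), hφV v hv, hπα]
  · rw [Measure.map_map hφ hc.measurable,
      Measure.map_congr (f := φ ∘ h) (g := π) (hVae.mono fun v hv => hφV v hv), Measure.map_map hπ hψ,
      show π ∘ ψ = id from funext hπψ, Measure.map_id]

end Conjugacy

end PiecewiseSquare

end

theorem mainTheorem4 (θ : ℝ) (hθ : Irrational θ) (hθ₀ : 0 ≤ θ) (hθ₁ : θ < 1) (ε : ℤˣ) :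
    -- the S-adic word `u_ω` exists and is Sturmian
    ∃ u : ℕ → PiecewiseSquare.Letter,
      PiecewiseSquare.IsLimitWord (fun ℓ => PiecewiseSquare.sadicPrefix ℓ (θ, ε)) u ∧
      PiecewiseSquare.IsSturmian u ∧
      -- the map `h`: continuous, with image `K_ω`, intertwining the shift and `T_ω`
      ∃ h : PiecewiseSquare.subshift u → ℝ × ℝ,
        Continuous h ∧
        Set.range h = PiecewiseSquare.aperiodicSet (θ, ε) ∧
        (∀ v, h v ∈ PiecewiseSquare.domT (θ, ε) →
          PiecewiseSquare.T (θ, ε) (h v) = h (PiecewiseSquare.subshiftMap u v)) ∧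
        -- the unique shift-invariant probability measure of the subshift
        ∃ m : MeasureTheory.Measure (PiecewiseSquare.subshift u),
          MeasureTheory.IsProbabilityMeasure m ∧
          MeasureTheory.MeasurePreserving (PiecewiseSquare.subshiftMap u) m m ∧
          (∀ m' : MeasureTheory.Measure (PiecewiseSquare.subshift u),
            MeasureTheory.IsProbabilityMeasure m' →
            MeasureTheory.MeasurePreserving (PiecewiseSquare.subshiftMap u) m' m' → m' = m) ∧
          -- almost every point of the subshift is sent to a point with an infinite `T_ω`-orbit,
          -- and is the only point of its fibre
          (∀ᵐ v ∂m, h v ∈ PiecewiseSquare.regularSet (θ, ε)) ∧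
          (∀ᵐ v ∂m, ∀ v', h v' = h v → v' = v) ∧
          -- `(K_ω, T_ω)` with the image measure is conjugate to an irrational rotation
          ∃ α : ℝ, Irrational α ∧
            PiecewiseSquare.IsMeasurablyConjugate
              (PiecewiseSquare.aperiodicSet (θ, ε) ∩ PiecewiseSquare.regularSet (θ, ε))
              (PiecewiseSquare.T (θ, ε)) (m.map h)
              (fun x : UnitAddCircle => x + (α : UnitAddCircle))
              (MeasureTheory.volume : MeasureTheory.Measure UnitAddCircle) := by
  open PiecewiseSquare in
  have h0 : 0 < θ := lt_of_le_of_ne hθ₀ hθ.ne_zero.symm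
  have hs : Good (toGeo (θ, ε)) := good_toGeo (ω := (θ, ε)) hθ h0
  have h2 : (toGeo (θ, ε)).1 ≤ 2 := by simp only [toGeo]; linarith
  obtain ⟨u, hu⟩ := hs.mixing.exists_isLimit
  obtain ⟨α, hα⟩ := hu.exists_codesRotation hs.mixing
  obtain ⟨h, hc, hh⟩ := exists_parametrization hs hu
  obtain ⟨π, ψ, hπ, hψ, hπα, hψα, hπψ, Γ, hΓ, hΓα, hinv⟩ := hα.exists_semiconj
  have hmem : ∀ v : subshift u, ((v : ℕ → Letter), h v) ∈ limitSet (toGeo (θ, ε)) :=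
    fun v => (hh v _).2 rfl
  have hrange : range h = aperiodicSet (θ, ε) := by
    rw [aperiodicSet_eq hs]
    ext z
    constructor
    · rintro ⟨v, rfl⟩
      exact ⟨_, hmem v, rfl⟩
    · rintro ⟨⟨v, z⟩, hvz, rfl⟩
      exact ⟨⟨v, mem_subshift_of_mem_limitSet hs hu hvz⟩, ((hh _ _).1 hvz).symm⟩
  have hT : ∀ v, h v ∈ domT (θ, ε) → T (θ, ε) (h v) = h (subshiftMap u v) := by
    intro v hv
    rw [domT_eq] at hv
    obtain ⟨c, hc⟩ := hv
    refine (hh _ _).1 ?_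
    rw [T_eq_map hc, ← show (v : ℕ → Letter) 0 = c from limitSet_letter (hmem v) hc]
    exact next_mem_limitSet hs (hmem v)
  have hm := measurePreserving_map_volume hψ hψα
  have hprob : IsProbabilityMeasure (volume.map ψ) :=
    Measure.isProbabilityMeasure_map hψ.aemeasurable
  have hae := ae_codes hs h2 hc hh hm
  -- a regular point of the image has only one preimage, which is its coding
  have hfibre : ∀ v : subshift u, (geo (toGeo (θ, ε))).Codes ((v : ℕ → Letter), h v) →
      ∀ v' : subshift u, h v' = h v → v' = v := by
    intro v hv v' he
    have h3 := codes_of_mem_limitSet hs (hmem v') (by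
      simp only [he]; exact mem_regularSet_of_codes hs hv)
    rw [he] at h3
    exact Subtype.ext (h3.ext geo_cell_disjoint hv)
  refine ⟨u, hu.isLimitWord hθ h0 hθ₁, hα.isSturmian, h, hc, hrange, hT, volume.map ψ, hprob, hm,
    fun m' _ hm' => eq_map_volume hα.irrational hπ.measurable hψ hπα hΓ hinv hm',
    hae.mono fun v hv => mem_regularSet_of_codes hs hv, hae.mono hfibre, α, hα.irrational, ?_⟩
  refine isMeasurablyConjugate hc hπ.measurable hψ hπα hψα hπψ
    (V := {v | (geo (toGeo (θ, ε))).Codes ((v : ℕ → Letter), h v)} ∩ (π ⁻¹' Γ)ᶜ)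
    ((measurableSet_codes hc).inter (hπ.measurable hΓ.measurableSet).compl) ?_ ?_ (fun v hv => hinv v hv.2)
    (fun v hv w _ he => (hfibre v hv.1 w he.symm).symm)
    (fun v hv => ⟨hrange ▸ mem_range_self v, mem_regularSet_of_codes hs hv.1⟩) ?_
  · have h3 : (volume.map ψ) (π ⁻¹' Γ) = 0 := by
      rw [Measure.map_apply hψ (hπ.measurable hΓ.measurableSet), ← preimage_comp,
        show π ∘ ψ = id from funext hπψ, preimage_id, volume_eq_zero_of_countable hΓ]
    rw [compl_inter, compl_compl]
    exact measure_union_null hae h3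
  · rintro v ⟨hv, hvΓ⟩
    have hn : (h (subshiftMap u v)) = ((geo (toGeo (θ, ε))).next ((v : ℕ → Letter), h v)).2 :=
      ((hh _ _).1 (next_mem_limitSet hs (hmem v))).symm
    refine ⟨?_, ?_⟩
    · simp only [mem_ofPred_eq, hn]
      exact hv.next
    · rw [mem_compl_iff, mem_preimage, hπα, hΓα]
      exact hvΓ
  · rintro v ⟨hv, -⟩
    refine hT v ?_
    rw [domT_eq]
    exact ⟨_, hv.mem⟩
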